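/- **Theorem (Convergence of biased RS-RSG).** *Game.* Let $N\ge 1$, $n_i\ge 1$, $\eta>0$, and let $\xi$ be a random variable. For $i=1,\dots,N$ let $X_i\subseteq\mathbb R^{n_i}$ and $Y_i\subseteq\mathbb R^{\kappa_i}$ be closed and convex, let $U_i$ be an open set containing $X_{i}+\eta\mathbb B$ ($\mathbb B$ the closed unit ball), and put $X=\prod_i X_i$. Consider the game in which player $i$ solves $$\min_{x_i\in X_i}\ \mathbb E[\tilde h_i(x_i,y_i(x_i),\xi)]+\mathbb E[\tilde m_i(x_i,x_{-i},\xi)],$$ where, for every $x_i\in U_i$, $y_i(x_i)$ is a solution of the variational inequality $\mathrm{VI}(Y_i,\mathbb E[\tilde F_i(x_i,\bullet,\xi)])$. Put $h_i(x_i)=\mathbb E[\tilde h_i(x_i,y_i(x_i),\xi)]$ and $m_i(x)=\mathbb E[\tilde m_i(x,\xi)]$; all these expectations are assumed to exist and the data to be measurable. Assume that $x_i\mapsto\tilde h_i(x_i,y_i(x_i),\xi)$ is $L_i$-Lipschitz on $U_i$ for every $\xi$ and that $\tilde m_i(\bullet,x_{-i},\xi)$ is continuously differentiable near $X_i$ for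 every $x_{-i}\in X_{-i}$ and every $\xi$. The smoothed game has the objectives $f_i^{\mathrm{HI},\eta}(x)=\mathbb E_u[h_i(x_i+\eta u)]+m_i(x)$ with $u$ uniform on $\mathbb B$; put $F^{\mathrm{HI},\eta}(x)=(\nabla_{x_i}f_i^{\mathrm{HI},\eta}(x))_{i=1}^N$ and $G^{\mathrm{HI},\eta}_\gamma(x)=\frac1\gamma\big(x-\Pi_X[x-\gamma F^{\mathrm{HI},\eta}(x)]\big)$. *Assumptions.* (D1) The smoothed game has on $X$ a potential function $P$ that is $L^{\mathrm{HI}}$-smooth on $X$, $L^{\mathrm{HI}}>0$, and attains its maximum $P_{\max}$ and minimum $P_{\min}$ over $X$; $P_{\min}<P_{\max}$. (D2) For all $x\in X$ and all $i$, $m_i$ is differentiable in $x_i$ at $x$ and $\mathbb E[\nabla_{x_i}\tilde m_i(x,\xi)]=\nabla_{x_i}m_i(x)$. (D3) For all $x\in X$ and all $i$, $\mathbb E\|\nabla_{x_i}\tilde m_i(x,\xi)-\nabla_{x_i}m_i(x)\|^2\le\sigma_m^2$, where $\sigma_m>0$. (D4) $\tilde F_i(x_i,\bullet,\xi)$ is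 $\mu_i$-strongly monotone on $Y_i$, $\mu_i>0$, for all $x_i\in U_i$ and all $\xi$. (D5) $\tilde h_i(x_i,\bullet,\xi)$ is $L_i^y$-Lipschitz on $Y_i$ for all $x_i\in U_i$ and all $\xi$. *Lower level.* Fix $\alpha_0>\max_i 1/(2\mu_i)$, $\Gamma>0$, $y_i^0\in Y_i$ and numbers $t_k\in\mathbb N$. For $\hat x_i\in X_i+\eta\mathbb B$, the SA scheme started at $y_i^0$ makes $t_k$ steps $y^{t+1}=\Pi_{Y_i}[y^t-\frac{\alpha_0}{t+\Gamma}\tilde F_i(\hat x_i,y^t,\xi^t)]$ with i.i.d. realizations $\xi^t$ of $\xi$ and returns $y_i^{\epsilon_k}(\hat x_i)=y^{t_k}$. Assume that $\mathbb E\|\tilde F_i(\hat x_i,y,\xi)-\mathbb E[\tilde F_i(\hat x_i,y,\xi)]\|^2\le v_i^2$ and $\|\mathbb E[\tilde F_i(\hat x_i,y,\xi)]\|\le c_{F_i}$ for all $\hat x_i\in X_i+\eta\mathbb B$ and $y\in Y_i$, and define $$\epsilon_k=\frac{1}{t_k+\Gamma}\max_{i}\max\Big\{\frac{(c_{F_i}^2+v_i^2)\alpha_0^2}{2\mu_i\alpha_0-1},\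 \Gamma\sup_{y\in Y_i}\|y_i^0-y\|^2\Big\},\qquad \mu_k^{\mathrm{HI}}=\eta^{-1}n_{\max}L^y_{\max}\sqrt{\epsilon_k},$$ where $n_{\max},L_{\max},L^y_{\max}$ are the maxima over $i$ of $n_i,L_i,L_i^y$. Assume $\epsilon_k\le\epsilon^{\mathrm{up}}$ for all $k$, with $\epsilon^{\mathrm{up}}>0$, and put $$\sigma^{\mathrm{HI}}=\Big(\tfrac{4n_{\max}^2(L^y_{\max})^2\epsilon^{\mathrm{up}}}{\eta^2}+64\sqrt{2\pi}\,L_{\max}^2n_{\max}+2\sigma_m^2\Big)^{1/2},\qquad D^{\mathrm{HI}}=\Big(\tfrac{P_{\max}-P_{\min}}{L^{\mathrm{HI}}}\Big)^{1/2}.$$ *Scheme.* Let $M_0,M_1\in\mathbb N$ be the numbers of available zeroth- and first-order stochastic oracle calls, and let $$M=\min\{M_0/2,M_1\},\quad S=\Big\lceil\tfrac{\sigma^{\mathrm{HI}}\sqrt{6M}}{4L^{\mathrm{HI}}D^{\mathrm{HI}}}\Big\rceil,\quad T=\min\Big\{\Big\lfloor\tfrac{M_0/2}{SN}\Big\rfloor,\Big\lfloor\tfrac{M_1}{SN}\Big\rfloor\Big\}.$$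 From $x^0\in X$ the scheme iterates $x_i^{k+1}=\Pi_{X_i}\big[x_i^k-\gamma_k\frac1S\sum_{l=1}^S\Delta^k_{i,l}\big]$ with $$\Delta_{i,l}^k=\tfrac{n_i}{2\eta}\Big(\tilde h_i\big(x_i^k+v,y_i^{\epsilon_k}(x_i^k+v),\xi'\big)-\tilde h_i\big(x_i^k-v,y_i^{\epsilon_k}(x_i^k-v),\xi'\big)\Big)\tfrac{v}{\|v\|}+\nabla_{x_i}\tilde m_i(x^k,\xi'),$$ where $\xi'=\xi^k_{i,l}$ is a realization of $\xi$, $v=v^k_{i,l}$ is uniform on the sphere of radius $\eta$ in $\mathbb R^{n_i}$, and all of these, and all realizations used in the SA calls, are independent. Let $\gamma_k=1/(2L^{\mathrm{HI}})$ for $k=1,\dots,T$, and let the output index $R$ be uniform on $\{1,\dots,T\}$ and independent of all the other draws. *Conclusion.* If $M_0$ and $M_1$ are sufficiently large, then $T\ge1$; and whenever $T\ge 1$, the following expectation is finite and $$\mathbb E\big[\|G^{\mathrm{HI},\eta}_{\gamma_R}(x^R)\|^2\big]\le\frac{48(L^{\mathrm{HI}})^2(D^{\mathrm{HI}})^2N}{M}+\frac{60\sqrt6\,(L^{\mathrm{HI}})^2(D^{\mathrm{HI}})^2N\sigma^{\mathrm{HI}}+18\sqrt6\,N^2\sigma^{\mathrm{HI}}\sum_{k=1}^{T}(\mu_k^{\mathrm{HI}})^2}{L^{\mathrm{HI}}D^{\mathrm{HI}}\sqrt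 M}.$$ -/

import Mathlib

open MeasureTheory ProbabilityTheory
open scoped NNReal ENNReal

noncomputable section

namespace HierGame

/-- The Euclidean space `ℝᵈ`. -/
abbrev Eu (d : ℕ) : Type := EuclideanSpace ℝ (Fin d)

/-- Strategy profiles `x = (x₁, …, x_N) ∈ ℝ^{n₁} × ⋯ × ℝ^{n_N}`, with the Euclidean norm. -/
abbrev Profile {N : ℕ} (n : Fin N → ℕ) : Type := PiLp 2 (fun i => Eu (n i))

/-- The profile `(z, x_{-i})`: block `i` of `x` is replaced by `z`. -/
def upd {N : ℕ} {n : Fin N → ℕ} (x : Profile n) (i : Fin N) (z : Eu (n i)) : Profile n :=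
  WithLp.toLp 2 (Function.update (WithLp.ofLp x) i z)

section Projection

variable {E : Type*} [NormedAddCommGroup E] [InnerProductSpace ℝ E]

/-- The Euclidean projection `Π_K[x]`: a point of `K` nearest to `x`. It exists and is unique if
`K` is nonempty, closed and convex; `x` is a default value if there is no nearest point. -/
def proj (K : Set E) (x : E) : E :=
  open Classical in
  if hp : ∃ p ∈ K, ∀ q ∈ K, ‖x - p‖ ≤ ‖x - q‖ then hp.choose else x

theorem proj_spec [FiniteDimensional ℝ E] {K : Set E} (hne : K.Nonempty) (hcl : IsClosed K)
    (x : E) : proj K x ∈ K ∧ ∀ q ∈ K, ‖x - proj K x‖ ≤ ‖x - q‖ := by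
  have : ProperSpace E := FiniteDimensional.proper ℝ E
  have hp : ∃ p ∈ K, ∀ q ∈ K, ‖x - p‖ ≤ ‖x - q‖ := by
    obtain ⟨p, hpK, hpd⟩ := hcl.exists_infDist_eq_dist hne x
    refine ⟨p, hpK, fun q hq => ?_⟩
    rw [← dist_eq_norm, ← dist_eq_norm, ← hpd]
    exact Metric.infDist_le_dist_of_mem hq
  unfold proj
  rw [dif_pos hp]
  exact hp.choose_spec

/-- `y` solves the variational inequality `VI(K, Φ)`. -/
def SolvesVI (Φ : E → E) (K : Set E) (y : E) : Prop :=
  y ∈ K ∧ ∀ z ∈ K, 0 ≤ inner ℝ (Φ y) (z - y)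

/-- `Φ` is `μ`-strongly monotone on `K`. -/
def StronglyMonotoneOn (μ : ℝ) (Φ : E → E) (K : Set E) : Prop :=
  ∀ a ∈ K, ∀ b ∈ K, μ * ‖a - b‖ ^ 2 ≤ inner ℝ (Φ a - Φ b) (a - b)

/-- `P` is `L`-smooth on `K`: it has on `K` a gradient that is `L`-Lipschitz. -/
def IsSmoothOn [CompleteSpace E] (L : ℝ) (P : E → ℝ) (K : Set E) : Prop :=
  ∃ g : E → E, (∀ x ∈ K, HasGradientWithinAt P (g x) K x) ∧
    ∀ x ∈ K, ∀ x' ∈ K, ‖g x - g x'‖ ≤ L * ‖x - x'‖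

end Projection

/-- The randomized smoothing `f^η(x) = 𝔼[f(x + ηu)]`, `u` uniform on the unit ball. -/
def ballSmooth {d : ℕ} (η : ℝ) (f : Eu d → ℝ) (x : Eu d) : ℝ :=
  ⨍ u in Metric.closedBall (0 : Eu d) 1, f (x + η • u)

/-- The uniform distribution on the sphere of radius `η` about the origin of `ℝᵈ`. -/
def sphereUniform (d : ℕ) (η : ℝ) : Measure (Eu d) :=
  (((volume : Measure (Eu d)).toSphere Set.univ)⁻¹ • (volume : Measure (Eu d)).toSphere).map
    (fun w : Metric.sphere (0 : Eu d) 1 => η • (w : Eu d))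

/-- The data of a stochastic `N`-player hierarchical game: player `i` has `x_i ∈ X_i ⊆ ℝ^{n_i}` and
a lower-level variable in `Y_i ⊆ ℝ^{κ_i}`; `ξ` has values in `Ξ`. -/
structure Game {N : ℕ} (n κ : Fin N → ℕ) (Ξ : Type*) where
  /-- upper-level feasible sets -/
  X : ∀ i, Set (Eu (n i))
  /-- open sets of parameters `x_i` for which the lower-level problem is given -/
  U : ∀ i, Set (Eu (n i))
  /-- lower-level feasible sets -/
  Y : ∀ i, Set (Eu (κ i))
  /-- the terms `h̃_i(x_i, y_i, ξ)` -/
  h : ∀ i, Eu (n i) → Eu (κ i) → Ξ → ℝ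
  /-- the coupling terms `m̃_i(x, ξ)` -/
  m : Fin N → Profile n → Ξ → ℝ
  /-- the lower-level maps `F̃_i(x_i, y_i, ξ)` -/
  F : ∀ i, Eu (n i) → Eu (κ i) → Ξ → Eu (κ i)
  /-- the lower-level solution maps `y_i(x_i)` -/
  y : ∀ i, Eu (n i) → Eu (κ i)

section Model

variable {N : ℕ} {n κ : Fin N → ℕ} {Ξ : Type*} [MeasurableSpace Ξ]

/-- `X = X₁ × ⋯ × X_N`. -/
def Game.XX (G : Game n κ Ξ) : Set (Profile n) := {x | ∀ i, x i ∈ G.X i}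

/-- `X_i + ηB`. -/
def Game.Xη (G : Game n κ Ξ) (η : ℝ) (i : Fin N) : Set (Eu (n i)) :=
  {z | ∃ x ∈ G.X i, ‖z - x‖ ≤ η}

/-- The expected lower-level map `𝔼[F̃_i(x_i, y_i, ξ)]`. -/
def Game.meanF (G : Game n κ Ξ) (ν : Measure Ξ) (i : Fin N) (x : Eu (n i)) (y : Eu (κ i)) :
    Eu (κ i) := ∫ ξ, G.F i x y ξ ∂ν

/-- The implicit function `x_i ↦ h_i(x_i, y_i(x_i)) = 𝔼[h̃_i(x_i, y_i(x_i), ξ)]`. -/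
def Game.hImp (G : Game n κ Ξ) (ν : Measure Ξ) (i : Fin N) (x : Eu (n i)) : ℝ :=
  ∫ ξ, G.h i x (G.y i x) ξ ∂ν

/-- `m_i(x) = 𝔼[m̃_i(x, ξ)]`. -/
def Game.meanM (G : Game n κ Ξ) (ν : Measure Ξ) (i : Fin N) (x : Profile n) : ℝ :=
  ∫ ξ, G.m i x ξ ∂ν

/-- `∇_{x_i} m̃_i(x_i, x_{-i}, ξ)`. -/
def Game.gradM (G : Game n κ Ξ) (i : Fin N) (x : Profile n) (ξ : Ξ) : Eu (n i) :=
  gradient (fun z => G.m i (upd x i z) ξ) (x i)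

/-- `∇_{x_i} m_i(x_i, x_{-i})`. -/
def Game.gradMeanM (G : Game n κ Ξ) (ν : Measure Ξ) (i : Fin N) (x : Profile n) : Eu (n i) :=
  gradient (fun z => G.meanM ν i (upd x i z)) (x i)

/-- The objective of player `i` in the randomized smoothed hierarchical game,
`h_i^η(x_i, y_i(x_i)) + m_i(x_i, x_{-i})`. -/
def Game.smoothedCost (G : Game n κ Ξ) (ν : Measure Ξ) (η : ℝ) (i : Fin N) (x : Profile n) : ℝ :=
  ballSmooth η (G.hImp ν i) (x i) + G.meanM ν i x

/-- `F^{HI,η}(x)`, the tuple of the players' partial gradients in the smoothed game. -/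
def Game.Fη (G : Game n κ Ξ) (ν : Measure Ξ) (η : ℝ) (x : Profile n) : Profile n :=
  WithLp.toLp 2 (fun i => gradient (fun z => G.smoothedCost ν η i (upd x i z)) (x i))

/-- The residual `G^{HI,η}_γ(x) = (x - Π_X[x - γ F^{HI,η}(x)]) / γ`. -/
def Game.residual (G : Game n κ Ξ) (ν : Measure Ξ) (η γ : ℝ) (x : Profile n) : Profile n :=
  γ⁻¹ • (x - proj G.XX (x - γ • G.Fη ν η x))

/-- `P` is a potential function, over `X`, of the randomized smoothed hierarchical game. -/
def Game.IsPotential (G : Game n κ Ξ) (ν : Measure Ξ) (η : ℝ) (P : Profile n → ℝ) : Prop :=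
  ∀ x ∈ G.XX, ∀ i, ∀ z ∈ G.X i, ∀ z' ∈ G.X i,
    P (upd x i z) - P (upd x i z') =
      G.smoothedCost ν η i (upd x i z) - G.smoothedCost ν η i (upd x i z')

/-- Standing conventions on the game: feasible sets, regularity of the objectives, and `y_i(x_i)`
being a solution of the lower-level stochastic variational inequality. -/
structure Game.Standing (G : Game n κ Ξ) (ν : Measure Ξ) (η : ℝ) (L : Fin N → ℝ≥0) : Prop where
  closed_X : ∀ i, IsClosed (G.X i)
  convex_X : ∀ i, Convex ℝ (G.X i)
  closed_Y : ∀ i, IsClosed (G.Y i)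
  convex_Y : ∀ i, Convex ℝ (G.Y i)
  open_U : ∀ i, IsOpen (G.U i)
  Xη_sub_U : ∀ i, G.Xη η i ⊆ G.U i
  measurable_h : ∀ i, Measurable (fun p : Eu (n i) × Eu (κ i) × Ξ => G.h i p.1 p.2.1 p.2.2)
  measurable_m : ∀ i, Measurable (fun p : Profile n × Ξ => G.m i p.1 p.2)
  measurable_F : ∀ i, Measurable (fun p : Eu (n i) × Eu (κ i) × Ξ => G.F i p.1 p.2.1 p.2.2)
  integrable_h : ∀ i, ∀ x ∈ G.U i, Integrable (fun ξ => G.h i x (G.y i x) ξ) ν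
  integrable_m : ∀ i, ∀ x ∈ G.XX, ∀ᶠ z in nhds (x i), Integrable (fun ξ => G.m i (upd x i z) ξ) ν
  integrable_F : ∀ i, ∀ x ∈ G.U i, ∀ y ∈ G.Y i, Integrable (fun ξ => G.F i x y ξ) ν
  lipschitz_h : ∀ i ξ, LipschitzOnWith (L i) (fun x => G.h i x (G.y i x) ξ) (G.U i)
  contDiff_m : ∀ i ξ, ∀ x ∈ G.XX, ContDiffAt ℝ 1 (fun z => G.m i (upd x i z) ξ) (x i)
  solves : ∀ i, ∀ x ∈ G.U i, SolvesVI (G.meanF ν i x) (G.Y i) (G.y i x)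

/-- Potentiality, unbiasedness, bounded second moment, strong monotonicity of the lower level, and
Lipschitz continuity in the lower-level variable. -/
structure Game.Assumptions (G : Game n κ Ξ) (ν : Measure Ξ) (η : ℝ) (P : Profile n → ℝ)
    (LHI Pmax Pmin σm : ℝ) (μ : Fin N → ℝ) (Ly : Fin N → ℝ≥0) : Prop where
  potential : G.IsPotential ν η P
  LHI_pos : 0 < LHI
  smooth : IsSmoothOn LHI P G.XX
  isGreatest : IsGreatest (P '' G.XX) Pmax
  isLeast : IsLeast (P '' G.XX) Pmin
  unbiased : ∀ i, ∀ x ∈ G.XX,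
    DifferentiableAt ℝ (fun z => G.meanM ν i (upd x i z)) (x i) ∧
      Integrable (G.gradM i x) ν ∧ ∫ ξ, G.gradM i x ξ ∂ν = G.gradMeanM ν i x
  σm_pos : 0 < σm
  second_moment : ∀ i, ∀ x ∈ G.XX,
    Integrable (fun ξ => ‖G.gradM i x ξ - G.gradMeanM ν i x‖ ^ 2) ν ∧
      ∫ ξ, ‖G.gradM i x ξ - G.gradMeanM ν i x‖ ^ 2 ∂ν ≤ σm ^ 2
  μ_pos : ∀ i, 0 < μ i
  strongly_monotone : ∀ i, ∀ x ∈ G.U i, ∀ ξ,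
    StronglyMonotoneOn (μ i) (fun y => G.F i x y ξ) (G.Y i)
  lipschitz_y : ∀ i, ∀ x ∈ G.U i, ∀ ξ, LipschitzOnWith (Ly i) (fun y => G.h i x y ξ) (G.Y i)

/-- The setting of the lower-level stochastic approximation scheme: stepsizes `α₀ / (t + Γ)`,
starting points `y_i⁰ ∈ Y_i`, an oracle with variance at most `v_i²` and mean of norm at most
`c_i`. -/
structure Game.SASetting (G : Game n κ Ξ) (ν : Measure Ξ) (η : ℝ) (μ : Fin N → ℝ) (α₀ Γ : ℝ)
    (y₀ : ∀ i, Eu (κ i)) (c v : Fin N → ℝ) : Prop where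
  α₀_gt : ∀ i, 1 / (2 * μ i) < α₀
  Γ_pos : 0 < Γ
  y₀_mem : ∀ i, y₀ i ∈ G.Y i
  variance : ∀ i, ∀ x ∈ G.Xη η i, ∀ y ∈ G.Y i,
    Integrable (fun ξ => ‖G.F i x y ξ - G.meanF ν i x y‖ ^ 2) ν ∧
      ∫ ξ, ‖G.F i x y ξ - G.meanF ν i x y‖ ^ 2 ∂ν ≤ v i ^ 2
  mean_bound : ∀ i, ∀ x ∈ G.Xη η i, ∀ y ∈ G.Y i, ‖G.meanF ν i x y‖ ≤ c i

/-- The iterates of the lower-level scheme, `y^{t+1} = Π_K[y^t - (α₀ / (t + Γ)) Φ(y^t, ξ^t)]`. -/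
def saIter {d : ℕ} (Φ : Eu d → Ξ → Eu d) (K : Set (Eu d)) (α₀ Γ : ℝ) (y₀ : Eu d) (ζ : ℕ → Ξ) :
    ℕ → Eu d
  | 0 => y₀
  | t + 1 => proj K (saIter Φ K α₀ Γ y₀ ζ t -
      (α₀ / (t + Γ)) • Φ (saIter Φ K α₀ Γ y₀ ζ t) (ζ t))

/-- What is drawn for one `(k, i, l)`: a realization `ξ`, a direction `v`, and the realizations
consumed by the two lower-level calls, at `x_i + v` and at `x_i - v`. -/
abbrev Draw (Ξ : Type*) (d : ℕ) : Type _ := Ξ × Eu d × (ℕ → Ξ) × (ℕ → Ξ)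

/-- The law of a `Draw`: all its components are independent, `v` is uniform on the sphere of radius
`η`, and all the others have the law of `ξ`. -/
def drawLaw (ν : Measure Ξ) [IsProbabilityMeasure ν] (d : ℕ) (η : ℝ) : Measure (Draw Ξ d) :=
  ν.prod ((sphereUniform d η).prod
    ((Measure.infinitePi fun _ : ℕ => ν).prod (Measure.infinitePi fun _ : ℕ => ν)))

/-- The single-sample inexact gradient estimator `Δ^{k,f}_{i,l,ε_k}` at `x`, with `t` lower-level
steps: the two-point estimator of the `h` part plus `∇_{x_i} m̃_i`. -/
def Game.estimator (G : Game n κ Ξ) (η α₀ Γ : ℝ) (y₀ : ∀ i, Eu (κ i)) (t : ℕ) (i : Fin N)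
    (x : Profile n) (w : Draw Ξ (n i)) : Eu (n i) :=
  let ξ := w.1
  let v := w.2.1
  let yplus := saIter (G.F i (x i + v)) (G.Y i) α₀ Γ (y₀ i) w.2.2.1 t
  let yminus := saIter (G.F i (x i - v)) (G.Y i) α₀ Γ (y₀ i) w.2.2.2 t
  ((n i : ℝ) / (2 * η) * (G.h i (x i + v) yplus ξ - G.h i (x i - v) yminus ξ)) • (‖v‖⁻¹ • v) +
    G.gradM i x ξ

/-- The iterates `x^k` of the biased RS-RSG scheme with stepsizes `γ k`, constant batch size `S`
and `t k` lower-level steps at iteration `k`, as a function of all the draws. -/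
def Game.iterate (G : Game n κ Ξ) (η α₀ Γ : ℝ) (y₀ : ∀ i, Eu (κ i)) (t : ℕ → ℕ) (γ : ℕ → ℝ)
    (S : ℕ)
    (x₀ : Profile n) (w : ∀ j : ℕ × Fin N × ℕ, Draw Ξ (n j.2.1)) : ℕ → Profile n
  | 0 => x₀
  | k + 1 =>
    let x := Game.iterate G η α₀ Γ y₀ t γ S x₀ w k
    WithLp.toLp 2 (fun i => proj (G.X i)
      (x i - γ k • ((S : ℝ)⁻¹ • ∑ l ∈ Finset.range S,
        G.estimator η α₀ Γ y₀ (t k) i x (w (k, i, l)))))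

/-- `max_i max {(c_i² + v_i²) α₀² / (2 μ_i α₀ - 1), Γ sup_{y ∈ Y_i} ‖y_i⁰ - y‖²}`. -/
def Game.saConst (G : Game n κ Ξ) (μ : Fin N → ℝ) (α₀ Γ : ℝ) (y₀ : ∀ i, Eu (κ i))
    (c v : Fin N → ℝ) : ℝ :=
  ⨆ i, max ((c i ^ 2 + v i ^ 2) * α₀ ^ 2 / (2 * μ i * α₀ - 1))
    (Γ * sSup ((fun y => ‖y₀ i - y‖ ^ 2) '' G.Y i))

/-- The lower-level inexactness `ε_k` after `t` steps. -/
def Game.inexactness (G : Game n κ Ξ) (μ : Fin N → ℝ) (α₀ Γ : ℝ) (y₀ : ∀ i, Eu (κ i))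
    (c v : Fin N → ℝ) (t : ℕ) : ℝ :=
  G.saConst μ α₀ Γ y₀ c v / (t + Γ)

end Model

/-- `μ_k^{HI} = η⁻¹ n_max L^y_max √ε_k`. -/
def biasHI {N : ℕ} (n : Fin N → ℕ) (Ly : Fin N → ℝ≥0) (η ε : ℝ) : ℝ :=
  η⁻¹ * ((⨆ i, n i : ℕ) : ℝ) * ((⨆ i, Ly i : ℝ≥0) : ℝ) * √ε

/-- `σ^{HI} = √(4 n_max² (L^y_max)² ε^up / η² + 64 √(2π) L_max² n_max + 2 σ_m²)`. -/
def sigmaHI {N : ℕ} (n : Fin N → ℕ) (L Ly : Fin N → ℝ≥0) (η σm εup : ℝ) : ℝ :=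
  √(4 * ((⨆ i, n i : ℕ) : ℝ) ^ 2 * ((⨆ i, Ly i : ℝ≥0) : ℝ) ^ 2 * εup / η ^ 2 +
    64 * √(2 * Real.pi) * ((⨆ i, L i : ℝ≥0) : ℝ) ^ 2 * ((⨆ i, n i : ℕ) : ℝ) + 2 * σm ^ 2)

/-- `D^{HI}(η) = ((P_max - P_min) / L^{HI}(η))^{1/2}`. -/
def DHI (LHI Pmax Pmin : ℝ) : ℝ := √((Pmax - Pmin) / LHI)

/-- `M = min {M₀ / 2, M₁}` for `M₀` zeroth-order and `M₁` first-order oracle calls. -/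
def budget (M₀ M₁ : ℕ) : ℝ := min ((M₀ : ℝ) / 2) (M₁ : ℝ)

/-- The batch size `S = ⌈σ √(6M) / (4 L D)⌉`. -/
def batchSize (σ LHI D M : ℝ) : ℕ := ⌈σ * √(6 * M) / (4 * LHI * D)⌉₊

/-- The number of iterations that the oracle calls allow,
`T = min {⌊(M₀ / 2) / (S N)⌋, ⌊M₁ / (S N)⌋}`. -/
def iterLimit (N S M₀ M₁ : ℕ) : ℕ :=
  min ⌊((M₀ : ℝ) / 2) / ((S : ℝ) * N)⌋₊ ⌊(M₁ : ℝ) / ((S : ℝ) * N)⌋₊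

end HierGame

end

/-! The scheme is inexact projected gradient descent on the potential `P`, and the bound is a
descent estimate plus the mean square error of the gradient estimates. On `X` the game map
`F^{HI,η}` and the gradient of `P` have equal inner products with feasible directions
(`inner_Fη_eq`). With stepsize `1/(2L)` one step from `x` to `x⁺` along an estimate with error `e`
satisfies `‖G(x)‖² ≤ 4L (P(x) - P(x⁺)) + ‖e‖²` (`residual_sq_le`): the inexact step is used only in
the decrease of `P`, while the residual is the exact one. Summing over `k = 1, …, T` telescopes, and
averaging over the uniform index gives `(1/T) (4L (Pmax - Pmin) + ∑ 𝔼‖e_k‖²)`.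

The error of a batch splits into a centered part, that of the estimator with exact lower-level
solutions, and a part caused by the lower level. For the centered part, the divergence theorem on
the ball, proved for Lipschitz functions by radial cutoffs, shows that the two-point estimator is
unbiased for the gradient of the ball smoothing (`hasGradientAt_ballSmooth`). Its second moment must
be of order `n_i L_i²`, whereas the pointwise bound gives only `n_i² L_i²`. The missing factor comes
from concentration: the antipodal difference is an odd Lipschitz function on the sphere. A Poincaré
inequality for odd functions of a Gaussian vector is obtained by rotating `x` into `-x` through
independent Gaussian pairs (`gaussian_poincare_of_odd`), and is transferred to the sphere by a
homogeneous extension. The resulting constant `9π²/2` lies below `64√(2π)`. Averaging `S`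
independent copies divides this variance by `S`.

For the lower level, the stochastic approximation recursion gives mean square error at most `4ε_k`
(`integral_saIter_le`). The factor 4 covers the early steps, in which the contraction factor may be
negative. Hence one estimator has mean square inexactness at most `4 (μ_k^{HI})²`. Since `x^k`
depends only on draws of earlier iterations, the estimates at a fixed point apply along the
iteration by freezing `x^k`.

It remains to insert `S` and `T` (`rate_le`). The rounding in `T` loses a factor 2. The rounding in
`S` matters only if the unrounded batch size is below 1; then `(μ_k^{HI})² ≤ (σ^{HI})²/4` puts the
bias into the `1/M` term. The constants 48, 60 and 18 leave room for these losses. -/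

namespace HierGame

/-! ### Projections onto closed convex sets. -/

section ProjectionLemmas

variable {E : Type*} [NormedAddCommGroup E] [InnerProductSpace ℝ E]

theorem eq_of_variational {K : Set E} {x p q : E} (hp : p ∈ K) (hq : q ∈ K)
    (h1 : ∀ z ∈ K, inner ℝ (x - p) (z - p) ≤ 0) (h2 : ∀ z ∈ K, inner ℝ (x - q) (z - q) ≤ 0) :
    p = q := by
  have a := h1 q hq
  have b := h2 p hp
  have h : inner ℝ (p - q) (p - q) ≤ (0 : ℝ) := by
    have e : inner ℝ (p - q) (p - q) = inner ℝ (x - p) (q - p) + inner ℝ (x - q) (p - q) := by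
      rw [show q - p = -(p - q) by abel, inner_neg_right,
        show x - p = (x - q) - (p - q) by abel, inner_sub_left (x - q) (p - q)]
      ring
    linarith
  rw [real_inner_self_eq_norm_sq] at h
  exact sub_eq_zero.1 (norm_eq_zero.1 (pow_eq_zero_iff two_ne_zero |>.1
    (le_antisymm h (sq_nonneg _))))

variable [FiniteDimensional ℝ E]

theorem proj_mem {K : Set E} (hne : K.Nonempty) (hcl : IsClosed K) (x : E) : proj K x ∈ K :=
  (proj_spec hne hcl x).1

theorem inner_sub_proj_nonpos {K : Set E} (hne : K.Nonempty) (hcl : IsClosed K)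
    (hcv : Convex ℝ K) (x : E) : ∀ z ∈ K, inner ℝ (x - proj K x) (z - proj K x) ≤ 0 := by
  obtain ⟨hm, hp⟩ := proj_spec hne hcl x
  rw [← norm_eq_iInf_iff_real_inner_le_zero hcv hm]
  have : Nonempty K := ⟨⟨_, hm⟩⟩
  apply le_antisymm
  · exact le_ciInf fun w => hp w w.2
  · exact ciInf_le ⟨0, by rintro _ ⟨w, rfl⟩; exact norm_nonneg _⟩ (⟨_, hm⟩ : K)

/-- The obtuse-angle condition determines the projection. It allows projections of two different
points to be compared, as in `residual_eq`. -/
theorem proj_eq_of_variational {K : Set E} (hcl : IsClosed K) (hcv : Convex ℝ K) {x p : E}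
    (hp : p ∈ K) (h : ∀ z ∈ K, inner ℝ (x - p) (z - p) ≤ 0) : proj K x = p :=
  eq_of_variational (proj_mem ⟨p, hp⟩ hcl x) hp (inner_sub_proj_nonpos ⟨p, hp⟩ hcl hcv x) h

theorem norm_proj_sub_proj_le {K : Set E} (hne : K.Nonempty) (hcl : IsClosed K)
    (hcv : Convex ℝ K) (x y : E) : ‖proj K x - proj K y‖ ≤ ‖x - y‖ := by
  have a := inner_sub_proj_nonpos hne hcl hcv x _ (proj_mem hne hcl y)
  have b := inner_sub_proj_nonpos hne hcl hcv y _ (proj_mem hne hcl x)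
  set p := proj K x
  set q := proj K y
  have e : inner ℝ (p - q) (p - q) =
      inner ℝ (x - p) (q - p) + inner ℝ (y - q) (p - q) + inner ℝ (x - y) (p - q) := by
    rw [show q - p = -(p - q) by abel, inner_neg_right,
      show x - p = (x - y) + (y - q) - (p - q) by abel, inner_sub_left _ (p - q),
      inner_add_left]
    ring
  rw [real_inner_self_eq_norm_sq] at e
  have c := real_inner_le_norm (x - y) (p - q)
  by_contra hlt
  push Not at hlt
  nlinarith [norm_nonneg (x - y), norm_nonneg (p - q)]

theorem continuous_proj {K : Set E} (hne : K.Nonempty) (hcl : IsClosed K)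
    (hcv : Convex ℝ K) : Continuous (proj K) := by
  have : LipschitzWith 1 (proj K) := LipschitzWith.of_dist_le_mul fun x y => by
    simpa [dist_eq_norm] using norm_proj_sub_proj_le hne hcl hcv x y
  exact this.continuous

theorem proj_of_mem {K : Set E} (hcl : IsClosed K) (hcv : Convex ℝ K) {x : E} (hx : x ∈ K) :
    proj K x = x :=
  proj_eq_of_variational hcl hcv hx (by simp)

end ProjectionLemmas

/-! ### Descent along inexact projected gradient steps. -/

section Descent

variable {E : Type*} [NormedAddCommGroup E] [InnerProductSpace ℝ E] [CompleteSpace E]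

/-- The derivative of a function along a segment, from its gradient within a convex set. -/
theorem hasDerivWithinAt_segment {K : Set E} (hK : Convex ℝ K) {P : E → ℝ} {g : E → E}
    (hg : ∀ x ∈ K, HasGradientWithinAt P (g x) K x) {x p : E} (hx : x ∈ K) (hp : p ∈ K)
    {s : ℝ} (hs : s ∈ Set.Icc (0 : ℝ) 1) :
    HasDerivWithinAt (fun s : ℝ => P (x + s • (p - x)))
      (inner ℝ (g (x + s • (p - x))) (p - x)) (Set.Icc 0 1) s := by
  have hm : Set.MapsTo (fun s : ℝ => x + s • (p - x)) (Set.Icc 0 1) K := fun s hs =>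
    hK.add_smul_sub_mem hx hp hs
  have h1 := (hg _ (hm hs)).hasFDerivWithinAt
  have h2 : HasDerivWithinAt (fun s : ℝ => x + s • (p - x)) (p - x) (Set.Icc 0 1) s := by
    simpa using (((hasDerivAt_id s).smul_const (p - x)).const_add x).hasDerivWithinAt
  simpa [Function.comp_def] using h1.comp_hasDerivWithinAt s h2 hm

/-- The descent lemma. As `P` has a gradient only within `K`, one-sided derivatives along the
segment are compared with those of the quadratic `B`; no integral is needed. -/
theorem IsSmoothOn.le_add {K : Set E} (hK : Convex ℝ K) {P : E → ℝ} {g : E → E} {L : ℝ}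
    (hg : ∀ x ∈ K, HasGradientWithinAt P (g x) K x)
    (hL : ∀ x ∈ K, ∀ x' ∈ K, ‖g x - g x'‖ ≤ L * ‖x - x'‖) {x p : E} (hx : x ∈ K) (hp : p ∈ K) :
    P p ≤ P x + inner ℝ (g x) (p - x) + L / 2 * ‖p - x‖ ^ 2 := by
  set φ : ℝ → ℝ := fun s => P (x + s • (p - x))
  set B : ℝ → ℝ := fun s => P x + s * inner ℝ (g x) (p - x) + L / 2 * s ^ 2 * ‖p - x‖ ^ 2
  have hd := fun s hs => hasDerivWithinAt_segment hK hg hx hp (s := s) hs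
  have hB : ∀ s, HasDerivAt B (inner ℝ (g x) (p - x) + L * s * ‖p - x‖ ^ 2) s := fun s => by
    have := (((hasDerivAt_id s).mul_const (inner ℝ (g x) (p - x))).const_add (P x)).add
      ((((hasDerivAt_id s).pow 2).const_mul (L / 2)).mul_const (‖p - x‖ ^ 2))
    refine (this.congr_deriv ?_)
    simp only [id, Nat.cast_ofNat, Nat.add_one_sub_one, pow_one, mul_one]
    ring
  have key := image_le_of_deriv_right_le_deriv_boundary (f := φ) (a := 0) (b := 1)
    (fun s hs => (hd s hs).continuousWithinAt)
    (fun s hs => ((hd s ⟨hs.1, hs.2.le⟩).mono_of_mem_nhdsWithin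
      (Icc_mem_nhdsGE_of_mem hs))) (B := B) (by simp [φ, B])
    (fun s _ => (hB s).continuousAt.continuousWithinAt)
    (fun s _ => (hB s).hasDerivWithinAt) ?_ (Set.right_mem_Icc.2 zero_le_one)
  · simpa [φ, B] using key
  · intro s hs
    have hmem : x + s • (p - x) ∈ K := hK.add_smul_sub_mem hx hp ⟨hs.1, hs.2.le⟩
    have h1 := hL _ hmem _ hx
    have h2 := real_inner_le_norm (g (x + s • (p - x)) - g x) (p - x)
    rw [inner_sub_left] at h2
    have h3 : ‖x + s • (p - x) - x‖ = s * ‖p - x‖ := by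
      rw [add_sub_cancel_left, norm_smul, Real.norm_of_nonneg hs.1]
    rw [h3] at h1
    nlinarith [norm_nonneg (p - x)]

/-- One inexact projected gradient step with stepsize `1 / (2 L)`: the squared norm of the exact
residual is controlled by the decrease of the potential and by the error `e` of the gradient. -/
theorem residual_sq_le {K : Set E} (hK : Convex ℝ K) {P : E → ℝ} {g : E → E} {L : ℝ}
    (hLpos : 0 < L) (hg : ∀ x ∈ K, HasGradientWithinAt P (g x) K x)
    (hL : ∀ x ∈ K, ∀ x' ∈ K, ‖g x - g x'‖ ≤ L * ‖x - x'‖) {x p q F e : E} (hx : x ∈ K)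
    (hp : p ∈ K) (hq : q ∈ K)
    (hF : ∀ z ∈ K, inner ℝ F (z - x) = inner ℝ (g x) (z - x))
    (hpv : ∀ z ∈ K, inner ℝ (x - (1 / (2 * L)) • F - p) (z - p) ≤ 0)
    (hqv : ∀ z ∈ K, inner ℝ (x - (1 / (2 * L)) • (F + e) - q) (z - q) ≤ 0) :
    ‖(1 / (2 * L))⁻¹ • (x - p)‖ ^ 2 ≤ 4 * L * (P x - P q) + ‖e‖ ^ 2 := by
  have hs := IsSmoothOn.le_add hK hg hL hx hq
  rw [← hF q hq] at hs
  have a1 := hpv x hx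
  have a2 := hqv p hp
  have hc := real_inner_le_norm e (p - q)
  -- Here `a` is the exact step and `b` the deviation of the inexact one, so that `x - q = a + b`.
  set a := x - p with ha
  set b := p - q with hb
  have e1 : q - x = -(a + b) := by rw [ha, hb]; abel
  have e2 : x - (1 / (2 * L)) • F - p = a - (1 / (2 * L)) • F := by rw [ha]; abel
  have e3 : x - (1 / (2 * L)) • (F + e) - q = a + b - (1 / (2 * L)) • (F + e) := by
    rw [ha, hb]; abel
  rw [e2, inner_sub_left, real_inner_smul_left, real_inner_self_eq_norm_sq] at a1
  rw [e3, inner_sub_left, real_inner_smul_left, inner_add_left, inner_add_left,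
    real_inner_self_eq_norm_sq] at a2
  rw [e1, norm_neg, inner_neg_right, inner_add_right, norm_add_sq_real] at hs
  rw [norm_smul, mul_pow, Real.norm_eq_abs, sq_abs]
  have hL2 : (1 / (2 * L))⁻¹ = 2 * L := by field_simp
  have b1 : 2 * L * ‖a‖ ^ 2 ≤ inner ℝ F a := by
    have := mul_le_mul_of_nonneg_left a1 (by positivity : 0 ≤ 2 * L)
    field_simp at this
    linarith
  have b2 : 2 * L * (inner ℝ a b + ‖b‖ ^ 2) ≤ inner ℝ F b + inner ℝ e b := by
    have := mul_le_mul_of_nonneg_left a2 (by positivity : 0 ≤ 2 * L)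
    field_simp at this
    linarith
  rw [hL2]
  -- Together, `P x - P q ≥ L‖a‖² + L‖b‖² + (L/2)‖a + b‖² - ‖e‖‖b‖`. After multiplication by `4L`,
  -- the error is absorbed by `4L‖e‖‖b‖ ≤ 4L²‖b‖² + ‖e‖²`.
  have hab : 0 ≤ ‖a + b‖ ^ 2 := by positivity
  rw [norm_add_sq_real] at hab
  nlinarith [sq_nonneg (2 * L * ‖b‖ - ‖e‖), norm_nonneg b, norm_nonneg e]

end Descent

/-! ### Radial cutoff functions and their directional derivatives. -/

section Cutoff

open Set Filter Topology

variable {E : Type*} [NormedAddCommGroup E] [InnerProductSpace ℝ E]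

/-- The derivative of the norm along a line. -/
theorem hasDerivAt_norm_line {x : E} (hx : x ≠ 0) (v : E) :
    HasDerivAt (fun t : ℝ => ‖x + t • v‖) (inner ℝ v (‖x‖⁻¹ • x)) 0 := by
  have h1 : HasDerivAt (fun t : ℝ => x + t • v) v 0 := by
    simpa using ((hasDerivAt_id (0 : ℝ)).smul_const v).const_add x
  have h2 := h1.norm_sq.sqrt (by simp [hx])
  simp only [Real.sqrt_sq (norm_nonneg _), zero_smul, add_zero] at h2
  refine h2.congr_deriv ?_
  have : ‖x‖ ≠ 0 := norm_ne_zero_iff.2 hx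
  rw [real_inner_smul_right, real_inner_comm]
  field_simp

/-- Radial cutoff, equal to `1` on `[0, 1]` and to `0` beyond `1 + δ`. -/
noncomputable def cutoff (δ s : ℝ) : ℝ := max 0 (min 1 ((1 + δ - s) * δ⁻¹))

theorem lipschitzWith_cutoff {δ : ℝ} (hδ : 0 < δ) : LipschitzWith (δ⁻¹).toNNReal (cutoff δ) := by
  refine LipschitzWith.const_max (LipschitzWith.const_min ?_ 1) 0
  refine LipschitzWith.of_dist_le_mul fun a b => ?_
  rw [Real.coe_toNNReal _ (by positivity), Real.dist_eq, Real.dist_eq, ← sub_mul, abs_mul,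
    abs_of_pos (inv_pos.2 hδ), mul_comm, abs_sub_comm]
  simp

theorem cutoff_of_le {δ s : ℝ} (hδ : 0 < δ) (hs : s ≤ 1) : cutoff δ s = 1 := by
  have : 1 ≤ (1 + δ - s) * δ⁻¹ := by
    rw [← div_eq_mul_inv, le_div_iff₀ hδ]; linarith
  simp [cutoff, this]

theorem cutoff_of_ge {δ s : ℝ} (hδ : 0 < δ) (hs : 1 + δ ≤ s) : cutoff δ s = 0 := by
  have : (1 + δ - s) * δ⁻¹ ≤ 0 :=
    mul_nonpos_of_nonpos_of_nonneg (by linarith) (inv_nonneg.2 hδ.le)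
  simp only [cutoff]
  exact max_eq_left ((min_le_right _ _).trans this)

theorem cutoff_of_mem {δ s : ℝ} (hδ : 0 < δ) (h1 : 1 ≤ s) (h2 : s ≤ 1 + δ) :
    cutoff δ s = (1 + δ - s) * δ⁻¹ := by
  have h3 : (1 + δ - s) * δ⁻¹ ≤ 1 := by
    rw [← div_eq_mul_inv, div_le_one hδ]; linarith
  have h4 : 0 ≤ (1 + δ - s) * δ⁻¹ := mul_nonneg (by linarith) (inv_nonneg.2 hδ.le)
  simp [cutoff, h3, h4]

theorem cutoff_nonneg (δ s : ℝ) : 0 ≤ cutoff δ s := le_max_left _ _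

theorem cutoff_le_one (δ s : ℝ) : cutoff δ s ≤ 1 := max_le zero_le_one (min_le_left _ _)

/-- The direction is `-v` because integration by parts moves the derivative with this sign. The two
excluded spheres are the kinks of the cutoff. -/
theorem lineDeriv_cutoff_norm {δ : ℝ} (hδ : 0 < δ) (v : E) {x : E} (h1 : ‖x‖ ≠ 1)
    (h2 : ‖x‖ ≠ 1 + δ) :
    lineDeriv ℝ (fun x : E => cutoff δ ‖x‖) x (-v) =
      (Ico 1 (1 + δ)).indicator (fun _ => 1) ‖x‖ * (δ⁻¹ * inner ℝ v (‖x‖⁻¹ • x)) := by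
  have hc : Continuous fun t : ℝ => ‖x + t • (-v)‖ := by fun_prop
  have hc0 : Tendsto (fun t : ℝ => ‖x + t • (-v)‖) (𝓝 0) (𝓝 ‖x‖) := by
    simpa using hc.tendsto 0
  rw [lineDeriv]
  rcases lt_or_gt_of_ne h1 with h | h
  · have : (fun t : ℝ => cutoff δ ‖x + t • (-v)‖) =ᶠ[𝓝 0] fun _ => 1 := by
      filter_upwards [hc0.eventually (gt_mem_nhds h)] with t ht
      exact cutoff_of_le hδ ht.le
    rw [this.deriv_eq]
    simp [h]
  · rcases lt_or_gt_of_ne h2 with h' | h'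
    · have : (fun t : ℝ => cutoff δ ‖x + t • (-v)‖) =ᶠ[𝓝 0]
          fun t => (1 + δ - ‖x + t • (-v)‖) * δ⁻¹ := by
        filter_upwards [hc0.eventually (gt_mem_nhds h'), hc0.eventually (lt_mem_nhds h)]
          with t ht ht'
        exact cutoff_of_mem hδ ht'.le ht.le
      rw [this.deriv_eq]
      have hx : x ≠ 0 := by
        rintro rfl
        simp at h
        linarith
      have h3 := ((hasDerivAt_norm_line hx (-v)).const_sub (1 + δ)).mul_const δ⁻¹
      rw [h3.deriv, inner_neg_left, indicator_of_mem (by exact ⟨h.le, h'⟩)]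
      ring
    · have : (fun t : ℝ => cutoff δ ‖x + t • (-v)‖) =ᶠ[𝓝 0] fun _ => 0 := by
        filter_upwards [hc0.eventually (lt_mem_nhds h')] with t ht
        exact cutoff_of_ge hδ ht.le
      rw [this.deriv_eq, indicator_of_notMem (by simp [h'.le])]
      simp

theorem abs_lineDeriv_le {f : E → ℝ} {C : ℝ≥0} (hf : LipschitzWith C f) (v x : E) :
    |lineDeriv ℝ f x v| ≤ C * ‖v‖ :=
  norm_lineDeriv_le_of_lipschitz ℝ hf

theorem abs_inner_direction_le (v x : E) : |inner ℝ v (‖x‖⁻¹ • x)| ≤ ‖v‖ := by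
  refine (abs_real_inner_le_norm _ _).trans ?_
  have : ‖‖x‖⁻¹ • x‖ ≤ 1 := by
    rw [norm_smul, norm_inv, norm_norm]
    exact inv_mul_le_one
  exact mul_le_of_le_one_right (norm_nonneg _) this

end Cutoff

/-! ### Polar coordinates and the divergence theorem on the unit ball. -/

section Polar

open Set Metric Filter Topology Measure

variable {E : Type*} [NormedAddCommGroup E] [InnerProductSpace ℝ E] [MeasurableSpace E]
  [BorelSpace E] [FiniteDimensional ℝ E] (μ : Measure E) [μ.IsAddHaarMeasure]

/-- The cutoffs converge pointwise to the indicator of the closed unit ball. For `δ < 1` they vanish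
outside the ball of radius 2, where the constant `C‖v‖` is an integrable bound. -/
theorem tendsto_integral_mul_cutoff {f : E → ℝ} {C : ℝ≥0} (hf : LipschitzWith C f) (v : E) :
    Tendsto (fun δ : ℝ => ∫ x, lineDeriv ℝ f x v * cutoff δ ‖x‖ ∂μ) (𝓝[>] 0)
      (𝓝 (∫ x in closedBall (0 : E) 1, lineDeriv ℝ f x v ∂μ)) := by
  have hm : AEStronglyMeasurable (fun x => lineDeriv ℝ f x v) μ :=
    aestronglyMeasurable_lineDeriv hf.continuous μ
  rw [← integral_indicator measurableSet_closedBall]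
  refine tendsto_integral_filter_of_dominated_convergence
    ((closedBall (0 : E) 2).indicator fun _ => C * ‖v‖) ?_ ?_ ?_ ?_
  · filter_upwards [self_mem_nhdsWithin] with δ hδ
    exact hm.mul (((lipschitzWith_cutoff hδ).continuous.comp continuous_norm).aestronglyMeasurable)
  · filter_upwards [Ioo_mem_nhdsGT (zero_lt_one' ℝ)] with δ hδ
    refine .of_forall fun x => ?_
    by_cases hx : x ∈ closedBall (0 : E) 2
    · rw [indicator_of_mem hx, norm_mul, Real.norm_eq_abs, Real.norm_eq_abs,
        abs_of_nonneg (cutoff_nonneg δ ‖x‖)]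
      calc _ ≤ (C * ‖v‖) * 1 := by
            exact mul_le_mul (abs_lineDeriv_le hf v x) (cutoff_le_one _ _) (cutoff_nonneg _ _)
              (by positivity)
        _ = _ := mul_one _
    · rw [indicator_of_notMem hx]
      rw [mem_closedBall_zero_iff, not_le] at hx
      rw [cutoff_of_ge hδ.1 (by linarith [hδ.2])]
      simp
  · rw [integrable_indicator_iff measurableSet_closedBall]
    exact integrableOn_const (isCompact_closedBall _ _).measure_lt_top.ne
  · refine .of_forall fun x => ?_
    by_cases hx : x ∈ closedBall (0 : E) 1
    · rw [indicator_of_mem hx]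
      refine tendsto_const_nhds.congr' ?_
      filter_upwards [self_mem_nhdsWithin] with δ hδ
      rw [cutoff_of_le hδ (mem_closedBall_zero_iff.1 hx), mul_one]
    · rw [indicator_of_notMem hx]
      rw [mem_closedBall_zero_iff, not_le] at hx
      refine tendsto_const_nhds.congr' ?_
      filter_upwards [Ioo_mem_nhdsGT (sub_pos.2 hx)] with δ hδ
      rw [cutoff_of_ge hδ.1 (by linarith [hδ.2]), mul_zero]

variable [Nontrivial E]

/-- Integration in polar coordinates of a product of a radial and an angular function. -/
theorem integral_norm_mul_direction (φ : ℝ → ℝ) (q : E → ℝ) :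
    ∫ x, φ ‖x‖ * q (‖x‖⁻¹ • x) ∂μ =
      (∫ w : sphere (0 : E) 1, q w ∂μ.toSphere) *
        ∫ r : Ioi (0 : ℝ), φ r ∂volumeIoiPow (Module.finrank ℝ E - 1) := by
  calc
    _ = ∫ x : ({(0)}ᶜ : Set E), φ ‖x.1‖ * q (‖x.1‖⁻¹ • x.1) ∂(μ.comap (↑)) := by
      rw [integral_subtype_comap (measurableSet_singleton _).compl
        fun x => φ ‖x‖ * q (‖x‖⁻¹ • x), restrict_compl_singleton]
    _ = ∫ x, q (x.1 : E) * φ x.2 ∂μ.toSphere.prod (volumeIoiPow (Module.finrank ℝ E - 1)) := by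
      rw [← μ.measurePreserving_homeomorphUnitSphereProd.integral_comp
        (Homeomorph.measurableEmbedding _)]
      refine integral_congr_ae (.of_forall fun x => ?_)
      simp [mul_comm]
    _ = _ := integral_prod_mul (μ := μ.toSphere)
      (ν := volumeIoiPow (Module.finrank ℝ E - 1)) (fun w : sphere (0 : E) 1 => q w)
      (fun r : Ioi (0 : ℝ) => φ r)

theorem integral_norm (φ : ℝ → ℝ) :
    ∫ x, φ ‖x‖ ∂μ = μ.toSphere.real univ *
        ∫ r : Ioi (0 : ℝ), φ r ∂volumeIoiPow (Module.finrank ℝ E - 1) := by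
  simpa using integral_norm_mul_direction μ φ (fun _ => 1)

theorem toSphere_real_univ_pos : 0 < μ.toSphere.real univ := by
  rw [measureReal_def, ENNReal.toReal_pos_iff]
  refine ⟨?_, measure_lt_top _ _⟩
  rw [pos_iff_ne_zero, measure_univ_ne_zero]
  exact μ.toSphere_ne_zero

theorem integral_indicator_volumeIoiPow (k : ℕ) {δ : ℝ} (hδ : 0 < δ) :
    ∫ r : Ioi (0 : ℝ), (Ico 1 (1 + δ)).indicator (fun _ => (1 : ℝ)) r ∂volumeIoiPow k =
      ((1 + δ) ^ (k + 1) - 1) / (k + 1) := by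
  set a : Ioi (0 : ℝ) := ⟨1, mem_Ioi.2 one_pos⟩
  set b : Ioi (0 : ℝ) := ⟨1 + δ, by simp; linarith⟩
  have hab : a ≤ b := by
    rw [← Subtype.coe_le_coe]; simp [a, b, hδ.le]
  have h1 : (fun r : Ioi (0 : ℝ) => (Ico 1 (1 + δ)).indicator (fun _ => (1 : ℝ)) r) =
      (Iio b \ Iio a).indicator (fun _ => (1 : ℝ)) := by
    ext r
    have : (r : ℝ) ∈ Ico 1 (1 + δ) ↔ r ∈ Iio b \ Iio a := by
      rw [Set.mem_sdiff, mem_Iio, mem_Iio, not_lt, ← Subtype.coe_lt_coe, ← Subtype.coe_le_coe]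
      exact and_comm
    simp only [indicator, this]
  have h2 : (volumeIoiPow k).real (Iio b \ Iio a) = ((1 + δ) ^ (k + 1) - 1) / (k + 1) := by
    rw [measureReal_sdiff (Iio_subset_Iio hab) measurableSet_Iio (by
      simp [volumeIoiPow_apply_Iio])]
    simp only [measureReal_def, volumeIoiPow_apply_Iio, a, b]
    rw [ENNReal.toReal_ofReal (by positivity), ENNReal.toReal_ofReal (by positivity)]
    field_simp
    simp
  rw [h1, integral_indicator (measurableSet_Iio.diff measurableSet_Iio)]
  rw [setIntegral_const, h2, smul_eq_mul, mul_one]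

/-- The expression is a slope at 1 of `r ^ (k + 1) / (k + 1)`, whose derivative there is 1: the
radial mass of a thin shell is asymptotic to its thickness. -/
theorem tendsto_annulus (k : ℕ) :
    Tendsto (fun δ : ℝ => δ⁻¹ * (((1 + δ) ^ (k + 1) - 1) / (k + 1))) (𝓝[>] 0) (𝓝 1) := by
  have h : HasDerivAt (fun x : ℝ => x ^ (k + 1) / (k + 1)) 1 1 := by
    have := (hasDerivAt_pow (k + 1) (1 : ℝ)).div_const ((k : ℝ) + 1)
    refine this.congr_deriv ?_
    have : (k : ℝ) + 1 ≠ 0 := by positivity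
    simp [this]
  have h2 := h.tendsto_slope_zero_right
  refine h2.congr fun t => ?_
  rw [smul_eq_mul, one_pow, sub_div]

/-- Integration by parts for Lipschitz functions. The derivative of the cutoff lives on the shell `1
≤ ‖x‖ < 1 + δ`, up to two null spheres. -/
theorem integral_lineDeriv_mul_cutoff {f : E → ℝ} {C : ℝ≥0} (hf : LipschitzWith C f) (v : E)
    {δ : ℝ} (hδ : 0 < δ) :
    ∫ x, lineDeriv ℝ f x v * cutoff δ ‖x‖ ∂μ =
      ∫ x, δ⁻¹ * ((Ico 1 (1 + δ)).indicator (fun _ => 1) ‖x‖ *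
        (inner ℝ v (‖x‖⁻¹ • x) * f x)) ∂μ := by
  have hg : LipschitzWith (δ⁻¹.toNNReal * 1) (fun x : E => cutoff δ ‖x‖) :=
    (lipschitzWith_cutoff hδ).comp lipschitzWith_one_norm
  have hgc : HasCompactSupport (fun x : E => cutoff δ ‖x‖) := by
    refine HasCompactSupport.intro (isCompact_closedBall (0 : E) (1 + δ)) fun x hx => ?_
    rw [mem_closedBall_zero_iff, not_le] at hx
    exact cutoff_of_ge hδ hx.le
  rw [hf.integral_lineDeriv_mul_eq hg hgc v]
  refine integral_congr_ae ?_
  have n1 : ∀ᵐ x ∂μ, ‖x‖ ≠ 1 := by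
    have := addHaar_sphere μ (0 : E) 1
    refine measure_mono_null (fun x hx => ?_) this
    simpa using hx
  have n2 : ∀ᵐ x ∂μ, ‖x‖ ≠ 1 + δ := by
    have := addHaar_sphere μ (0 : E) (1 + δ)
    refine measure_mono_null (fun x hx => ?_) this
    simpa using hx
  filter_upwards [n1, n2] with x h1 h2
  rw [lineDeriv_cutoff_norm hδ v h1 h2]
  ring

/-- The divergence theorem on the unit ball for a Lipschitz function. -/
theorem integral_lineDeriv_closedBall {f : E → ℝ} {C : ℝ≥0} (hf : LipschitzWith C f) (v : E) :
    ∫ x in closedBall (0 : E) 1, lineDeriv ℝ f x v ∂μ =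
      ∫ w : sphere (0 : E) 1, f w * inner ℝ v (w : E) ∂μ.toSphere := by
  set k := Module.finrank ℝ E - 1
  set a : ℝ → ℝ := fun δ => δ⁻¹ * (((1 + δ) ^ (k + 1) - 1) / (k + 1))
  set A : ℝ := ∫ w : sphere (0 : E) 1, f w * inner ℝ v (w : E) ∂μ.toSphere with hA
  set s : ℝ := μ.toSphere.real univ
  -- With `f` replaced by its value at `x / ‖x‖`, the shell integral factors exactly into a sphere
  -- integral and a radial mass.
  have hmain : ∀ δ : ℝ, 0 < δ → ∫ x, δ⁻¹ * ((Ico 1 (1 + δ)).indicator (fun _ => 1) ‖x‖ *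
      (inner ℝ v (‖x‖⁻¹ • x) * f (‖x‖⁻¹ • x))) ∂μ = a δ * A := by
    intro δ hδ
    rw [integral_const_mul, integral_norm_mul_direction μ _ (fun x => inner ℝ v x * f x),
      integral_indicator_volumeIoiPow k hδ, hA]
    simp only [mul_comm (inner ℝ v _) (f _), a]
    ring
  have hint : ∀ δ : ℝ, 0 < δ →
      Integrable (fun x : E => (Ico 1 (1 + δ)).indicator (fun _ => (1 : ℝ)) ‖x‖) μ := by
    intro δ hδ
    have h : (fun x : E => (Ico 1 (1 + δ)).indicator (fun _ => (1 : ℝ)) ‖x‖) =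
        (norm ⁻¹' (Ico 1 (1 + δ)) : Set E).indicator fun _ => (1 : ℝ) := rfl
    rw [h, integrable_indicator_iff (measurable_norm measurableSet_Ico)]
    refine integrableOn_const (ne_top_of_le_ne_top
      (isCompact_closedBall (0 : E) (1 + δ)).measure_lt_top.ne (measure_mono fun x hx => ?_))
    exact mem_closedBall_zero_iff.2 hx.2.le
  have hcont : Measurable fun x : E => inner ℝ v (‖x‖⁻¹ • x) := by fun_prop
  -- The replacement changes `f` by at most `Cδ` on the shell. As the shell has mass of order `δ`,
  -- the prefactor `δ⁻¹` still leaves an error of order `δ`.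
  have hdiff : ∀ δ : ℝ, 0 < δ → |(∫ x, lineDeriv ℝ f x v * cutoff δ ‖x‖ ∂μ) - a δ * A| ≤
      δ * (C * ‖v‖ * s * a δ) := by
    intro δ hδ
    have b1 : ∀ x : E, |(Ico 1 (1 + δ)).indicator (fun _ => (1 : ℝ)) ‖x‖ *
        (inner ℝ v (‖x‖⁻¹ • x) * (f x - f (‖x‖⁻¹ • x)))| ≤
        (Ico 1 (1 + δ)).indicator (fun _ => (1 : ℝ)) ‖x‖ * (‖v‖ * (C * δ)) := by
      intro x
      by_cases hx : ‖x‖ ∈ Ico 1 (1 + δ)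
      · rw [indicator_of_mem hx, one_mul, one_mul, abs_mul]
        have h1 : |f x - f (‖x‖⁻¹ • x)| ≤ C * δ := by
          have h2 := hf.dist_le_mul x (‖x‖⁻¹ • x)
          rw [Real.dist_eq] at h2
          refine h2.trans (mul_le_mul_of_nonneg_left ?_ C.2)
          have hx0 : 0 < ‖x‖ := zero_lt_one.trans_le hx.1
          have h3 : x - ‖x‖⁻¹ • x = (1 - ‖x‖⁻¹) • x := by rw [sub_smul, one_smul]
          rw [dist_eq_norm, h3, norm_smul, Real.norm_of_nonneg
            (sub_nonneg.2 (inv_le_one_of_one_le₀ hx.1)), sub_mul, inv_mul_cancel₀ hx0.ne']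
          linarith [hx.2]
        exact mul_le_mul (abs_inner_direction_le v x) h1 (abs_nonneg _) (norm_nonneg _)
      · rw [indicator_of_notMem hx]
        simp
    have i1 : Integrable (fun x => (Ico 1 (1 + δ)).indicator (fun _ => (1 : ℝ)) ‖x‖ *
        (inner ℝ v (‖x‖⁻¹ • x) * (f x - f (‖x‖⁻¹ • x)))) μ := by
      refine ((hint δ hδ).mul_const (‖v‖ * (C * δ))).mono'
        ((hint δ hδ).aestronglyMeasurable.mul (Measurable.aestronglyMeasurable ?_)) (.of_forall b1)
      exact hcont.mul (hf.continuous.measurable.sub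
        (hf.continuous.measurable.comp (by fun_prop)))
    have i2 : Integrable (fun x => (Ico 1 (1 + δ)).indicator (fun _ => (1 : ℝ)) ‖x‖ *
        (inner ℝ v (‖x‖⁻¹ • x) * f (‖x‖⁻¹ • x))) μ := by
      have hb : ∀ x : E, |inner ℝ v (‖x‖⁻¹ • x) * f (‖x‖⁻¹ • x)| ≤ ‖v‖ * (|f 0| + C) := by
        intro x
        rw [abs_mul]
        refine mul_le_mul (abs_inner_direction_le v x) ?_ (abs_nonneg _) (norm_nonneg _)
        have h2 := hf.dist_le_mul (‖x‖⁻¹ • x) 0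
        rw [Real.dist_eq, dist_zero_right] at h2
        have h3 : ‖‖x‖⁻¹ • x‖ ≤ 1 := by
          rw [norm_smul, norm_inv, norm_norm]
          exact inv_mul_le_one
        have h4 : (C : ℝ) * ‖‖x‖⁻¹ • x‖ ≤ C := mul_le_of_le_one_right C.2 h3
        have h5 := abs_sub_abs_le_abs_sub (f (‖x‖⁻¹ • x)) (f 0)
        linarith
      refine ((hint δ hδ).mul_const (‖v‖ * (|f 0| + C))).mono'
        ((hint δ hδ).aestronglyMeasurable.mul (Measurable.aestronglyMeasurable ?_))
        (.of_forall fun x => ?_)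
      · exact hcont.mul (hf.continuous.measurable.comp (by fun_prop))
      · rw [norm_mul, Real.norm_of_nonneg (indicator_nonneg (fun _ _ => zero_le_one) _)]
        exact mul_le_mul_of_nonneg_left (hb x) (indicator_nonneg (fun _ _ => zero_le_one) _)
    have e : (∫ x, lineDeriv ℝ f x v * cutoff δ ‖x‖ ∂μ) - a δ * A =
        δ⁻¹ * ∫ x, (Ico 1 (1 + δ)).indicator (fun _ => (1 : ℝ)) ‖x‖ *
        (inner ℝ v (‖x‖⁻¹ • x) * (f x - f (‖x‖⁻¹ • x))) ∂μ := by
      rw [integral_lineDeriv_mul_cutoff μ hf v hδ, ← hmain δ hδ, integral_const_mul,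
        integral_const_mul, ← mul_sub, sub_eq_iff_eq_add.2]
      rw [← integral_add i1 i2]
      congr 1
      ext x
      ring
    rw [e, abs_mul, abs_of_pos (inv_pos.2 hδ)]
    have h1 : |∫ x, (Ico 1 (1 + δ)).indicator (fun _ => (1 : ℝ)) ‖x‖ *
        (inner ℝ v (‖x‖⁻¹ • x) * (f x - f (‖x‖⁻¹ • x))) ∂μ| ≤
        ∫ x, (Ico 1 (1 + δ)).indicator (fun _ => (1 : ℝ)) ‖x‖ * (‖v‖ * (C * δ)) ∂μ := by
      rw [← Real.norm_eq_abs]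
      exact norm_integral_le_of_norm_le ((hint δ hδ).mul_const _) (.of_forall b1)
    rw [integral_mul_const, integral_norm μ, integral_indicator_volumeIoiPow k hδ] at h1
    calc _ ≤ δ⁻¹ * _ := mul_le_mul_of_nonneg_left h1 (inv_pos.2 hδ).le
      _ = _ := by simp only [a]; ring
  have ha : Tendsto a (𝓝[>] 0) (𝓝 1) := tendsto_annulus k
  have hd : Tendsto (fun δ : ℝ => δ) (𝓝[>] 0) (𝓝 0) := tendsto_nhdsWithin_of_tendsto_nhds tendsto_id
  have h0 : Tendsto (fun δ => (∫ x, lineDeriv ℝ f x v * cutoff δ ‖x‖ ∂μ) - a δ * A) (𝓝[>] 0)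
      (𝓝 0) := by
    refine squeeze_zero_norm' ?_ (by simpa using hd.mul (ha.const_mul (C * ‖v‖ * s)))
    filter_upwards [self_mem_nhdsWithin] with δ hδ
    exact hdiff δ hδ
  have h1 := (tendsto_integral_mul_cutoff μ hf v).sub (ha.mul_const A)
  have h2 := tendsto_nhds_unique h1 h0
  linarith

end Polar
-- The uniform law on a sphere and the gradient of the ball smoothing.
section SphereUniform

open Set Metric Filter Topology Measure

variable {d : ℕ}

theorem nontrivial_eu (hd : 0 < d) : Nontrivial (Eu d) := by
  have : Nonempty (Fin d) := ⟨⟨0, hd⟩⟩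
  infer_instance

theorem measurable_smul_sphere (η : ℝ) :
    Measurable fun w : sphere (0 : Eu d) 1 => η • (w : Eu d) := by
  fun_prop

theorem isProbabilityMeasure_sphereUniform (hd : 0 < d) (η : ℝ) :
    IsProbabilityMeasure (sphereUniform d η) := by
  have := nontrivial_eu hd
  have h : IsProbabilityMeasure
      (((volume : Measure (Eu d)).toSphere univ)⁻¹ • (volume : Measure (Eu d)).toSphere) := by
    constructor
    rw [Measure.smul_apply, smul_eq_mul]
    refine ENNReal.inv_mul_cancel ?_ (measure_ne_top _ _)
    rw [measure_univ_ne_zero]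
    exact toSphere_ne_zero _
  exact isProbabilityMeasure_map (measurable_smul_sphere η).aemeasurable

theorem ae_norm_eq_sphereUniform {η : ℝ} (hη : 0 < η) : ∀ᵐ v ∂sphereUniform d η, ‖v‖ = η := by
  rw [sphereUniform, ae_map_iff (measurable_smul_sphere η).aemeasurable
    (measurableSet_eq_fun (by fun_prop) (by fun_prop))]
  refine .of_forall fun w => ?_
  rw [norm_smul, Real.norm_of_nonneg hη.le, norm_eq_of_mem_sphere, mul_one]

theorem integral_sphereUniform {F : Type*} [NormedAddCommGroup F] [NormedSpace ℝ F] {η : ℝ}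
    (hη : 0 < η) (g : Eu d → F) :
    ∫ v, g v ∂sphereUniform d η = ((volume : Measure (Eu d)).toSphere.real univ)⁻¹ •
      ∫ w : sphere (0 : Eu d) 1, g (η • (w : Eu d)) ∂(volume : Measure (Eu d)).toSphere := by
  have he : MeasurableEmbedding fun w : sphere (0 : Eu d) 1 => η • (w : Eu d) :=
    (measurableEmbedding_const_smul₀ hη.ne').comp
      (MeasurableEmbedding.subtype_coe isClosed_sphere.measurableSet)
  rw [sphereUniform, he.integral_map, integral_smul_measure, ENNReal.toReal_inv]
  rfl

/-- Lebesgue measure is invariant under negation. Polar coordinates, with the indicator of a shell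
as radial factor, pass this on to the sphere after division by the nonzero radial mass. -/
theorem integral_toSphere_neg (hd : 0 < d) (q : Eu d → ℝ) :
    ∫ w : sphere (0 : Eu d) 1, q (-(w : Eu d)) ∂(volume : Measure (Eu d)).toSphere =
      ∫ w : sphere (0 : Eu d) 1, q w ∂(volume : Measure (Eu d)).toSphere := by
  have := nontrivial_eu hd
  set φ : ℝ → ℝ := (Ico 1 (1 + 1)).indicator fun _ => 1
  have h1 := integral_norm_mul_direction (volume : Measure (Eu d)) φ q
  have h2 := integral_norm_mul_direction (volume : Measure (Eu d)) φ (fun x => q (-x))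
  rw [← integral_neg_eq_self] at h1
  simp only [norm_neg, smul_neg] at h1
  rw [h2] at h1
  refine mul_right_cancel₀ ?_ h1
  rw [integral_indicator_volumeIoiPow _ one_pos]
  have : (1 : ℝ) < (1 + 1) ^ (Module.finrank ℝ (Eu d) - 1 + 1) :=
    one_lt_pow₀ (by norm_num) (by omega)
  have h3 : 0 < ((1 : ℝ) + 1) ^ (Module.finrank ℝ (Eu d) - 1 + 1) - 1 := by linarith
  positivity

theorem map_neg_sphereUniform (hd : 0 < d) {η : ℝ} (hη : 0 < η) :
    (sphereUniform d η).map (fun v => -v) = sphereUniform d η := by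
  have := isProbabilityMeasure_sphereUniform hd η
  have : IsProbabilityMeasure ((sphereUniform d η).map (fun v => -v)) :=
    isProbabilityMeasure_map measurable_neg.aemeasurable
  ext A hA
  rw [map_apply measurable_neg hA]
  have hA' := measurable_neg (G := Eu d) hA
  rw [← measureReal_eq_measureReal_iff, ← integral_indicator_one hA, ← integral_indicator_one hA',
    integral_sphereUniform hη, integral_sphereUniform hη]
  have h := integral_toSphere_neg hd (fun w : Eu d => A.indicator (1 : Eu d → ℝ) (η • w))
  simp only [smul_neg] at h
  rw [← h]
  rfl

theorem integrable_mul_smul_direction (hd : 0 < d) {η : ℝ} (hη : 0 < η) {f : Eu d → ℝ}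
    {L : ℝ≥0} (hf : LipschitzWith L f) (x : Eu d) (c : ℝ) :
    Integrable (fun v => (c * f (x + v)) • (‖v‖⁻¹ • v)) (sphereUniform d η) := by
  have := isProbabilityMeasure_sphereUniform hd η
  refine Integrable.of_bound (C := |c| * (|f x| + L * η)) ?_ ?_
  · have := hf.continuous.measurable
    exact Measurable.aestronglyMeasurable (by fun_prop)
  · filter_upwards [ae_norm_eq_sphereUniform hη] with v hv
    have h6 := hf.dist_le_mul (x + v) x
    rw [Real.dist_eq, dist_eq_norm, add_sub_cancel_left, hv] at h6
    have h7 := abs_sub_abs_le_abs_sub (f (x + v)) (f x)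
    rw [norm_smul, norm_smul, norm_inv, norm_norm, hv, inv_mul_cancel₀ hη.ne', mul_one, norm_mul,
      Real.norm_eq_abs, Real.norm_eq_abs]
    exact mul_le_mul_of_nonneg_left (by linarith) (abs_nonneg c)

theorem integral_sphereUniform_neg {F : Type*} [NormedAddCommGroup F] [NormedSpace ℝ F]
    (hd : 0 < d) {η : ℝ} (hη : 0 < η) (g : Eu d → F) :
    ∫ v, g (-v) ∂sphereUniform d η = ∫ v, g v ∂sphereUniform d η := by
  conv_rhs => rw [← map_neg_sphereUniform hd hη]
  exact ((MeasurableEquiv.neg (Eu d)).measurableEmbedding.integral_map g).symm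

/-- By Rademacher's theorem and dominated convergence the derivative passes under the ball average;
the divergence theorem then turns it into a sphere integral. The sphere has `d` times the mass of
the ball, which produces the factor `d / η`. -/
theorem hasGradientAt_ballSmooth_of_lipschitz (hd : 0 < d) {η : ℝ} (hη : 0 < η) {f : Eu d → ℝ}
    {L : ℝ≥0} (hf : LipschitzWith L f) (x : Eu d) :
    HasGradientAt (ballSmooth η f)
      (∫ v, (d / η * f (x + v)) • (‖v‖⁻¹ • v) ∂sphereUniform d η) x := by
  have := nontrivial_eu hd
  set B := closedBall (0 : Eu d) 1
  set b : ℝ := volume.real B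
  have hsb : (volume : Measure (Eu d)).toSphere.real univ = d * b := by
    rw [toSphere_real_apply_univ]
    simp only [finrank_euclideanSpace, Fintype.card_fin, b, B]
    rw [measureReal_def, measureReal_def, addHaar_closedBall_eq_addHaar_ball]
  have hBfin : volume B ≠ ⊤ := (isCompact_closedBall _ _).measure_lt_top.ne
  have hbpos : 0 < b := by
    have h1 := toSphere_real_univ_pos (volume : Measure (Eu d))
    rw [hsb] at h1
    exact pos_of_mul_pos_right h1 (Nat.cast_nonneg d)
  have hdiff : ∀ᵐ u ∂(volume : Measure (Eu d)), DifferentiableAt ℝ f (x + η • u) := by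
    have h1 := hf.ae_differentiableAt (μ := (volume : Measure (Eu d)))
    have h2 : QuasiMeasurePreserving (fun u : Eu d => x + η • u) volume volume :=
      (quasiMeasurePreserving_add_left volume x).comp
        ((quasiMeasurePreserving_smul volume hη.ne'))
    exact h2.ae h1
  have hcont : ∀ z : Eu d, Continuous fun u : Eu d => f (z + η • u) := fun z =>
    hf.continuous.comp (by fun_prop)
  have key := hasFDerivAt_integral_of_dominated_loc_of_lip (μ := volume.restrict B)
    (F := fun z (u : Eu d) => f (z + η • u)) (x₀ := x) (s := univ) (bound := fun _ => L)
    (F' := fun u => fderiv ℝ f (x + η • u)) univ_mem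
    (.of_forall fun z => (hcont z).aestronglyMeasurable)
    ((hcont x).continuousOn.integrableOn_compact (isCompact_closedBall _ _))
    ((measurable_fderiv ℝ f).comp (by fun_prop)).aestronglyMeasurable
    (.of_forall fun u => by
      have hLL : Real.nnabs (L : ℝ) = L := by ext; simp
      rw [hLL]
      refine LipschitzWith.lipschitzOnWith ?_
      exact LipschitzWith.of_dist_le_mul fun a c => by
        simpa using hf.dist_le_mul (a + η • u) (c + η • u))
    (integrableOn_const hBfin)
    (ae_restrict_of_ae (hdiff.mono fun u hu => by
      exact (hasFDerivAt_comp_add_right (η • u)).2 hu.hasFDerivAt))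
  rw [hasGradientAt_iff_hasFDerivAt]
  have h2 := key.2.const_smul (b⁻¹)
  have hsm : ballSmooth η f = fun z => b⁻¹ • ∫ u in B, f (z + η • u) := by
    ext z
    rw [ballSmooth, setAverage_eq]
  rw [hsm]
  refine h2.congr_fderiv ?_
  ext v
  rw [_root_.smul_apply, ContinuousLinearMap.integral_apply key.1]
  have hl : LipschitzWith (L * ⟨η, hη.le⟩) fun u : Eu d => f (x + η • u) :=
    hf.comp (LipschitzWith.of_dist_le_mul fun a c => by
      rw [dist_add_left, dist_smul₀, Real.norm_of_nonneg hη.le]; rfl)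
  have hdiv := integral_lineDeriv_closedBall volume hl v
  have hld : ∫ u in B, lineDeriv ℝ (fun u : Eu d => f (x + η • u)) u v =
      η * ∫ u in B, fderiv ℝ f (x + η • u) v := by
    rw [← integral_const_mul]
    refine integral_congr_ae (ae_restrict_of_ae (hdiff.mono fun u hu => ?_))
    have h3 : HasDerivAt (fun t : ℝ => x + η • (u + t • v)) (η • v) 0 := by
      simpa using ((((hasDerivAt_id (0 : ℝ)).smul_const v).const_add u).const_smul η).const_add x
    have h4 : HasFDerivAt f (fderiv ℝ f (x + η • u)) (x + η • (u + (0 : ℝ) • v)) := by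
      simpa using hu.hasFDerivAt
    have h5 := h4.comp_hasDerivAt (0 : ℝ) h3
    have h6 : HasLineDerivAt ℝ (fun u : Eu d => f (x + η • u))
        (fderiv ℝ f (x + η • u) (η • v)) u v :=
      h5
    refine h6.lineDeriv.trans ?_
    simp
  rw [hld] at hdiv
  have hint := integrable_mul_smul_direction hd hη hf x (d / η)
  rw [InnerProductSpace.toDual_apply_apply, real_inner_comm, ← integral_inner hint,
    integral_sphereUniform hη, hsb]
  have hrhs : ∫ w : sphere (0 : Eu d) 1,
      inner ℝ v ((d / η * f (x + η • (w : Eu d))) • (‖η • (w : Eu d)‖⁻¹ • η • (w : Eu d)))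
        ∂(volume : Measure (Eu d)).toSphere =
      d / η * ∫ w : sphere (0 : Eu d) 1, f (x + η • (w : Eu d)) * inner ℝ v (w : Eu d)
        ∂(volume : Measure (Eu d)).toSphere := by
    rw [← integral_const_mul]
    refine integral_congr_ae (.of_forall fun w => ?_)
    simp only
    rw [norm_smul, norm_eq_of_mem_sphere, mul_one, Real.norm_of_nonneg hη.le, smul_smul η⁻¹,
      inv_mul_cancel₀ hη.ne', one_smul, real_inner_smul_right, mul_assoc]
  rw [hrhs, ← hdiv]
  have hd' : (0 : ℝ) < d := Nat.cast_pos.2 hd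
  simp only [smul_eq_mul]
  field_simp

/-- The gradient of the randomized smoothing is the mean of the two-point estimator. -/
theorem hasGradientAt_ballSmooth (hd : 0 < d) {η : ℝ} (hη : 0 < η) {f : Eu d → ℝ}
    {L : ℝ≥0} {U : Set (Eu d)} (hU : IsOpen U) (hf : LipschitzOnWith L f U) {x : Eu d}
    (hx : closedBall x η ⊆ U) :
    HasGradientAt (ballSmooth η f)
      (∫ v, (d / (2 * η) * (f (x + v) - f (x - v))) • (‖v‖⁻¹ • v) ∂sphereUniform d η) x := by
  -- Only values of `f` on `U` enter, so a globally Lipschitz extension can take its place.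
  obtain ⟨F, hF, hFf⟩ := hf.extend_real
  have h1 := hasGradientAt_ballSmooth_of_lipschitz hd hη hF x
  have hint := integrable_mul_smul_direction hd hη hF x (d / (2 * η))
  have hmem : ∀ᵐ v ∂sphereUniform d η, x + v ∈ U ∧ x - v ∈ U := by
    filter_upwards [ae_norm_eq_sphereUniform hη] with v hv
    constructor <;> exact hx (by simp [hv])
  have h2 : ∫ v, (d / (2 * η) * (f (x + v) - f (x - v))) • (‖v‖⁻¹ • v) ∂sphereUniform d η =
      ∫ v, (d / η * F (x + v)) • (‖v‖⁻¹ • v) ∂sphereUniform d η := by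
    have h3 : ∫ v, (d / (2 * η) * (f (x + v) - f (x - v))) • (‖v‖⁻¹ • v) ∂sphereUniform d η =
      ∫ v, ((d / (2 * η) * F (x + v)) • (‖v‖⁻¹ • v) +
        (d / (2 * η) * F (x + -v)) • (‖-v‖⁻¹ • (-v))) ∂sphereUniform d η := by
      refine integral_congr_ae (hmem.mono fun v hv => ?_)
      simp only
      rw [hFf hv.1, hFf hv.2, ← sub_eq_add_neg, norm_neg, smul_neg, smul_neg, ← sub_eq_add_neg,
        ← sub_smul, mul_sub]
    have hneg : Integrable (fun v => (d / (2 * η) * F (x + -v)) • (‖-v‖⁻¹ • (-v)))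
        (sphereUniform d η) := by
      rw [← map_neg_sphereUniform hd hη] at hint
      exact (integrable_map_measure hint.1 measurable_neg.aemeasurable).1 hint
    -- By antipodal symmetry both halves of the two-point formula have the same mean.
    rw [h3, integral_add hint hneg, integral_sphereUniform_neg hd hη
      (fun v => (d / (2 * η) * F (x + v)) • (‖v‖⁻¹ • v)), ← integral_add hint hint]
    congr 1
    ext1 v
    rw [← add_smul]
    congr 1
    field_simp
    ring
  rw [h2]
  refine HasGradientAt.congr_of_eventuallyEq h1 ?_
  -- The gradient at `x` requires the smoothings to agree near `x`; compactness of the ball keeps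
  -- the balls around nearby points inside `U`.
  obtain ⟨δ, hδ, hδU⟩ := (isCompact_closedBall x η).exists_thickening_subset_open hU hx
  filter_upwards [ball_mem_nhds x hδ] with z hz
  rw [ballSmooth, ballSmooth]
  refine setAverage_congr_fun measurableSet_closedBall (.of_forall fun u hu => ?_)
  refine hFf (hδU ?_)
  rw [mem_thickening_iff]
  refine ⟨x + η • u, ?_, by simpa using hz⟩
  rw [mem_closedBall, dist_eq_norm, add_sub_cancel_left, norm_smul, Real.norm_of_nonneg hη.le]
  exact mul_le_of_le_one_right hη.le (mem_closedBall_zero_iff.1 hu)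

end SphereUniform
-- Density of the standard Gaussian and its polar decomposition.
section GaussianDensity

open Set Metric Filter Topology Measure

variable {E : Type*} [NormedAddCommGroup E] [InnerProductSpace ℝ E] [MeasurableSpace E]
  [BorelSpace E] [FiniteDimensional ℝ E]

variable (E) in
/-- The integral of the unnormalized Gaussian density. -/
noncomputable def gaussMass : ℝ := ∫ x : E, Real.exp (-(1 / 2) * ‖x‖ ^ 2)

theorem gaussMass_pos : 0 < gaussMass E := by
  rw [gaussMass, GaussianFourier.integral_rexp_neg_mul_sq_norm (by norm_num)]
  positivity

theorem integrable_gauss : Integrable fun x : E => Real.exp (-(1 / 2) * ‖x‖ ^ 2) := by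
  by_contra h
  exact gaussMass_pos.ne' (integral_undef h)

/-- Both measures have the same characteristic function. The density is needed for polar coordinates
and to transfer almost everywhere differentiability from Lebesgue measure. -/
theorem stdGaussian_eq_withDensity :
    stdGaussian E = (volume : Measure E).withDensity fun x =>
      ENNReal.ofReal ((gaussMass E)⁻¹ * Real.exp (-(1 / 2) * ‖x‖ ^ 2)) := by
  have hc := gaussMass_pos (E := E)
  have : IsFiniteMeasure ((volume : Measure E).withDensity fun x =>
      ENNReal.ofReal ((gaussMass E)⁻¹ * Real.exp (-(1 / 2) * ‖x‖ ^ 2))) :=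
    isFiniteMeasure_withDensity_ofReal (integrable_gauss.const_mul _).2
  refine Measure.ext_of_charFun (funext fun t => ?_)
  rw [charFun_stdGaussian, charFun_apply, integral_withDensity_eq_integral_toReal_smul
    (by fun_prop) (.of_forall fun x => ENNReal.ofReal_lt_top)]
  have h1 := GaussianFourier.integral_cexp_neg_mul_sq_norm_add (V := E) (b := 1 / 2)
    (by norm_num) Complex.I t
  have h2 := GaussianFourier.integral_cexp_neg_mul_sq_norm (V := E) (b := 1 / 2) (by norm_num)
  have h3 : ∫ x : E, Complex.exp (-(1 / 2) * ‖x‖ ^ 2) = (gaussMass E : ℂ) := by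
    rw [gaussMass, ← integral_complex_ofReal]
    congr 1
    ext x
    push_cast
    rfl
  rw [← h2, h3] at h1
  have h4 : ∀ x : E, (ENNReal.ofReal ((gaussMass E)⁻¹ * Real.exp (-(1 / 2) * ‖x‖ ^ 2))).toReal •
      Complex.exp (inner ℝ x t * Complex.I) = ((gaussMass E)⁻¹ : ℂ) *
      Complex.exp (-(1 / 2) * ‖x‖ ^ 2 + Complex.I * inner ℝ t x) := by
    intro x
    rw [ENNReal.toReal_ofReal (by positivity), Complex.exp_add, Complex.real_smul,
      real_inner_comm]
    push_cast
    ring_nf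
  simp_rw [h4]
  rw [integral_const_mul, h1, ← mul_assoc, inv_mul_cancel₀ (by exact_mod_cast hc.ne'), one_mul,
    Complex.I_sq]
  congr 1
  ring

theorem integral_stdGaussian (g : E → ℝ) :
    ∫ x, g x ∂stdGaussian E = ∫ x, (gaussMass E)⁻¹ * Real.exp (-(1 / 2) * ‖x‖ ^ 2) * g x := by
  rw [stdGaussian_eq_withDensity, integral_withDensity_eq_integral_toReal_smul
    (by fun_prop) (.of_forall fun x => ENNReal.ofReal_lt_top)]
  refine integral_congr_ae (.of_forall fun x => ?_)
  have := gaussMass_pos (E := E)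
  simp only
  rw [ENNReal.toReal_ofReal (by positivity), smul_eq_mul]

theorem stdGaussian_absolutelyContinuous : stdGaussian E ≪ (volume : Measure E) := by
  rw [stdGaussian_eq_withDensity]
  exact withDensity_absolutelyContinuous _ _

theorem integral_dual_sq_stdGaussian (l : StrongDual ℝ E) :
    ∫ x, l x ^ 2 ∂stdGaussian E = ‖l‖ ^ 2 := by
  rw [← variance_dual_stdGaussian, variance_of_integral_eq_zero (by fun_prop)
    (integral_strongDual_stdGaussian l)]

theorem integral_norm_sq_stdGaussian :
    ∫ x : E, ‖x‖ ^ 2 ∂stdGaussian E = Module.finrank ℝ E := by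
  set b := stdOrthonormalBasis ℝ E
  have h : ∀ x : E, ‖x‖ ^ 2 = ∑ i, (innerSL ℝ (b i) x) ^ 2 := fun x => by
    rw [← b.sum_sq_norm_inner_right x]
    simp
  simp_rw [h]
  rw [integral_finsetSum]
  · simp_rw [integral_dual_sq_stdGaussian, innerSL_apply_norm]
    simp
  · intro i _
    exact (IsGaussian.memLp_two_id.continuousLinearMap_comp (innerSL ℝ (b i))).integrable_sq

variable [Nontrivial E]

/-- The density is radial, so the norm and the direction are independent and the direction is
uniform. This carries Gaussian moments over to the sphere. -/
theorem integral_norm_mul_direction_stdGaussian (φ : ℝ → ℝ) (q : E → ℝ) :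
    ∫ x, φ ‖x‖ * q (‖x‖⁻¹ • x) ∂stdGaussian E = (∫ x, φ ‖x‖ ∂stdGaussian E) *
      (((volume : Measure E).toSphere.real univ)⁻¹ *
        ∫ w : sphere (0 : E) 1, q w ∂(volume : Measure E).toSphere) := by
  rw [integral_stdGaussian, integral_stdGaussian]
  have h1 := integral_norm_mul_direction (volume : Measure E)
    (fun r => (gaussMass E)⁻¹ * Real.exp (-(1 / 2) * r ^ 2) * φ r) q
  have h2 := integral_norm (volume : Measure E)
    (fun r => (gaussMass E)⁻¹ * Real.exp (-(1 / 2) * r ^ 2) * φ r)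
  have hs := toSphere_real_univ_pos (volume : Measure E)
  simp_rw [← mul_assoc]
  rw [h1, h2]
  field_simp

end GaussianDensity

/-! ### Lipschitz bounds along rotations and for homogeneous extensions. -/

section OddExtension

variable {E : Type*} [NormedAddCommGroup E] [InnerProductSpace ℝ E]

/-- Linearity in `θ` is the point: increments of angle `π / m`, multiplied by `m`, are dominated
uniformly in `m`. -/
theorem abs_sub_rotation_le {F : E → ℝ} {K : ℝ≥0} (hF : LipschitzWith K F) {θ : ℝ} (hθ : 0 ≤ θ)
    (p : E × E) :
    |F (Real.cos θ • p.1 + Real.sin θ • p.2) - F p.1| ≤ θ * (2 * K * ‖p‖) := by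
  have h1 := hF.dist_le_mul (Real.cos θ • p.1 + Real.sin θ • p.2) p.1
  rw [Real.dist_eq, dist_eq_norm] at h1
  refine h1.trans ?_
  have h2 : Real.cos θ • p.1 + Real.sin θ • p.2 - p.1 =
      (Real.cos θ - 1) • p.1 + Real.sin θ • p.2 := by
    rw [sub_smul, one_smul]; abel
  have h3 : |Real.cos θ - 1| ≤ θ := by
    have := Real.abs_cos_sub_cos_le θ 0
    simpa [abs_of_nonneg hθ] using this
  have h4 : |Real.sin θ| ≤ θ := by
    have := Real.abs_sin_le_abs (x := θ)
    rwa [abs_of_nonneg hθ] at this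
  have h5 : ‖(Real.cos θ - 1) • p.1 + Real.sin θ • p.2‖ ≤ θ * ‖p‖ + θ * ‖p‖ := by
    refine (norm_add_le _ _).trans (add_le_add ?_ ?_)
    · rw [norm_smul]
      exact mul_le_mul h3 (norm_fst_le p) (norm_nonneg _) hθ
    · rw [norm_smul]
      exact mul_le_mul h4 (norm_snd_le p) (norm_nonneg _) hθ
  rw [h2]
  calc _ ≤ K * (θ * ‖p‖ + θ * ‖p‖) := mul_le_mul_of_nonneg_left h5 K.2
    _ = _ := by ring

/-- The positively homogeneous extension of the restriction of `D` to the unit sphere. -/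
noncomputable def homogeneousExtension (D : E → ℝ) (x : E) : ℝ := ‖x‖ * D (‖x‖⁻¹ • x)

theorem homogeneousExtension_neg {D : E → ℝ} (hodd : ∀ x, D (-x) = -D x) (x : E) :
    homogeneousExtension D (-x) = -homogeneousExtension D x := by
  simp [homogeneousExtension, hodd]

/-- Oddness gives `D 0 = 0`, hence `|D| ≤ K` at unit vectors. The change of the norm contributes
`K`, and the change of direction contributes `2K` because `‖y‖ ‖x/‖x‖ - y/‖y‖‖ ≤ 2‖x - y‖`. -/
theorem lipschitzWith_homogeneousExtension {D : E → ℝ} {K : ℝ≥0} (hD : LipschitzWith K D)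
    (hodd : ∀ x, D (-x) = -D x) : LipschitzWith (3 * K) (homogeneousExtension D) := by
  refine LipschitzWith.of_dist_le_mul fun x y => ?_
  rw [Real.dist_eq, dist_eq_norm]
  have h0 : D 0 = 0 := by
    have := hodd 0
    rw [neg_zero] at this
    linarith
  have hdir : ∀ z : E, ‖‖z‖⁻¹ • z‖ ≤ 1 := fun z => by
    rw [norm_smul, norm_inv, norm_norm]
    exact inv_mul_le_one
  have h1 : |D (‖x‖⁻¹ • x)| ≤ K := by
    have h := hD.dist_le_mul (‖x‖⁻¹ • x) 0
    rw [Real.dist_eq, h0, sub_zero, dist_zero_right] at h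
    exact h.trans (mul_le_of_le_one_right K.2 (hdir x))
  have h2 : ‖y‖ * ‖‖x‖⁻¹ • x - ‖y‖⁻¹ • y‖ ≤ 2 * ‖x - y‖ := by
    rcases eq_or_ne x 0 with rfl | hx
    · rw [norm_zero, inv_zero, smul_zero, zero_sub, zero_sub, norm_neg, norm_neg]
      calc _ ≤ ‖y‖ * 1 := mul_le_mul_of_nonneg_left (hdir y) (norm_nonneg _)
        _ ≤ _ := by linarith [norm_nonneg y]
    · rcases eq_or_ne y 0 with rfl | hy
      · rw [norm_zero, zero_mul]; positivity
      · have hx' : ‖x‖ ≠ 0 := norm_ne_zero_iff.2 hx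
        have hy' : ‖y‖ ≠ 0 := norm_ne_zero_iff.2 hy
        have e1 : ‖y‖ * ‖‖x‖⁻¹ • x - ‖y‖⁻¹ • y‖ =
            ‖(x - y) + ((‖y‖ - ‖x‖) * ‖x‖⁻¹) • x‖ := by
          rw [← norm_norm y, ← norm_smul, norm_norm, smul_sub, smul_smul, smul_smul,
            mul_inv_cancel₀ hy', one_smul, sub_mul, mul_inv_cancel₀ hx', sub_smul, one_smul]
          congr 1
          abel
        rw [e1]
        refine (norm_add_le _ _).trans ?_
        rw [norm_smul, norm_mul, norm_inv, norm_norm, mul_assoc, inv_mul_cancel₀ hx', mul_one,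
          Real.norm_eq_abs]
        have := abs_norm_sub_norm_le y x
        rw [norm_sub_rev y x] at this
        linarith
  have h3 : |D (‖x‖⁻¹ • x) - D (‖y‖⁻¹ • y)| ≤ K * ‖‖x‖⁻¹ • x - ‖y‖⁻¹ • y‖ := by
    have h := hD.dist_le_mul (‖x‖⁻¹ • x) (‖y‖⁻¹ • y)
    rwa [Real.dist_eq, dist_eq_norm] at h
  have e : homogeneousExtension D x - homogeneousExtension D y =
      (‖x‖ - ‖y‖) * D (‖x‖⁻¹ • x) + ‖y‖ * (D (‖x‖⁻¹ • x) - D (‖y‖⁻¹ • y)) := by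
    simp only [homogeneousExtension]; ring
  rw [e]
  refine (abs_add_le _ _).trans ?_
  rw [abs_mul, abs_mul, abs_norm]
  have h4 : |‖x‖ - ‖y‖| * |D (‖x‖⁻¹ • x)| ≤ ‖x - y‖ * K :=
    mul_le_mul (abs_norm_sub_norm_le x y) h1 (abs_nonneg _) (norm_nonneg _)
  have h5 : ‖y‖ * |D (‖x‖⁻¹ • x) - D (‖y‖⁻¹ • y)| ≤ K * (2 * ‖x - y‖) := by
    calc _ ≤ ‖y‖ * (K * ‖‖x‖⁻¹ • x - ‖y‖⁻¹ • y‖) := mul_le_mul_of_nonneg_left h3 (norm_nonneg _)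
      _ = K * (‖y‖ * ‖‖x‖⁻¹ • x - ‖y‖⁻¹ • y‖) := by ring
      _ ≤ _ := mul_le_mul_of_nonneg_left h2 K.2
  push_cast
  linarith

end OddExtension

/-! ### Poincaré inequalities for odd functions. -/

section GaussianPoincare

open Set Metric Filter Topology Measure

variable {E : Type*} [NormedAddCommGroup E] [InnerProductSpace ℝ E] [MeasurableSpace E]
  [BorelSpace E] [FiniteDimensional ℝ E]

theorem map_rotation_stdGaussian (θ : ℝ) :
    MeasurePreserving (ContinuousLinearMap.rotation θ)
      ((stdGaussian E).prod (stdGaussian E)) ((stdGaussian E).prod (stdGaussian E)) :=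
  ⟨(ContinuousLinearMap.rotation θ).continuous.measurable,
    IsGaussian.map_rotation_eq_self_of_forall_strongDual_eq_zero
      integral_strongDual_stdGaussian θ⟩

theorem integrable_norm_sq_prod_stdGaussian :
    Integrable (fun p : E × E => ‖p‖ ^ 2) ((stdGaussian E).prod (stdGaussian E)) :=
  IsGaussian.memLp_two_id.integrable_norm_pow (by norm_num)

theorem integrable_sub_rotation_sq {F : E → ℝ} {K : ℝ≥0} (hF : LipschitzWith K F) {θ : ℝ}
    (hθ : 0 ≤ θ) :
    Integrable (fun p : E × E => (F (Real.cos θ • p.1 + Real.sin θ • p.2) - F p.1) ^ 2)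
      ((stdGaussian E).prod (stdGaussian E)) := by
  refine (integrable_norm_sq_prod_stdGaussian.const_mul ((θ * (2 * K)) ^ 2)).mono' ?_
    (.of_forall fun p => ?_)
  · have := hF.continuous
    exact Continuous.aestronglyMeasurable (by fun_prop)
  · rw [Real.norm_of_nonneg (sq_nonneg _), ← mul_pow, ← sq_abs]
    refine pow_le_pow_left₀ (abs_nonneg _) ((abs_sub_rotation_le hF hθ p).trans_eq ?_) 2
    ring

/-- Rotating the pair by the angle `π` in `m` equal steps leads from `x` to `-x`, where an odd `F`
has changed by `-2F(x)`. Cauchy–Schwarz over the steps gives one factor `m`; the other comes from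
the `m` increments having the same law, by rotation invariance of the product Gaussian. -/
theorem four_mul_integral_sq_le {F : E → ℝ} {K : ℝ≥0} (hF : LipschitzWith K F)
    (hodd : ∀ x, F (-x) = -F x) {m : ℕ} (hm : 0 < m) :
    4 * ∫ x, F x ^ 2 ∂stdGaussian E ≤
      ∫ p : E × E, (m * (F (Real.cos (Real.pi / m) • p.1 + Real.sin (Real.pi / m) • p.2) - F p.1))
        ^ 2 ∂(stdGaussian E).prod (stdGaussian E) := by
  set γ := stdGaussian E
  set δ : ℝ := Real.pi / m
  have hm' : (0 : ℝ) < m := Nat.cast_pos.2 hm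
  have hδ : 0 ≤ δ := by positivity
  set G : E × E → ℝ := fun p => (F (Real.cos δ • p.1 + Real.sin δ • p.2) - F p.1) ^ 2
  have hG : Integrable G (γ.prod γ) := integrable_sub_rotation_sq hF hδ
  have hstep : ∀ (j : ℕ) (p : E × E), F (ContinuousLinearMap.rotation ((j + 1 : ℕ) * δ) p).1 -
      F (ContinuousLinearMap.rotation (j * δ) p).1 =
      F (Real.cos δ • (ContinuousLinearMap.rotation (j * δ) p).1 +
        Real.sin δ • (ContinuousLinearMap.rotation (j * δ) p).2) -
      F (ContinuousLinearMap.rotation (j * δ) p).1 := by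
    intro j p
    congr 2
    simp only [ContinuousLinearMap.rotation_apply]
    push_cast
    rw [add_mul, one_mul, Real.cos_add, Real.sin_add]
    module
  have hpt : ∀ p : E × E, 4 * F p.1 ^ 2 ≤
      m * ∑ j ∈ Finset.range m, G (ContinuousLinearMap.rotation (j * δ) p) := by
    intro p
    have hsum := Finset.sum_range_sub
      (fun j : ℕ => F (ContinuousLinearMap.rotation ((j : ℕ) * δ) p).1) m
    have hend : F (ContinuousLinearMap.rotation ((m : ℕ) * δ) p).1 = -F p.1 := by
      have : (m : ℝ) * δ = Real.pi := by simp only [δ]; field_simp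
      rw [this, ContinuousLinearMap.rotation_apply, ← hodd]
      simp
    have hstart : F (ContinuousLinearMap.rotation ((0 : ℕ) * δ) p).1 = F p.1 := by
      rw [ContinuousLinearMap.rotation_apply]
      simp
    rw [hend, hstart] at hsum
    have hcs := sq_sum_le_card_mul_sum_sq (s := Finset.range m)
      (f := fun j : ℕ => F (ContinuousLinearMap.rotation ((j + 1 : ℕ) * δ) p).1 -
        F (ContinuousLinearMap.rotation (j * δ) p).1)
    rw [hsum, Finset.card_range] at hcs
    calc 4 * F p.1 ^ 2 = (-F p.1 - F p.1) ^ 2 := by ring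
      _ ≤ _ := hcs
      _ = _ := by simp_rw [hstep]; rfl
  have hGj : ∀ j : ℕ, Integrable (fun p => G (ContinuousLinearMap.rotation (j * δ) p))
      (γ.prod γ) := fun j =>
    ((map_rotation_stdGaussian (j * δ)).integrable_comp hG.1).2 hG
  have hGint : ∀ j : ℕ, ∫ p, G (ContinuousLinearMap.rotation (j * δ) p) ∂(γ.prod γ) =
      ∫ p, G p ∂(γ.prod γ) := by
    intro j
    have h := map_rotation_stdGaussian (E := E) (j * δ)
    conv_rhs => rw [← h.map_eq]
    rw [integral_map h.measurable.aemeasurable]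
    rw [h.map_eq]
    exact hG.1
  have h1 : 4 * ∫ x, F x ^ 2 ∂γ = ∫ p : E × E, 4 * F p.1 ^ 2 ∂(γ.prod γ) := by
    rw [integral_const_mul, integral_fun_fst (μ := γ) (ν := γ) (fun x => F x ^ 2)]
    simp
  have h2 : ∫ p : E × E, 4 * F p.1 ^ 2 ∂(γ.prod γ) ≤
      ∫ p, m * ∑ j ∈ Finset.range m, G (ContinuousLinearMap.rotation (j * δ) p) ∂(γ.prod γ) :=
    integral_mono_of_nonneg (.of_forall fun p => by positivity)
      ((integrable_finsetSum _ fun j _ => hGj j).const_mul _) (.of_forall hpt)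
  rw [h1]
  refine h2.trans_eq ?_
  rw [integral_const_mul, integral_finsetSum _ fun j _ => hGj j]
  simp_rw [hGint, mul_pow]
  rw [integral_const_mul, Finset.sum_const, Finset.card_range, nsmul_eq_mul]
  ring

/-- A Poincaré inequality for odd Lipschitz functions of a standard Gaussian vector. -/
theorem gaussian_poincare_of_odd {F : E → ℝ} {K : ℝ≥0} (hF : LipschitzWith K F)
    (hodd : ∀ x, F (-x) = -F x) :
    4 * ∫ x, F x ^ 2 ∂stdGaussian E ≤ Real.pi ^ 2 * K ^ 2 := by
  set γ := stdGaussian E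
  have hdiff : ∀ᵐ p ∂(γ.prod γ), DifferentiableAt ℝ F p.1 :=
    quasiMeasurePreserving_fst.ae (stdGaussian_absolutelyContinuous.ae_le
      (hF.ae_differentiableAt (μ := volume)))
  -- The rotation curve has velocity `p.2` at angle 0, so the scaled increments converge to `π`
  -- times a directional derivative of `F`.
  have hlim : Tendsto (fun m : ℕ => ∫ p : E × E, (m * (F (Real.cos (Real.pi / m) • p.1 +
      Real.sin (Real.pi / m) • p.2) - F p.1)) ^ 2 ∂(γ.prod γ)) atTop
      (𝓝 (∫ p : E × E, (Real.pi * fderiv ℝ F p.1 p.2) ^ 2 ∂(γ.prod γ))) := by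
    refine tendsto_integral_of_dominated_convergence
      (fun p => (Real.pi * (2 * K)) ^ 2 * ‖p‖ ^ 2) (fun m => ?_)
      (integrable_norm_sq_prod_stdGaussian.const_mul _) (fun m => .of_forall fun p => ?_) ?_
    · have := hF.continuous
      exact Continuous.aestronglyMeasurable (by fun_prop)
    · rw [Real.norm_of_nonneg (sq_nonneg _), ← mul_pow, ← sq_abs]
      refine pow_le_pow_left₀ (abs_nonneg _) ?_ 2
      rcases Nat.eq_zero_or_pos m with rfl | hm
      · simp only [Nat.cast_zero, zero_mul, abs_zero]
        positivity
      · have hm' : (0 : ℝ) < m := Nat.cast_pos.2 hm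
        rw [abs_mul, abs_of_pos hm']
        calc _ ≤ (m : ℝ) * (Real.pi / m * (2 * K * ‖p‖)) :=
              mul_le_mul_of_nonneg_left (abs_sub_rotation_le hF (by positivity) p) hm'.le
          _ = _ := by field_simp
    · filter_upwards [hdiff] with p hp
      have hc : HasDerivAt (fun θ : ℝ => Real.cos θ • p.1 + Real.sin θ • p.2) p.2 0 := by
        have h := ((Real.hasDerivAt_cos 0).smul_const p.1).add
          ((Real.hasDerivAt_sin 0).smul_const p.2)
        exact HasDerivAt.congr_deriv h (by simp)
      have hp' : HasFDerivAt F (fderiv ℝ F p.1)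
          (Real.cos 0 • p.1 + Real.sin 0 • p.2) := by simpa using hp.hasFDerivAt
      have h1 := (hp'.comp_hasDerivAt (0 : ℝ) hc).tendsto_slope_zero_right
      have h2 : Tendsto (fun m : ℕ => Real.pi / m) atTop (𝓝[>] 0) := by
        rw [tendsto_nhdsWithin_iff]
        refine ⟨tendsto_const_div_atTop_nhds_zero_nat _, ?_⟩
        filter_upwards [eventually_gt_atTop 0] with m hm
        have : (0 : ℝ) < m := Nat.cast_pos.2 hm
        exact mem_Ioi.2 (by positivity)
      have h3 := ((h1.comp h2).const_mul Real.pi).pow 2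
      refine h3.congr' ?_
      filter_upwards [eventually_gt_atTop 0] with m hm
      have hm' : (0 : ℝ) < m := Nat.cast_pos.2 hm
      simp only [Function.comp_apply, zero_add, Real.cos_zero, one_smul, Real.sin_zero, zero_smul,
        add_zero, smul_eq_mul, inv_div]
      rw [← mul_assoc, mul_div_cancel₀ _ Real.pi_ne_zero]
  have h1 : 4 * ∫ x, F x ^ 2 ∂γ ≤ ∫ p : E × E, (Real.pi * fderiv ℝ F p.1 p.2) ^ 2 ∂(γ.prod γ) := by
    refine ge_of_tendsto hlim ?_
    filter_upwards [eventually_gt_atTop 0] with m hm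
    exact four_mul_integral_sq_le hF hodd hm
  refine h1.trans ?_
  have hfd : ∀ x, ‖fderiv ℝ F x‖ ≤ K := fun x => norm_fderiv_le_of_lipschitz ℝ hF
  have hint : Integrable (fun p : E × E => (Real.pi * fderiv ℝ F p.1 p.2) ^ 2) (γ.prod γ) := by
    refine (integrable_norm_sq_prod_stdGaussian.const_mul ((Real.pi * K) ^ 2)).mono' ?_
      (.of_forall fun p => ?_)
    · have h1 : Measurable fun p : E × E => fderiv ℝ F p.1 :=
        (measurable_fderiv ℝ F).comp measurable_fst
      have h2 : Measurable fun p : E × E => fderiv ℝ F p.1 p.2 :=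
        (isBoundedBilinearMap_apply (𝕜 := ℝ) (E := E) (F := ℝ)).continuous.measurable.comp
          (h1.prodMk measurable_snd)
      exact ((h2.const_mul _).pow_const 2).aestronglyMeasurable
    · rw [Real.norm_of_nonneg (sq_nonneg _), ← mul_pow, ← sq_abs]
      refine pow_le_pow_left₀ (abs_nonneg _) ?_ 2
      rw [abs_mul, abs_of_pos Real.pi_pos, mul_assoc]
      refine mul_le_mul_of_nonneg_left ?_ Real.pi_pos.le
      exact ((fderiv ℝ F p.1).le_opNorm p.2).trans
        (mul_le_mul (hfd _) (norm_snd_le p) (norm_nonneg _) K.2)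
  rw [integral_prod _ hint]
  -- For fixed `x` a linear functional is evaluated at an independent standard Gaussian; its second
  -- moment is the squared dual norm, so no dimension enters.
  have h3 : ∀ x, ∫ y, (Real.pi * fderiv ℝ F x y) ^ 2 ∂γ ≤ Real.pi ^ 2 * K ^ 2 := by
    intro x
    simp_rw [mul_pow]
    rw [integral_const_mul, integral_dual_sq_stdGaussian]
    exact mul_le_mul_of_nonneg_left (pow_le_pow_left₀ (norm_nonneg _) (hfd x) 2) (sq_nonneg _)
  calc _ ≤ ∫ x : E, Real.pi ^ 2 * (K : ℝ) ^ 2 ∂γ :=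
        integral_mono_of_nonneg (.of_forall fun x => integral_nonneg fun y => sq_nonneg _)
          (integrable_const _) (.of_forall h3)
    _ = _ := by simp

/-- A Poincaré inequality for odd Lipschitz functions on the unit sphere. -/
theorem sphere_poincare_of_odd [Nontrivial E] {D : E → ℝ} {K : ℝ≥0} (hD : LipschitzWith K D)
    (hodd : ∀ x, D (-x) = -D x) :
    4 * Module.finrank ℝ E * (((volume : Measure E).toSphere.real univ)⁻¹ *
      ∫ w : sphere (0 : E) 1, D w ^ 2 ∂(volume : Measure E).toSphere) ≤
      9 * Real.pi ^ 2 * K ^ 2 := by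
  have h1 := gaussian_poincare_of_odd (lipschitzWith_homogeneousExtension hD hodd)
    (homogeneousExtension_neg hodd)
  -- The radial factor is `𝔼‖x‖² = dim E`; this is the gain of the dimension.
  have h2 := integral_norm_mul_direction_stdGaussian (E := E) (fun r => r ^ 2) (fun w => D w ^ 2)
  simp only [homogeneousExtension, mul_pow] at h1
  rw [h2, integral_norm_sq_stdGaussian] at h1
  push_cast at h1
  calc _ = 4 * (Module.finrank ℝ E * (((volume : Measure E).toSphere.real univ)⁻¹ *
      ∫ w : sphere (0 : E) 1, D w ^ 2 ∂(volume : Measure E).toSphere)) := by ring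
    _ ≤ _ := h1
    _ = _ := by ring

end GaussianPoincare

/-! ### Second moment of the two-point difference. -/

section TwoPoint

open Set Metric

/-- The second moment of the difference of a Lipschitz function at antipodal points of a sphere
is inversely proportional to the dimension. -/
theorem integral_two_point_sq_le {d : ℕ} (hd : 0 < d) {η : ℝ} (hη : 0 < η) {f : Eu d → ℝ}
    {L : ℝ≥0} {U : Set (Eu d)} (hf : LipschitzOnWith L f U) {x : Eu d}
    (hx : closedBall x η ⊆ U) :
    d * ∫ v, (f (x + v) - f (x - v)) ^ 2 ∂sphereUniform d η ≤ 9 * Real.pi ^ 2 * (L * η) ^ 2 := by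
  have := nontrivial_eu hd
  obtain ⟨F, hF, hFf⟩ := hf.extend_real
  -- The antipodal difference is odd in `w` for every `F`, with Lipschitz constant `2Lη`.
  set D : Eu d → ℝ := fun w => F (x + η • w) - F (x + -(η • w))
  have hL : ∀ s : ℝ, |s| = η → LipschitzWith (L * ⟨η, hη.le⟩) fun w : Eu d => F (x + s • w) := by
    intro s hs
    refine hF.comp (LipschitzWith.of_dist_le_mul fun a c => ?_)
    rw [dist_add_left, dist_smul₀, Real.norm_eq_abs, hs]
    rfl
  have hD : LipschitzWith (L * ⟨η, hη.le⟩ + L * ⟨η, hη.le⟩) D := by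
    refine (hL η (abs_of_pos hη)).sub ?_
    simpa using hL (-η) (by rw [abs_neg, abs_of_pos hη])
  have hodd : ∀ w, D (-w) = -D w := fun w => by simp [D]
  have h1 := sphere_poincare_of_odd hD hodd
  have h2 : ∫ v, (f (x + v) - f (x - v)) ^ 2 ∂sphereUniform d η =
      ((volume : Measure (Eu d)).toSphere.real univ)⁻¹ *
        ∫ w : sphere (0 : Eu d) 1, D w ^ 2 ∂(volume : Measure (Eu d)).toSphere := by
    rw [integral_sphereUniform hη, smul_eq_mul]
    congr 1
    refine integral_congr_ae (.of_forall fun w => ?_)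
    have hw : ‖η • (w : Eu d)‖ = η := by
      rw [norm_smul, Real.norm_of_nonneg hη.le, norm_eq_of_mem_sphere, mul_one]
    have m1 : x + η • (w : Eu d) ∈ U := hx (by simp [hw])
    have m2 : x - η • (w : Eu d) ∈ U := hx (by simp [hw])
    simp only [D]
    rw [hFf m1, hFf m2, ← sub_eq_add_neg]
  rw [h2]
  rw [finrank_euclideanSpace, Fintype.card_fin] at h1
  have e : ((L * ⟨η, hη.le⟩ + L * ⟨η, hη.le⟩ : ℝ≥0) : ℝ) = 2 * (L * η) := by
    push_cast
    ring_nf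
    rfl
  rw [e] at h1
  nlinarith

end TwoPoint

/-! ### Integration with an independent variable frozen. -/

section Independence

variable {Ω ι α β : Type*} {mΩ : MeasurableSpace Ω} {Q : Measure Ω} [MeasurableSpace α]
  [MeasurableSpace β] {X : Ω → α} {W : Ω → β}

/-- Random variables generated by disjoint subfamilies of an independent family are independent. -/
theorem indepFun_of_iIndepFun_of_disjoint {γ : ι → Type*} {mγ : ∀ i, MeasurableSpace (γ i)}
    {Z : ∀ i, Ω → γ i} (hZ : ∀ i, Measurable (Z i)) (hind : iIndepFun Z Q) {S T : Set ι}
    (hST : Disjoint S T) (hX : Measurable[⨆ i ∈ S, MeasurableSpace.comap (Z i) (mγ i)] X)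
    (hW : Measurable[⨆ i ∈ T, MeasurableSpace.comap (Z i) (mγ i)] W) : IndepFun X W Q := by
  rw [IndepFun_iff_Indep]
  have h := indep_iSup_of_disjoint (fun i => (hZ i).comap_le) hind.iIndep hST
  exact indep_of_indep_of_le_left (indep_of_indep_of_le_right h hW.comap_le) hX.comap_le

/-- Independence makes the joint law a product, so a bound on the mean over `W` with `X` frozen may
be averaged over `X`. -/
theorem lintegral_indep_le [IsProbabilityMeasure Q] (hX : Measurable X) (hW : Measurable W)
    (hind : IndepFun X W Q) {φ : α × β → ℝ≥0∞} (hφ : Measurable φ) {ψ : Ω → ℝ≥0∞}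
    (hψ : ∀ ω, ∫⁻ ω', φ (X ω, W ω') ∂Q ≤ ψ ω) :
    ∫⁻ ω, φ (X ω, W ω) ∂Q ≤ ∫⁻ ω, ψ ω ∂Q := by
  have h := (indepFun_iff_map_prod_eq_prod_map_map hX.aemeasurable hW.aemeasurable).1 hind
  have : IsProbabilityMeasure (Q.map W) := Measure.isProbabilityMeasure_map hW.aemeasurable
  calc ∫⁻ ω, φ (X ω, W ω) ∂Q = ∫⁻ p, φ p ∂(Q.map fun ω => (X ω, W ω)) :=
        (lintegral_map hφ (hX.prodMk hW)).symm
    _ = ∫⁻ a, ∫⁻ b, φ (a, b) ∂(Q.map W) ∂(Q.map X) := by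
        rw [h, lintegral_prod _ hφ.aemeasurable]
    _ = ∫⁻ ω, ∫⁻ b, φ (X ω, b) ∂(Q.map W) ∂Q := by
        rw [lintegral_map hφ.lintegral_prod_right' hX]
    _ = ∫⁻ ω, ∫⁻ ω', φ (X ω, W ω') ∂Q ∂Q := by
        congr 1
        ext ω
        exact lintegral_map (hφ.comp measurable_prodMk_left) hW
    _ ≤ _ := lintegral_mono hψ

theorem integral_indep_le [IsProbabilityMeasure Q] (hX : Measurable X) (hW : Measurable W)
    (hind : IndepFun X W Q) {φ : α × β → ℝ} (hφ : Measurable φ) {b : ℝ}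
    (hb : ∀ p, |φ p| ≤ b) {ψ : Ω → ℝ} (hψi : Integrable ψ Q)
    (hψ : ∀ ω, ∫ w, φ (X ω, w) ∂(Q.map W) ≤ ψ ω) :
    ∫ ω, φ (X ω, W ω) ∂Q ≤ ∫ ω, ψ ω ∂Q := by
  have h := (indepFun_iff_map_prod_eq_prod_map_map hX.aemeasurable hW.aemeasurable).1 hind
  have i1 : IsProbabilityMeasure (Q.map W) := Measure.isProbabilityMeasure_map hW.aemeasurable
  have i2 : IsProbabilityMeasure (Q.map X) := Measure.isProbabilityMeasure_map hX.aemeasurable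
  have hint : Integrable φ ((Q.map X).prod (Q.map W)) :=
    Integrable.of_bound hφ.aestronglyMeasurable b (.of_forall hb)
  have hint2 := hint.integral_prod_left
  calc ∫ ω, φ (X ω, W ω) ∂Q = ∫ p, φ p ∂(Q.map fun ω => (X ω, W ω)) :=
        (integral_map (hX.prodMk hW).aemeasurable hφ.aestronglyMeasurable).symm
    _ = ∫ a, ∫ b, φ (a, b) ∂(Q.map W) ∂(Q.map X) := by
        rw [h, integral_prod _ hint]
    _ = ∫ ω, ∫ b, φ (X ω, b) ∂(Q.map W) ∂Q := by
        rw [integral_map hX.aemeasurable hint2.1]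
    _ ≤ _ := integral_mono (hint2.comp_measurable hX) hψi hψ

end Independence

/-! ### Stochastic approximation for the lower-level variational inequality. -/

section SA

variable {Ξ : Type*} {d : ℕ}

theorem saIter_mem {Φ : Eu d → Ξ → Eu d} {K : Set (Eu d)} (hcl : IsClosed K) {α₀ Γ : ℝ}
    {y₀ : Eu d} (hy₀ : y₀ ∈ K) (ζ : ℕ → Ξ) (t : ℕ) : saIter Φ K α₀ Γ y₀ ζ t ∈ K := by
  cases t with
  | zero => exact hy₀
  | succ t => exact proj_mem ⟨y₀, hy₀⟩ hcl _

variable [MeasurableSpace Ξ]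

/-- The σ-algebra is arbitrary and only draws before `t` are required to be measurable. This yields
both joint measurability in the upper-level point and the dependence on past draws alone. -/
theorem measurable_saIter {Ω : Type*} {mΩ : MeasurableSpace Ω} {Φ : Ω → Eu d → Ξ → Eu d}
    {K : Set (Eu d)} (hcl : IsClosed K) (hcv : Convex ℝ K) {α₀ Γ : ℝ} {y₀ : Eu d} (hy₀ : y₀ ∈ K)
    (hΦ : ∀ (y : Ω → Eu d) (ξ : Ω → Ξ), Measurable y → Measurable ξ →
      Measurable fun ω => Φ ω (y ω) (ξ ω))
    {ζ : Ω → ℕ → Ξ} {t : ℕ} (hζ : ∀ s < t, Measurable fun ω => ζ ω s) :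
    Measurable fun ω => saIter (Φ ω) K α₀ Γ y₀ (ζ ω) t := by
  induction t with
  | zero => exact measurable_const
  | succ t ih =>
    have h := ih fun s hs => hζ s (hs.trans (Nat.lt_succ_self t))
    have h1 := hΦ _ _ h (hζ t (Nat.lt_succ_self t))
    have h2 : Measurable fun ω => (α₀ / (t + Γ)) •
        Φ ω (saIter (Φ ω) K α₀ Γ y₀ (ζ ω) t) (ζ ω t) := h1.const_smul (α₀ / (t + Γ))
    exact (continuous_proj ⟨y₀, hy₀⟩ hcl hcv).measurable.comp (h.sub h2)

/-- The recursion `e (t + 1) ≤ (1 - 2 μ α_t) e t + α_t² B` with stepsizes `α_t = α₀ / (t + Γ)`,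
for errors that are also at most `(c / μ)²`. -/
theorem sa_recursion {e : ℕ → ℝ} {μ α₀ Γ c v C : ℝ} (hμ : 0 < μ) (hα : 1 / (2 * μ) < α₀)
    (hΓ : 0 < Γ) (hC : (c ^ 2 + v ^ 2) * α₀ ^ 2 / (2 * μ * α₀ - 1) ≤ C)
    (h0 : Γ * e 0 ≤ C) (hb : ∀ t, e t ≤ (c / μ) ^ 2)
    (hstep : ∀ t : ℕ, e (t + 1) ≤
      (1 - 2 * (α₀ / (t + Γ)) * μ) * e t + (α₀ / (t + Γ)) ^ 2 * (c ^ 2 + v ^ 2)) (t : ℕ) :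
    e t ≤ 4 * C / (t + Γ) := by
  have ha : 0 < 2 * μ * α₀ - 1 := by
    rw [div_lt_iff₀ (by positivity)] at hα
    linarith
  have hα0 : 0 < α₀ := (by positivity : 0 < 1 / (2 * μ)).trans hα
  have hC0 : 0 ≤ C := le_trans (by positivity) hC
  have hC1 : (c ^ 2 + v ^ 2) * α₀ ^ 2 ≤ C * (2 * μ * α₀ - 1) := (div_le_iff₀ ha).1 hC
  induction t with
  | zero =>
    rw [Nat.cast_zero, zero_add, le_div_iff₀ hΓ]
    linarith
  | succ t ih =>
    set s : ℝ := t + Γ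
    have hs : 0 < s := by positivity
    have e1 : ((t + 1 : ℕ) : ℝ) + Γ = s + 1 := by push_cast; ring
    rw [e1, le_div_iff₀ (by positivity)]
    -- For `s ≥ 2μα₀` the contraction factor is nonnegative and the induction hypothesis can be
    -- inserted. For smaller `s` it is negative, and the a priori bound is used instead; there
    -- `(c/μ)² (2μα₀)² = 4c²α₀²` is the source of the factor 4.
    rcases le_or_gt (2 * μ * α₀) s with h | h
    · have h1 : 0 ≤ 1 - 2 * (α₀ / s) * μ := by
        rw [sub_nonneg, show 2 * (α₀ / s) * μ = (2 * μ * α₀) / s by ring, div_le_one hs]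
        exact h
      have h2 := hstep t
      have h3 : e (t + 1) ≤ 4 * C * (s - 1) / s ^ 2 := by
        calc e (t + 1) ≤ (1 - 2 * (α₀ / s) * μ) * (4 * C / s) +
              (α₀ / s) ^ 2 * (c ^ 2 + v ^ 2) :=
              h2.trans (by linarith [mul_le_mul_of_nonneg_left ih h1])
          _ = (4 * C * (s - 2 * μ * α₀) + (c ^ 2 + v ^ 2) * α₀ ^ 2) / s ^ 2 := by
              field_simp
          _ ≤ (4 * C * (s - 2 * μ * α₀) + 4 * (C * (2 * μ * α₀ - 1))) / s ^ 2 := by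
              have : 0 ≤ C * (2 * μ * α₀ - 1) := mul_nonneg hC0 ha.le
              refine div_le_div_of_nonneg_right ?_ (by positivity)
              linarith
          _ = _ := by ring
      calc e (t + 1) * (s + 1) ≤ 4 * C * (s - 1) / s ^ 2 * (s + 1) :=
            mul_le_mul_of_nonneg_right h3 (by positivity)
        _ = 4 * C * ((s ^ 2 - 1) / s ^ 2) := by ring
        _ ≤ 4 * C * 1 := by
            refine mul_le_mul_of_nonneg_left ?_ (by positivity)
            rw [div_le_one (by positivity)]
            linarith
        _ = _ := mul_one _
    · have h1 := hb (t + 1)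
      have h2 : c ^ 2 * α₀ ^ 2 ≤ C * (2 * μ * α₀ - 1) := by
        refine le_trans ?_ hC1
        exact mul_le_mul_of_nonneg_right (by linarith [sq_nonneg v]) (sq_nonneg _)
      have h3 : (c / μ) ^ 2 * (s + 1) * (2 * μ * α₀ - 1) ≤ 4 * C * (2 * μ * α₀ - 1) := by
        calc (c / μ) ^ 2 * (s + 1) * (2 * μ * α₀ - 1) ≤
              (c / μ) ^ 2 * (2 * μ * α₀ + 1) * (2 * μ * α₀ - 1) := by
              gcongr
          _ ≤ (c / μ) ^ 2 * (2 * μ * α₀) ^ 2 := by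
              rw [mul_assoc]
              refine mul_le_mul_of_nonneg_left ?_ (sq_nonneg _)
              linarith
          _ = 4 * (c ^ 2 * α₀ ^ 2) := by field_simp; ring
          _ ≤ _ := by linarith
      exact (mul_le_mul_of_nonneg_right h1 (by positivity)).trans (le_of_mul_le_mul_right h3 ha)

variable {ν : Measure Ξ} [IsProbabilityMeasure ν] {Φ : Eu d → Ξ → Eu d} {K : Set (Eu d)}
  {μ c v : ℝ} {ys : Eu d}

/-- Strong monotonicity is averaged over `ξ`; the term at `ys` has a favorable sign by the
variational inequality. -/
theorem mul_norm_sq_le_inner_mean (hmono : ∀ ξ, StronglyMonotoneOn μ (fun y => Φ y ξ) K)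
    (hint : ∀ y ∈ K, Integrable (Φ y) ν) (hys : SolvesVI (fun y => ∫ ξ, Φ y ξ ∂ν) K ys)
    {y : Eu d} (hy : y ∈ K) :
    μ * ‖y - ys‖ ^ 2 ≤ inner ℝ (∫ ξ, Φ y ξ ∂ν) (y - ys) := by
  have hs : Integrable (fun ξ => Φ y ξ - Φ ys ξ) ν := (hint y hy).sub (hint ys hys.1)
  have h1 : μ * ‖y - ys‖ ^ 2 ≤ ∫ ξ, inner ℝ (y - ys) (Φ y ξ - Φ ys ξ) ∂ν := by
    have h : ∫ _, μ * ‖y - ys‖ ^ 2 ∂ν ≤ ∫ ξ, inner ℝ (y - ys) (Φ y ξ - Φ ys ξ) ∂ν := by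
      refine integral_mono (integrable_const _)
        (hs.const_inner (y - ys)) fun ξ => ?_
      simp only
      rw [real_inner_comm]
      exact hmono ξ y hy ys hys.1
    simpa using h
  rw [integral_inner hs,
    integral_sub (hint y hy) (hint ys hys.1), real_inner_comm, inner_sub_left] at h1
  have h2 := hys.2 y hy
  linarith

/-- A bounded, strongly monotone mean map forces `K` to be bounded. This supplies the a priori bound
in `sa_recursion` and the finiteness of the supremum in `saConst`. -/
theorem norm_sub_le_of_mean_bound (hμ : 0 < μ)
    (hmono : ∀ ξ, StronglyMonotoneOn μ (fun y => Φ y ξ) K)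
    (hint : ∀ y ∈ K, Integrable (Φ y) ν) (hys : SolvesVI (fun y => ∫ ξ, Φ y ξ ∂ν) K ys)
    (hc : ∀ y ∈ K, ‖∫ ξ, Φ y ξ ∂ν‖ ≤ c) {y : Eu d} (hy : y ∈ K) : ‖y - ys‖ ≤ c / μ := by
  have h1 := mul_norm_sq_le_inner_mean hmono hint hys hy
  have h2 := (real_inner_le_norm (∫ ξ, Φ y ξ ∂ν) (y - ys)).trans
    (mul_le_mul_of_nonneg_right (hc y hy) (norm_nonneg _))
  rw [le_div_iff₀ hμ]
  have hc0 : 0 ≤ c := (norm_nonneg _).trans (hc y hy)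
  by_contra hlt
  push Not at hlt
  rcases (norm_nonneg (y - ys)).eq_or_lt' with h | h
  · rw [h] at hlt
    linarith
  · nlinarith

/-- The projection is nonexpansive and fixes `ys`; the noise is centered, so only its variance
survives next to the deterministic step. -/
theorem integral_step_le {α : ℝ} (hα : 0 ≤ α) (hcl : IsClosed K) (hcv : Convex ℝ K)
    (hmono : ∀ ξ, StronglyMonotoneOn μ (fun y => Φ y ξ) K)
    (hint : ∀ y ∈ K, Integrable (Φ y) ν) (hys : SolvesVI (fun y => ∫ ξ, Φ y ξ ∂ν) K ys)
    (hc : ∀ y ∈ K, ‖∫ ξ, Φ y ξ ∂ν‖ ≤ c)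
    (hv : ∀ y ∈ K, Integrable (fun ξ => ‖Φ y ξ - ∫ ξ', Φ y ξ' ∂ν‖ ^ 2) ν ∧
      ∫ ξ, ‖Φ y ξ - ∫ ξ', Φ y ξ' ∂ν‖ ^ 2 ∂ν ≤ v ^ 2)
    {y : Eu d} (hy : y ∈ K) :
    ∫ ξ, ‖proj K (y - α • Φ y ξ) - ys‖ ^ 2 ∂ν ≤
      (1 - 2 * α * μ) * ‖y - ys‖ ^ 2 + α ^ 2 * (c ^ 2 + v ^ 2) := by
  set m := ∫ ξ, Φ y ξ ∂ν
  have hs : Integrable (fun ξ => Φ y ξ - m) ν := (hint y hy).sub (integrable_const m)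
  have hpt : ∀ ξ, ‖proj K (y - α • Φ y ξ) - ys‖ ^ 2 ≤ ‖(y - ys) - α • m‖ ^ 2 +
      α ^ 2 * ‖Φ y ξ - m‖ ^ 2 - 2 * α * inner ℝ ((y - ys) - α • m) (Φ y ξ - m) := by
    intro ξ
    have h1 := norm_proj_sub_proj_le ⟨y, hy⟩ hcl hcv (y - α • Φ y ξ) ys
    rw [proj_of_mem hcl hcv hys.1] at h1
    have h2 : y - α • Φ y ξ - ys = ((y - ys) - α • m) - α • (Φ y ξ - m) := by
      rw [smul_sub]; abel
    calc _ ≤ ‖y - α • Φ y ξ - ys‖ ^ 2 := pow_le_pow_left₀ (norm_nonneg _) h1 2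
      _ = _ := by
        rw [h2, norm_sub_sq_real, norm_smul, real_inner_smul_right, mul_pow, Real.norm_eq_abs,
          sq_abs]
        ring
  have hi1 : Integrable (fun ξ => inner ℝ ((y - ys) - α • m) (Φ y ξ - m)) ν :=
    hs.const_inner _
  have hz : ∫ ξ, inner ℝ ((y - ys) - α • m) (Φ y ξ - m) ∂ν = 0 := by
    rw [integral_inner hs, integral_sub (hint y hy)
      (integrable_const m)]
    simp [m]
  have hi2 : Integrable (fun ξ => α ^ 2 * ‖Φ y ξ - m‖ ^ 2) ν := (hv y hy).1.const_mul (α ^ 2)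
  have hi3 : Integrable (fun ξ => ‖(y - ys) - α • m‖ ^ 2 + α ^ 2 * ‖Φ y ξ - m‖ ^ 2) ν :=
    (integrable_const _).add hi2
  have h1 : ∫ ξ, ‖proj K (y - α • Φ y ξ) - ys‖ ^ 2 ∂ν ≤ ‖(y - ys) - α • m‖ ^ 2 +
      α ^ 2 * ∫ ξ, ‖Φ y ξ - m‖ ^ 2 ∂ν := by
    have h2 : ∫ ξ, (‖(y - ys) - α • m‖ ^ 2 + α ^ 2 * ‖Φ y ξ - m‖ ^ 2 -
        2 * α * inner ℝ ((y - ys) - α • m) (Φ y ξ - m)) ∂ν = ‖(y - ys) - α • m‖ ^ 2 +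
      α ^ 2 * ∫ ξ, ‖Φ y ξ - m‖ ^ 2 ∂ν := by
      rw [integral_sub hi3 (hi1.const_mul _),
        integral_add (integrable_const _) hi2, integral_const_mul, integral_const_mul, hz]
      simp
    rw [← h2]
    exact integral_mono_of_nonneg (.of_forall fun ξ => sq_nonneg _)
      (hi3.sub (hi1.const_mul _)) (.of_forall hpt)
  have h3 : α ^ 2 * ∫ ξ, ‖Φ y ξ - m‖ ^ 2 ∂ν ≤ α ^ 2 * v ^ 2 :=
    mul_le_mul_of_nonneg_left (hv y hy).2 (sq_nonneg _)
  have h4 : ‖(y - ys) - α • m‖ ^ 2 ≤ ‖y - ys‖ ^ 2 - 2 * α * (μ * ‖y - ys‖ ^ 2) +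
      α ^ 2 * c ^ 2 := by
    rw [norm_sub_sq_real, norm_smul, real_inner_smul_right, mul_pow, Real.norm_eq_abs, sq_abs]
    have h5 := mul_norm_sq_le_inner_mean hmono hint hys hy
    rw [real_inner_comm] at h5
    have h6 : α ^ 2 * ‖m‖ ^ 2 ≤ α ^ 2 * c ^ 2 :=
      mul_le_mul_of_nonneg_left (pow_le_pow_left₀ (norm_nonneg _) (hc y hy) 2) (sq_nonneg _)
    have h7 := mul_le_mul_of_nonneg_left h5 hα
    linarith
  linarith

/-- Mean square error of the stochastic approximation scheme for a strongly monotone stochastic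
variational inequality. -/
theorem integral_saIter_le (hΦ : Measurable (Function.uncurry Φ)) (hcl : IsClosed K)
    (hcv : Convex ℝ K) (hμ : 0 < μ)
    (hmono : ∀ ξ, StronglyMonotoneOn μ (fun y => Φ y ξ) K)
    (hint : ∀ y ∈ K, Integrable (Φ y) ν) (hys : SolvesVI (fun y => ∫ ξ, Φ y ξ ∂ν) K ys)
    (hc : ∀ y ∈ K, ‖∫ ξ, Φ y ξ ∂ν‖ ≤ c)
    (hv : ∀ y ∈ K, Integrable (fun ξ => ‖Φ y ξ - ∫ ξ', Φ y ξ' ∂ν‖ ^ 2) ν ∧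
      ∫ ξ, ‖Φ y ξ - ∫ ξ', Φ y ξ' ∂ν‖ ^ 2 ∂ν ≤ v ^ 2)
    {α₀ Γ C : ℝ} {y₀ : Eu d} (hy₀ : y₀ ∈ K) (hα : 1 / (2 * μ) < α₀)
    (hΓ : 0 < Γ) (hC : (c ^ 2 + v ^ 2) * α₀ ^ 2 / (2 * μ * α₀ - 1) ≤ C)
    (h0 : Γ * ‖y₀ - ys‖ ^ 2 ≤ C) (t : ℕ) :
    ∫⁻ ζ, ENNReal.ofReal (‖saIter Φ K α₀ Γ y₀ ζ t - ys‖ ^ 2)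
      ∂(Measure.infinitePi fun _ : ℕ => ν) ≤ ENNReal.ofReal (4 * C / (t + Γ)) := by
  set π := Measure.infinitePi fun _ : ℕ => ν
  have hα0 : 0 < α₀ := (by positivity : 0 < 1 / (2 * μ)).trans hα
  have hbd : ∀ y ∈ K, ‖y - ys‖ ^ 2 ≤ (c / μ) ^ 2 := fun y hy =>
    pow_le_pow_left₀ (norm_nonneg _) (norm_sub_le_of_mean_bound hμ hmono hint hys hc hy) 2
  have hΦ' : ∀ (m : MeasurableSpace (ℕ → Ξ)) (y : (ℕ → Ξ) → Eu d) (ξ : (ℕ → Ξ) → Ξ),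
      Measurable y → Measurable ξ → Measurable fun ω => Φ (y ω) (ξ ω) :=
    fun m y ξ hy hξ => hΦ.comp (hy.prodMk hξ)
  have hmeas : ∀ t, Measurable fun ζ : ℕ → Ξ => saIter Φ K α₀ Γ y₀ ζ t := fun t =>
    measurable_saIter hcl hcv hy₀ (hΦ' _) fun s _ => measurable_pi_apply s
  have hintg : ∀ t, Integrable (fun ζ => ‖saIter Φ K α₀ Γ y₀ ζ t - ys‖ ^ 2) π := fun t =>
    Integrable.of_bound (((hmeas t).sub_const ys).norm.pow_const 2).aestronglyMeasurable
      ((c / μ) ^ 2) (.of_forall fun ζ => by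
        rw [Real.norm_of_nonneg (sq_nonneg _)]
        exact hbd _ (saIter_mem hcl hy₀ ζ t))
  have hreal : ∫ ζ, ‖saIter Φ K α₀ Γ y₀ ζ t - ys‖ ^ 2 ∂π ≤ 4 * C / (t + Γ) := by
    refine sa_recursion (e := fun t => ∫ ζ, ‖saIter Φ K α₀ Γ y₀ ζ t - ys‖ ^ 2 ∂π) hμ hα hΓ hC
      (by simpa [saIter] using h0) (fun t => ?_) (fun t => ?_) t
    · calc _ ≤ ∫ _, (c / μ) ^ 2 ∂π := integral_mono (hintg t) (integrable_const _)
            fun ζ => hbd _ (saIter_mem hcl hy₀ ζ t)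
        _ = _ := by simp
    · have hαt : 0 ≤ α₀ / (t + Γ) := by positivity
      have hZ : iIndepFun (fun (i : ℕ) (ζ : ℕ → Ξ) => ζ i) π :=
        iIndepFun_infinitePi (X := fun _ ξ => ξ) fun _ => measurable_id
      -- The iterate `y^t` uses the draws `0, …, t - 1` only, hence is independent of `ξ^t`.
      have hXs : Measurable[⨆ i ∈ Set.Iio t,
          MeasurableSpace.comap (fun ζ : ℕ → Ξ => ζ i) inferInstance]
          fun ζ : ℕ → Ξ => saIter Φ K α₀ Γ y₀ ζ t := by
        refine measurable_saIter (mΩ := _) hcl hcv hy₀ (hΦ' _) fun s hs => ?_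
        refine Measurable.mono (comap_measurable _) ?_ le_rfl
        exact le_iSup₂_of_le s hs le_rfl
      have hWs : Measurable[⨆ i ∈ ({t} : Set ℕ),
          MeasurableSpace.comap (fun ζ : ℕ → Ξ => ζ i) inferInstance]
          fun ζ : ℕ → Ξ => ζ t :=
        Measurable.mono (comap_measurable _) (le_iSup₂_of_le t rfl le_rfl) le_rfl
      have hind := indepFun_of_iIndepFun_of_disjoint (fun i => measurable_pi_apply i) hZ
        (by simp) hXs hWs
      have hproj := continuous_proj ⟨y₀, hy₀⟩ hcl hcv
      have hlaw : π.map (fun ζ => ζ t) = ν := Measure.infinitePi_map_eval _ t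
      have := integral_indep_le (φ := fun p : Eu d × Ξ =>
        ‖proj K (p.1 - (α₀ / (t + Γ)) • Φ p.1 p.2) - ys‖ ^ 2) (hmeas t) (measurable_pi_apply t) hind
        (((hproj.measurable.comp (measurable_fst.sub
          (hΦ.const_smul (α₀ / (t + Γ))))).sub_const ys).norm.pow_const 2)
        (b := (c / μ) ^ 2) (fun p => by
          rw [abs_of_nonneg (sq_nonneg _)]
          exact hbd _ (proj_mem ⟨y₀, hy₀⟩ hcl _))
        (ψ := fun ζ => (1 - 2 * (α₀ / (t + Γ)) * μ) * ‖saIter Φ K α₀ Γ y₀ ζ t - ys‖ ^ 2 +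
          (α₀ / (t + Γ)) ^ 2 * (c ^ 2 + v ^ 2))
        (((hintg t).const_mul _).add (integrable_const _)) (fun ζ => by
          rw [hlaw]
          exact integral_step_le hαt hcl hcv hmono hint hys hc hv
            (saIter_mem hcl hy₀ ζ t))
      rw [integral_add ((hintg t).const_mul _) (integrable_const _), integral_const_mul] at this
      simpa [saIter] using this
  rw [← ofReal_integral_eq_lintegral_ofReal (hintg t) (.of_forall fun ζ => sq_nonneg _)]
  exact ENNReal.ofReal_le_ofReal hreal

end SA

/-! ### Measurability of the data and of the estimators. -/

section Measurability

open Set Filter Topology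

variable {N : ℕ} {n κ : Fin N → ℕ}

theorem upd_apply_self (x : Profile n) (i : Fin N) (z : Eu (n i)) : upd x i z i = z := by
  simp [upd]

theorem upd_apply_of_ne (x : Profile n) {i j : Fin N} (h : j ≠ i) (z : Eu (n i)) :
    upd x i z j = x j := by
  simp [upd, Function.update_of_ne h]

theorem upd_self (x : Profile n) (i : Fin N) : upd x i (x i) = x := by
  simp [upd]

theorem measurable_upd (i : Fin N) :
    Measurable fun p : Profile n × Eu (n i) => upd p.1 i p.2 := by
  refine (WithLp.measurable_toLp 2 _).comp ?_
  refine measurable_pi_lambda _ fun j => ?_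
  by_cases h : j = i
  · subst h
    simpa using measurable_snd
  · simp only [Function.update_of_ne h]
    exact (measurable_pi_apply j).comp ((WithLp.measurable_ofLp 2 _).comp measurable_fst)

theorem measurable_block (i : Fin N) : Measurable fun x : Profile n => x i :=
  (measurable_pi_apply i).comp (WithLp.measurable_ofLp 2 _)

variable {Ξ : Type*}

/-- The value `h̃_i(z, y_i(z), ξ)`, extended by zero outside `U_i`. -/
noncomputable def Game.hval (G : Game n κ Ξ) (i : Fin N) (z : Eu (n i)) (ξ : Ξ) : ℝ :=
  (G.U i).indicator (fun z => G.h i z (G.y i z) ξ) z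

theorem Game.hval_of_mem (G : Game n κ Ξ) {i : Fin N} {z : Eu (n i)} (hz : z ∈ G.U i) (ξ : Ξ) :
    G.hval i z ξ = G.h i z (G.y i z) ξ :=
  indicator_of_mem hz _

/-- The estimator with exact lower-level solutions. -/
noncomputable def Game.exactEstimator (G : Game n κ Ξ) (η : ℝ) (i : Fin N) (x : Profile n)
    (w : Ξ × Eu (n i)) : Eu (n i) :=
  ((n i : ℝ) / (2 * η) * (G.hval i (x i + w.2) w.1 - G.hval i (x i - w.2) w.1)) •
    (‖w.2‖⁻¹ • w.2) + G.gradM i x w.1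

theorem Game.upd_mem_XX {G : Game n κ Ξ} {x : Profile n} (hx : x ∈ G.XX) {i : Fin N}
    {z : Eu (n i)} (hz : z ∈ G.X i) : upd x i z ∈ G.XX := by
  intro j
  by_cases h : j = i
  · subst h
    rwa [upd_apply_self]
  · rw [upd_apply_of_ne x h]
    exact hx j

theorem Game.inexactness_nonneg {G : Game n κ Ξ} {α₀ Γ : ℝ} {μ c v : Fin N → ℝ}
    {y₀ : ∀ i, Eu (κ i)} (hα : ∀ i, 0 < 2 * μ i * α₀ - 1) (hΓ : 0 < Γ) (t : ℕ) :
    0 ≤ G.inexactness μ α₀ Γ y₀ c v t := by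
  refine div_nonneg (Real.iSup_nonneg fun i => ?_) (by positivity)
  exact le_max_of_le_left (div_nonneg (by positivity) (hα i).le)

variable [MeasurableSpace Ξ] {G : Game n κ Ξ} {ν : Measure Ξ} {η : ℝ}
  {L : Fin N → ℝ≥0}

theorem Game.Standing.isClosed_XX (hG : G.Standing ν η L) : IsClosed G.XX := by
  have : G.XX = ⋂ i, (fun x : Profile n => x i) ⁻¹' G.X i := by
    ext x
    simp [Game.XX]
  rw [this]
  exact isClosed_iInter fun i => (hG.closed_X i).preimage (by fun_prop)

theorem Game.Standing.convex_XX (hG : G.Standing ν η L) : Convex ℝ G.XX := by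
  intro x hx y hy a b ha hb hab i
  exact hG.convex_X i (hx i) (hy i) ha hb hab

/-- The solution map `G.y i` is not known to be measurable. Joint measurability follows from the
Carathéodory property on `U_i`: Lipschitz in the point, measurable in `ξ`. -/
theorem Game.Standing.measurable_hval (hG : G.Standing ν η L) (i : Fin N) :
    Measurable fun p : Eu (n i) × Ξ => G.hval i p.1 p.2 := by
  have h1 : Measurable (Function.uncurry fun (z : G.U i) (ξ : Ξ) => G.h i z (G.y i z) ξ) := by
    refine measurable_uncurry_of_continuous_of_measurable (fun ξ => ?_) fun z => ?_
    · exact (hG.lipschitz_h i ξ).continuousOn.domRestrict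
    · have : Measurable fun ξ : Ξ => ((z : Eu (n i)), G.y i z, ξ) := by fun_prop
      exact (hG.measurable_h i).comp this
  have hm : MeasurableSet (Prod.fst ⁻¹' (G.U i) : Set (Eu (n i) × Ξ)) :=
    measurable_fst (hG.open_U i).measurableSet
  refine measurable_of_restrict_of_restrict_compl hm ?_ ?_
  · have h2 : Measurable fun p : (Prod.fst ⁻¹' (G.U i) : Set (Eu (n i) × Ξ)) =>
        ((⟨p.1.1, p.2⟩ : G.U i), p.1.2) :=
      ((measurable_fst.comp measurable_subtype_coe).subtype_mk).prodMk
        (measurable_snd.comp measurable_subtype_coe)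
    convert h1.comp h2 using 1
    ext p
    exact G.hval_of_mem p.2 _
  · have : (Prod.fst ⁻¹' (G.U i) : Set (Eu (n i) × Ξ))ᶜ.domRestrict
        (fun p : Eu (n i) × Ξ => G.hval i p.1 p.2) = fun _ => 0 := by
      ext p
      have hp : p.1.1 ∉ G.U i := p.2
      simp [Game.hval, hp]
    rw [this]
    exact measurable_const

theorem Game.Standing.differentiableAt_m (hG : G.Standing ν η L) (i : Fin N) (ξ : Ξ)
    {x : Profile n} (hx : x ∈ G.XX) : DifferentiableAt ℝ (fun z => G.m i (upd x i z) ξ) (x i) :=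
  (hG.contDiff_m i ξ x hx).differentiableAt one_ne_zero

/-- Each coordinate is a limit of measurable difference quotients. The domain is the subtype `G.XX`,
where differentiability is available. -/
theorem Game.Standing.measurable_gradM (hG : G.Standing ν η L) (i : Fin N) :
    Measurable fun p : G.XX × Ξ => G.gradM i p.1 p.2 := by
  have key : ∀ j : Fin (n i), Measurable fun p : G.XX × Ξ => G.gradM i p.1 p.2 j := by
    intro j
    set e : Eu (n i) := EuclideanSpace.single j 1
    have hlim : ∀ p : G.XX × Ξ, Tendsto (fun k : ℕ => ((1 : ℝ) / (k + 1))⁻¹ *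
        (G.m i (upd p.1 i ((p.1 : Profile n) i + ((1 : ℝ) / (k + 1)) • e)) p.2 -
          G.m i (upd p.1 i ((p.1 : Profile n) i)) p.2)) atTop (𝓝 (G.gradM i p.1 p.2 j)) := by
      intro p
      have hd := hG.differentiableAt_m i p.2 p.1.2
      have h1 := (hd.hasFDerivAt.hasLineDerivAt e).tendsto_slope_zero_right
      have h2 : Tendsto (fun k : ℕ => (1 : ℝ) / (k + 1)) atTop (𝓝[>] 0) := by
        rw [tendsto_nhdsWithin_iff]
        exact ⟨tendsto_one_div_add_atTop_nhds_zero_nat, .of_forall fun k =>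
          mem_Ioi.2 (by positivity)⟩
      have h3 := h1.comp h2
      have h4 : fderiv ℝ (fun z => G.m i (upd p.1 i z) p.2) ((p.1 : Profile n) i) e =
          G.gradM i p.1 p.2 j := by
        have h5 : inner ℝ (G.gradM i p.1 p.2) e = G.gradM i p.1 p.2 j := by
          simp [e, EuclideanSpace.inner_single_right]
        rw [← h5, ← InnerProductSpace.toDual_apply_apply (𝕜 := ℝ)]
        rw [Game.gradM, gradient, LinearIsometryEquiv.apply_symm_apply]
      rw [h4] at h3
      exact h3
    refine measurable_of_tendsto_metrizable (fun k => ?_) (tendsto_pi_nhds.2 hlim)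
    have hx : Measurable fun p : G.XX × Ξ => (p.1 : Profile n) :=
      measurable_subtype_coe.comp measurable_fst
    have hz : ∀ c : ℝ, Measurable fun p : G.XX × Ξ =>
        G.m i (upd p.1 i ((p.1 : Profile n) i + c • e)) p.2 := by
      intro c
      have h1 : Measurable fun p : G.XX × Ξ => (p.1 : Profile n) i + c • e :=
        ((measurable_block i).comp hx).add_const _
      exact (hG.measurable_m i).comp (((measurable_upd i).comp (hx.prodMk h1)).prodMk
        measurable_snd)
    have h0 := hz 0
    simp only [zero_smul, add_zero] at h0
    exact ((hz _).sub h0).const_mul _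
  have := (WithLp.measurable_toLp 2 (Fin (n i) → ℝ)).comp (measurable_pi_lambda _ key)
  exact this

theorem Game.Standing.measurable_exactEstimator (hG : G.Standing ν η L) (i : Fin N) :
    Measurable fun p : G.XX × Ξ × Eu (n i) => G.exactEstimator η i p.1 p.2 := by
  have hx : Measurable fun p : G.XX × Ξ × Eu (n i) => (p.1 : Profile n) i :=
    (measurable_block i).comp (measurable_subtype_coe.comp measurable_fst)
  have hv : Measurable fun p : G.XX × Ξ × Eu (n i) => p.2.2 := by fun_prop
  have hξ : Measurable fun p : G.XX × Ξ × Eu (n i) => p.2.1 := by fun_prop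
  have h1 := (hG.measurable_hval i).comp ((hx.add hv).prodMk hξ)
  have h2 := (hG.measurable_hval i).comp ((hx.sub hv).prodMk hξ)
  have h3 : Measurable fun p : G.XX × Ξ × Eu (n i) => ‖p.2.2‖⁻¹ • p.2.2 := by fun_prop
  have h4 := (hG.measurable_gradM i).comp
    ((measurable_fst.prodMk hξ : Measurable fun p : G.XX × Ξ × Eu (n i) => (p.1, p.2.1)))
  exact (((h1.sub h2).const_mul _).smul h3).add h4

theorem Game.Standing.measurable_estimator (hG : G.Standing ν η L) {y₀ : ∀ i, Eu (κ i)}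
    (hy₀ : ∀ i, y₀ i ∈ G.Y i) (α₀ Γ : ℝ) (t : ℕ) (i : Fin N) :
    Measurable fun p : G.XX × Draw Ξ (n i) => G.estimator η α₀ Γ y₀ t i p.1 p.2 := by
  have hx : Measurable fun p : G.XX × Draw Ξ (n i) => (p.1 : Profile n) i :=
    (measurable_block i).comp (measurable_subtype_coe.comp measurable_fst)
  have hv : Measurable fun p : G.XX × Draw Ξ (n i) => p.2.2.1 := by fun_prop
  have hξ : Measurable fun p : G.XX × Draw Ξ (n i) => p.2.1 := by fun_prop
  have hsa : ∀ (z : G.XX × Draw Ξ (n i) → Eu (n i)) (ζ : G.XX × Draw Ξ (n i) → ℕ → Ξ),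
      Measurable z → Measurable ζ →
      Measurable fun p => saIter (G.F i (z p)) (G.Y i) α₀ Γ (y₀ i) (ζ p) t := by
    intro z ζ hz hζ
    exact measurable_saIter (hG.closed_Y i) (hG.convex_Y i) (hy₀ i)
      (fun y ξ hy hξ => (hG.measurable_F i).comp (hz.prodMk (hy.prodMk hξ)))
      fun s _ => (measurable_pi_apply s).comp hζ
  have hp : Measurable fun p : G.XX × Draw Ξ (n i) => (p.1 : Profile n) i + p.2.2.1 := hx.add hv
  have hm : Measurable fun p : G.XX × Draw Ξ (n i) => (p.1 : Profile n) i - p.2.2.1 := hx.sub hv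
  have h1 := (hG.measurable_h i).comp (hp.prodMk ((hsa _ (fun p => p.2.2.2.1) hp
    (by fun_prop)).prodMk hξ))
  have h2 := (hG.measurable_h i).comp (hm.prodMk ((hsa _ (fun p => p.2.2.2.2) hm
    (by fun_prop)).prodMk hξ))
  have h3 : Measurable fun p : G.XX × Draw Ξ (n i) => ‖p.2.2.1‖⁻¹ • p.2.2.1 := by fun_prop
  have h4 := (hG.measurable_gradM i).comp
    ((measurable_fst.prodMk hξ : Measurable fun p : G.XX × Draw Ξ (n i) => (p.1, p.2.1)))
  exact (((h1.sub h2).const_mul _).smul h3).add h4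

end Measurability

/-! ### Mean and variance of the estimator with exact lower-level solutions. -/

section Estimator

open Set Filter Topology Metric

variable {N : ℕ} {n κ : Fin N → ℕ} {Ξ : Type*} [MeasurableSpace Ξ] {G : Game n κ Ξ}
  {ν : Measure Ξ} {η : ℝ} {L : Fin N → ℝ≥0}

theorem Game.Standing.closedBall_subset (hG : G.Standing ν η L) {i : Fin N} {x : Eu (n i)}
    (hx : x ∈ G.X i) : closedBall x η ⊆ G.U i := fun z hz =>
  hG.Xη_sub_U i ⟨x, hx, by rwa [← dist_eq_norm, ← mem_closedBall]⟩

/-- The two-point estimator of the gradient of the smoothed implicit function. -/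
noncomputable def Game.twoPoint (G : Game n κ Ξ) (η : ℝ) (i : Fin N) (z : Eu (n i))
    (w : Ξ × Eu (n i)) : Eu (n i) :=
  ((n i : ℝ) / (2 * η) * (G.hval i (z + w.2) w.1 - G.hval i (z - w.2) w.1)) • (‖w.2‖⁻¹ • w.2)

theorem Game.Standing.measurable_twoPoint (hG : G.Standing ν η L) (i : Fin N) (z : Eu (n i)) :
    Measurable (G.twoPoint η i z) := by
  have h1 : Measurable fun w : Ξ × Eu (n i) => (z + w.2, w.1) := by fun_prop
  have h2 : Measurable fun w : Ξ × Eu (n i) => (z - w.2, w.1) := by fun_prop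
  have h3 : Measurable fun w : Ξ × Eu (n i) => ‖w.2‖⁻¹ • w.2 := by fun_prop
  exact ((((hG.measurable_hval i).comp h1).sub ((hG.measurable_hval i).comp h2)).const_mul
    _).smul h3

theorem ae_prod_sphere {i : Fin N} (hn : 0 < n i) (hη : 0 < η) :
    ∀ᵐ w ∂ν.prod (sphereUniform (n i) η), ‖w.2‖ = η := by
  have := isProbabilityMeasure_sphereUniform hn η
  exact Measure.quasiMeasurePreserving_snd.ae (ae_norm_eq_sphereUniform hη)

theorem Game.smoothedCost_upd (i : Fin N) (x : Profile n) :
    (fun z => G.smoothedCost ν η i (upd x i z)) =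
      fun z => ballSmooth η (G.hImp ν i) z + G.meanM ν i (upd x i z) := by
  ext z
  rw [Game.smoothedCost, upd_apply_self]

theorem Game.Standing.measurable_gradM_apply (hG : G.Standing ν η L) (i : Fin N) {x : Profile n}
    (hx : x ∈ G.XX) : Measurable (G.gradM i x) :=
  (hG.measurable_gradM i).comp (measurable_prodMk_left (x := (⟨x, hx⟩ : G.XX)))

theorem Game.Standing.norm_twoPoint (hG : G.Standing ν η L) (hη : 0 < η) {i : Fin N}
    {z : Eu (n i)} (hz : z ∈ G.X i) {w : Ξ × Eu (n i)} (hw : ‖w.2‖ = η) :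
    ‖G.twoPoint η i z w‖ = (n i : ℝ) / (2 * η) *
      |G.h i (z + w.2) (G.y i (z + w.2)) w.1 - G.h i (z - w.2) (G.y i (z - w.2)) w.1| := by
  have m1 : z + w.2 ∈ G.U i := hG.closedBall_subset hz (by simp [hw])
  have m2 : z - w.2 ∈ G.U i := hG.closedBall_subset hz (by simp [hw])
  rw [Game.twoPoint, G.hval_of_mem m1, G.hval_of_mem m2, norm_smul, norm_smul, norm_inv, norm_norm,
    hw, inv_mul_cancel₀ hη.ne', mul_one, norm_mul, Real.norm_of_nonneg (by positivity),
    Real.norm_eq_abs]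

theorem Game.Standing.norm_twoPoint_le (hG : G.Standing ν η L) (hη : 0 < η) {i : Fin N}
    {z : Eu (n i)} (hz : z ∈ G.X i) {w : Ξ × Eu (n i)} (hw : ‖w.2‖ = η) :
    ‖G.twoPoint η i z w‖ ≤ n i * L i := by
  have m1 : z + w.2 ∈ G.U i := hG.closedBall_subset hz (by simp [hw])
  have m2 : z - w.2 ∈ G.U i := hG.closedBall_subset hz (by simp [hw])
  rw [hG.norm_twoPoint hη hz hw, ← Real.dist_eq]
  have h1 := (hG.lipschitz_h i w.1).dist_le_mul _ m1 _ m2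
  have h2 : dist (z + w.2) (z - w.2) ≤ 2 * η := by
    rw [dist_eq_norm, show z + w.2 - (z - w.2) = w.2 + w.2 by abel]
    refine (norm_add_le _ _).trans ?_
    rw [hw]; linarith
  calc _ ≤ (n i : ℝ) / (2 * η) * (L i * (2 * η)) := by
        refine mul_le_mul_of_nonneg_left (h1.trans ?_) (by positivity)
        exact mul_le_mul_of_nonneg_left h2 (L i).2
    _ = _ := by field_simp

variable [IsProbabilityMeasure ν]

theorem Game.Standing.lipschitzOnWith_hImp (hG : G.Standing ν η L) (i : Fin N) :
    LipschitzOnWith (L i) (G.hImp ν i) (G.U i) := by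
  refine LipschitzOnWith.of_dist_le_mul fun x hx y hy => ?_
  rw [Real.dist_eq, Game.hImp, Game.hImp,
    ← integral_sub (hG.integrable_h i x hx) (hG.integrable_h i y hy), ← Real.norm_eq_abs]
  refine (norm_integral_le_of_norm_le_const (C := L i * dist x y) (.of_forall fun ξ => ?_)).trans
    (by simp)
  rw [Real.norm_eq_abs, ← Real.dist_eq]
  exact (hG.lipschitz_h i ξ).dist_le_mul x hx y hy

theorem Game.Standing.memLp_twoPoint (hG : G.Standing ν η L) (hη : 0 < η) {i : Fin N}
    (hn : 0 < n i) {z : Eu (n i)} (hz : z ∈ G.X i) :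
    MemLp (G.twoPoint η i z) 2 (ν.prod (sphereUniform (n i) η)) := by
  have := isProbabilityMeasure_sphereUniform hn η
  refine MemLp.of_bound (hG.measurable_twoPoint i z).aestronglyMeasurable (n i * L i) ?_
  filter_upwards [ae_prod_sphere hn hη] with w hw
  exact hG.norm_twoPoint_le hη hz hw

/-- Fubini with `ξ` integrated first turns the random values into values of `hImp`, to which the
smoothing formula applies. -/
theorem Game.Standing.hasGradientAt_hImp (hG : G.Standing ν η L) (hη : 0 < η) {i : Fin N}
    (hn : 0 < n i) {z : Eu (n i)} (hz : z ∈ G.X i) :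
    HasGradientAt (ballSmooth η (G.hImp ν i))
      (∫ w, G.twoPoint η i z w ∂ν.prod (sphereUniform (n i) η)) z := by
  have := isProbabilityMeasure_sphereUniform hn η
  have h1 := hasGradientAt_ballSmooth hn hη (hG.open_U i) (hG.lipschitzOnWith_hImp i)
    (hG.closedBall_subset hz)
  convert h1 using 1
  rw [integral_prod_symm _ ((hG.memLp_twoPoint hη hn hz).integrable one_le_two)]
  refine integral_congr_ae ?_
  filter_upwards [ae_norm_eq_sphereUniform hη] with v hv
  have m1 : z + v ∈ G.U i := hG.closedBall_subset hz (by simp [hv])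
  have m2 : z - v ∈ G.U i := hG.closedBall_subset hz (by simp [hv])
  simp only [Game.twoPoint, G.hval_of_mem m1, G.hval_of_mem m2]
  rw [integral_smul_const, integral_const_mul,
    integral_sub (hG.integrable_h i _ m1) (hG.integrable_h i _ m2)]
  rfl

/-- The spherical estimate is applied for each fixed `ξ`; it cancels one of the two factors `n i` in
the squared prefactor. -/
theorem Game.Standing.integral_norm_twoPoint_sq_le (hG : G.Standing ν η L) (hη : 0 < η)
    {i : Fin N} (hn : 0 < n i) {z : Eu (n i)} (hz : z ∈ G.X i) :
    ∫ w, ‖G.twoPoint η i z w‖ ^ 2 ∂ν.prod (sphereUniform (n i) η) ≤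
      9 * Real.pi ^ 2 / 4 * n i * L i ^ 2 := by
  have := isProbabilityMeasure_sphereUniform hn η
  have hn' : (0 : ℝ) < n i := Nat.cast_pos.2 hn
  have hint := (hG.memLp_twoPoint hη hn hz).integrable_norm_pow two_ne_zero
  rw [integral_prod _ hint]
  have hξ : ∀ ξ, ∫ v, ‖G.twoPoint η i z (ξ, v)‖ ^ 2 ∂sphereUniform (n i) η ≤
      9 * Real.pi ^ 2 / 4 * n i * L i ^ 2 := by
    intro ξ
    have h1 := integral_two_point_sq_le hn hη (hG.lipschitz_h i ξ) (hG.closedBall_subset hz)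
    have h2 : ∫ v, ‖G.twoPoint η i z (ξ, v)‖ ^ 2 ∂sphereUniform (n i) η =
        ((n i : ℝ) / (2 * η)) ^ 2 * ∫ v, (G.h i (z + v) (G.y i (z + v)) ξ -
          G.h i (z - v) (G.y i (z - v)) ξ) ^ 2 ∂sphereUniform (n i) η := by
      rw [← integral_const_mul]
      refine integral_congr_ae ?_
      filter_upwards [ae_norm_eq_sphereUniform hη] with v hv
      rw [hG.norm_twoPoint hη hz (w := (ξ, v)) hv, mul_pow, sq_abs]
    rw [h2]
    calc _ = (n i : ℝ) / (4 * η ^ 2) * (n i * ∫ v, (G.h i (z + v) (G.y i (z + v)) ξ -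
          G.h i (z - v) (G.y i (z - v)) ξ) ^ 2 ∂sphereUniform (n i) η) := by
          field_simp
          ring
      _ ≤ (n i : ℝ) / (4 * η ^ 2) * (9 * Real.pi ^ 2 * (L i * η) ^ 2) :=
          mul_le_mul_of_nonneg_left h1 (by positivity)
      _ = _ := by field_simp
  calc _ ≤ ∫ _, 9 * Real.pi ^ 2 / 4 * n i * (L i : ℝ) ^ 2 ∂ν :=
        integral_mono hint.integral_prod_left (integrable_const _) hξ
    _ = _ := by simp

theorem integral_norm_sub_integral_sq_le {Ω : Type*} [MeasurableSpace Ω] {Q : Measure Ω}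
    [IsProbabilityMeasure Q] {d : ℕ} {f : Ω → Eu d} (hf : MemLp f 2 Q) :
    ∫ ω, ‖f ω - ∫ ω', f ω' ∂Q‖ ^ 2 ∂Q ≤ ∫ ω, ‖f ω‖ ^ 2 ∂Q := by
  set m := ∫ ω, f ω ∂Q
  have h1 : ∀ ω, ‖f ω - m‖ ^ 2 = ‖f ω‖ ^ 2 - 2 * inner ℝ m (f ω) + ‖m‖ ^ 2 := fun ω => by
    rw [norm_sub_sq_real, real_inner_comm]
  have hi := hf.integrable one_le_two
  have hi1 : Integrable (fun ω => ‖f ω‖ ^ 2) Q := hf.integrable_norm_pow two_ne_zero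
  have hi2 : Integrable (fun ω => 2 * inner ℝ m (f ω)) Q := (hi.const_inner m).const_mul 2
  have hi3 : Integrable (fun ω => ‖f ω‖ ^ 2 - 2 * inner ℝ m (f ω)) Q := hi1.sub hi2
  simp_rw [h1]
  rw [integral_add hi3 (integrable_const _), integral_sub hi1 hi2, integral_const_mul,
    integral_inner hi, real_inner_self_eq_norm_sq]
  simp only [integral_const, probReal_univ, one_smul]
  nlinarith [sq_nonneg ‖m‖]

variable {P : Profile n → ℝ} {LHI Pmax Pmin σm : ℝ} {μ : Fin N → ℝ} {Ly : Fin N → ℝ≥0}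

theorem Game.Standing.hasGradientAt_smoothedCost (hG : G.Standing ν η L)
    (hD : G.Assumptions ν η P LHI Pmax Pmin σm μ Ly) (hη : 0 < η) {i : Fin N}
    (hn : 0 < n i) {x : Profile n} (hx : x ∈ G.XX) :
    HasGradientAt (fun z => G.smoothedCost ν η i (upd x i z))
      ((∫ w, G.twoPoint η i (x i) w ∂ν.prod (sphereUniform (n i) η)) + G.gradMeanM ν i x)
      (x i) := by
  rw [Game.smoothedCost_upd]
  rw [hasGradientAt_iff_hasFDerivAt, map_add]
  exact (hG.hasGradientAt_hImp hη hn (hx i)).hasFDerivAt.add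
    (hD.unbiased i x hx).1.hasGradientAt.hasFDerivAt

theorem Game.Standing.Fη_apply (hG : G.Standing ν η L)
    (hD : G.Assumptions ν η P LHI Pmax Pmin σm μ Ly) (hη : 0 < η) {i : Fin N}
    (hn : 0 < n i) {x : Profile n} (hx : x ∈ G.XX) :
    G.Fη ν η x i =
      (∫ w, G.twoPoint η i (x i) w ∂ν.prod (sphereUniform (n i) η)) + G.gradMeanM ν i x :=
  (hG.hasGradientAt_smoothedCost hD hη hn hx).gradient

theorem Game.Standing.memLp_exactEstimator_sub (hG : G.Standing ν η L)
    (hD : G.Assumptions ν η P LHI Pmax Pmin σm μ Ly) (hη : 0 < η) {i : Fin N}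
    (hn : 0 < n i) {x : Profile n} (hx : x ∈ G.XX) :
    MemLp (fun w => G.exactEstimator η i x w - G.Fη ν η x i) 2 (ν.prod (sphereUniform (n i) η)) ∧
    ∫ w, (G.exactEstimator η i x w - G.Fη ν η x i) ∂ν.prod (sphereUniform (n i) η) = 0 ∧
    ∫ w, ‖G.exactEstimator η i x w - G.Fη ν η x i‖ ^ 2 ∂ν.prod (sphereUniform (n i) η) ≤
      9 * Real.pi ^ 2 / 2 * n i * L i ^ 2 + 2 * σm ^ 2 := by
  have := isProbabilityMeasure_sphereUniform hn η
  set ρ := ν.prod (sphereUniform (n i) η)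
  set A := G.twoPoint η i (x i)
  set a := ∫ w, A w ∂ρ
  set b := G.gradMeanM ν i x
  have hA : MemLp A 2 ρ := hG.memLp_twoPoint hη hn (hx i)
  have hA' : MemLp (fun w => A w - a) 2 ρ := hA.sub (memLp_const a)
  obtain ⟨-, hBi, hBm⟩ := hD.unbiased i x hx
  obtain ⟨hB2, hB2'⟩ := hD.second_moment i x hx
  have hB : MemLp (fun ξ => G.gradM i x ξ - b) 2 ν := by
    refine (memLp_two_iff_integrable_sq_norm ?_).2 hB2
    exact ((hG.measurable_gradM_apply i hx).sub_const b).aestronglyMeasurable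
  have hfst : MeasurePreserving Prod.fst ρ ν := measurePreserving_fst
  have hB' : MemLp (fun w : Ξ × Eu (n i) => G.gradM i x w.1 - b) 2 ρ :=
    hB.comp_measurePreserving hfst
  have hdec : (fun w => G.exactEstimator η i x w - G.Fη ν η x i) =
      fun w => (A w - a) + (G.gradM i x w.1 - b) := by
    ext1 w
    rw [hG.Fη_apply hD hη hn hx, Game.exactEstimator]
    simp only [A, a, b, ρ, Game.twoPoint]
    abel
  have hBint : ∫ w : Ξ × Eu (n i), (G.gradM i x w.1 - b) ∂ρ = 0 := by
    rw [integral_fun_fst (μ := ν) (fun ξ => G.gradM i x ξ - b), integral_sub hBi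
      (integrable_const _), hBm]
    simp [b]
  refine ⟨?_, ?_, ?_⟩
  · rw [hdec]
    exact hA'.add hB'
  · rw [hdec, integral_add (hA'.integrable one_le_two) (hB'.integrable one_le_two), hBint,
      integral_sub (hA.integrable one_le_two) (integrable_const _)]
    simp [a]
  -- Both parts of the estimator use the same `ξ`, so the cross term need not vanish; it is absorbed
  -- at the price of a factor 2.
  · have h1 : ∀ w, ‖G.exactEstimator η i x w - G.Fη ν η x i‖ ^ 2 ≤
        2 * ‖A w - a‖ ^ 2 + 2 * ‖G.gradM i x w.1 - b‖ ^ 2 := by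
      intro w
      rw [congrFun hdec w]
      have h2 := parallelogram_law_with_norm ℝ (A w - a) (G.gradM i x w.1 - b)
      nlinarith [mul_self_nonneg ‖A w - a - (G.gradM i x w.1 - b)‖]
    have i1 := (hA'.integrable_norm_pow two_ne_zero).const_mul 2
    have i2 := (hB'.integrable_norm_pow two_ne_zero).const_mul 2
    have h3 : ∫ w : Ξ × Eu (n i), ‖G.gradM i x w.1 - b‖ ^ 2 ∂ρ ≤ σm ^ 2 := by
      rw [integral_fun_fst (μ := ν) (fun ξ => ‖G.gradM i x ξ - b‖ ^ 2)]
      simpa using hB2'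
    have h4 := (integral_norm_sub_integral_sq_le hA).trans
      (hG.integral_norm_twoPoint_sq_le hη hn (hx i))
    calc _ ≤ ∫ w, (2 * ‖A w - a‖ ^ 2 + 2 * ‖G.gradM i x w.1 - b‖ ^ 2) ∂ρ :=
          integral_mono_of_nonneg (.of_forall fun w => sq_nonneg _) (i1.add i2) (.of_forall h1)
      _ = 2 * ∫ w, ‖A w - a‖ ^ 2 ∂ρ + 2 * ∫ w, ‖G.gradM i x w.1 - b‖ ^ 2 ∂ρ := by
          rw [← integral_const_mul, ← integral_const_mul]
          exact integral_add i1 i2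
      _ ≤ _ := by linarith

end Estimator

/-! ### Sums of independent centered vectors. -/

section Batch

variable {Ω : Type*} [MeasurableSpace Ω] {Q : Measure Ω} [IsProbabilityMeasure Q] {d : ℕ}

/-- The mean square norm of a sum of independent centered random vectors. -/
theorem integral_norm_sum_sq {A : ℕ → Ω → Eu d} {s : Finset ℕ} (hA : ∀ l ∈ s, MemLp (A l) 2 Q)
    (h0 : ∀ l ∈ s, ∫ ω, A l ω ∂Q = 0)
    (hind : Set.Pairwise s fun l l' => IndepFun (A l) (A l') Q) :
    ∫ ω, ‖∑ l ∈ s, A l ω‖ ^ 2 ∂Q = ∑ l ∈ s, ∫ ω, ‖A l ω‖ ^ 2 ∂Q := by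
  have h1 : ∀ ω, ‖∑ l ∈ s, A l ω‖ ^ 2 = ∑ l ∈ s, ∑ l' ∈ s, inner ℝ (A l ω) (A l' ω) := fun ω => by
    rw [← real_inner_self_eq_norm_sq, sum_inner]
    simp_rw [inner_sum]
  have hi : ∀ l ∈ s, ∀ l' ∈ s, Integrable (fun ω => (inner ℝ (A l ω) (A l' ω) : ℝ)) Q :=
    fun l hl l' hl' => by
      refine ((hA l hl).norm.integrable_mul (hA l' hl').norm).mono'
        ((hA l hl).1.inner (hA l' hl').1) (.of_forall fun ω => ?_)
      exact norm_inner_le_norm _ _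
  simp_rw [h1]
  rw [integral_finsetSum _ fun l hl => integrable_finsetSum _ fun l' hl' => hi l hl l' hl']
  refine Finset.sum_congr rfl fun l hl => ?_
  rw [integral_finsetSum _ fun l' hl' => hi l hl l' hl', Finset.sum_eq_single_of_mem l hl]
  · simp_rw [real_inner_self_eq_norm_sq]
  · intro l' hl' hne
    have := (hind hl hl' hne.symm).integral_bilin (hX := (hA l hl).integrable one_le_two)
      (hY := (hA l' hl').integrable one_le_two) (B := innerSL ℝ)
    rw [h0 l hl, map_zero] at this
    exact this

end Batch

/-! ### Error from inexact lower-level solutions, and total error of a batch. -/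

section Bias

variable {N : ℕ} {n κ : Fin N → ℕ} {Ξ : Type*} [MeasurableSpace Ξ] {G : Game n κ Ξ}
  {ν : Measure Ξ} {η : ℝ} {L Ly : Fin N → ℝ≥0} {P : Profile n → ℝ}
  {LHI Pmax Pmin σm α₀ Γ : ℝ} {μ c v : Fin N → ℝ} {y₀ : ∀ i, Eu (κ i)}

theorem Game.Standing.measurable_estimator_apply (hG : G.Standing ν η L)
    (hy₀ : ∀ i, y₀ i ∈ G.Y i) (α₀ Γ : ℝ) (t : ℕ) (i : Fin N) {x : Profile n} (hx : x ∈ G.XX) :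
    Measurable fun w : Draw Ξ (n i) => G.estimator η α₀ Γ y₀ t i x w := by
  have h := (hG.measurable_estimator hy₀ α₀ Γ t i).comp
    (measurable_prodMk_left (x := (⟨x, hx⟩ : G.XX)))
  exact h

theorem Game.Standing.measurable_exactEstimator_apply (hG : G.Standing ν η L) (i : Fin N)
    {x : Profile n} (hx : x ∈ G.XX) :
    Measurable fun w : Draw Ξ (n i) => G.exactEstimator η i x (w.1, w.2.1) := by
  have h1 : Measurable fun w : Draw Ξ (n i) => ((⟨x, hx⟩ : G.XX), w.1, w.2.1) := by fun_prop
  have h := (hG.measurable_exactEstimator i).comp h1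
  exact h

/-- At a common `ξ` the `gradM` terms cancel, and Lipschitz continuity in the lower-level variable
converts the two solution errors. -/
theorem Game.Standing.norm_estimator_sub_sq_le (hG : G.Standing ν η L)
    (hD : G.Assumptions ν η P LHI Pmax Pmin σm μ Ly) (hη : 0 < η)
    (hy₀ : ∀ i, y₀ i ∈ G.Y i) {i : Fin N} {x : Profile n} (hx : x ∈ G.XX) (t : ℕ)
    {w : Draw Ξ (n i)} (hw : ‖w.2.1‖ = η) :
    ‖G.estimator η α₀ Γ y₀ t i x w - G.exactEstimator η i x (w.1, w.2.1)‖ ^ 2 ≤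
      (n i : ℝ) ^ 2 * Ly i ^ 2 / (2 * η ^ 2) *
      (‖saIter (G.F i (x i + w.2.1)) (G.Y i) α₀ Γ (y₀ i) w.2.2.1 t - G.y i (x i + w.2.1)‖ ^ 2 +
      ‖saIter (G.F i (x i - w.2.1)) (G.Y i) α₀ Γ (y₀ i) w.2.2.2 t - G.y i (x i - w.2.1)‖ ^ 2) := by
  have m1 : x i + w.2.1 ∈ G.U i := hG.closedBall_subset (hx i) (by simp [hw])
  have m2 : x i - w.2.1 ∈ G.U i := hG.closedBall_subset (hx i) (by simp [hw])
  have b1 := (hD.lipschitz_y i _ m1 w.1).dist_le_mul _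
    (saIter_mem (hG.closed_Y i) (hy₀ i) (Φ := G.F i (x i + w.2.1)) (α₀ := α₀) (Γ := Γ) w.2.2.1 t) _
    (hG.solves i _ m1).1
  have b2 := (hD.lipschitz_y i _ m2 w.1).dist_le_mul _
    (saIter_mem (hG.closed_Y i) (hy₀ i) (Φ := G.F i (x i - w.2.1)) (α₀ := α₀) (Γ := Γ) w.2.2.2 t) _
    (hG.solves i _ m2).1
  rw [Real.dist_eq, dist_eq_norm] at b1 b2
  simp only [Game.estimator, Game.exactEstimator, G.hval_of_mem m1, G.hval_of_mem m2]
  rw [add_sub_add_right_eq_sub, ← sub_smul, norm_smul, norm_smul, norm_inv, norm_norm, hw,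
    inv_mul_cancel₀ hη.ne', mul_one, ← mul_sub, norm_mul, mul_pow, Real.norm_eq_abs, sq_abs,
    Real.norm_eq_abs]
  set a := ‖saIter (G.F i (x i + w.2.1)) (G.Y i) α₀ Γ (y₀ i) w.2.2.1 t - G.y i (x i + w.2.1)‖
  set b := ‖saIter (G.F i (x i - w.2.1)) (G.Y i) α₀ Γ (y₀ i) w.2.2.2 t - G.y i (x i - w.2.1)‖
  set p := G.h i (x i + w.2.1) (saIter (G.F i (x i + w.2.1)) (G.Y i) α₀ Γ (y₀ i) w.2.2.1 t) w.1
  set q := G.h i (x i - w.2.1) (saIter (G.F i (x i - w.2.1)) (G.Y i) α₀ Γ (y₀ i) w.2.2.2 t) w.1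
  set p' := G.h i (x i + w.2.1) (G.y i (x i + w.2.1)) w.1
  set q' := G.h i (x i - w.2.1) (G.y i (x i - w.2.1)) w.1
  have h1 : |p - q - (p' - q')| ≤ Ly i * (a + b) := by
    rw [show p - q - (p' - q') = (p - p') - (q - q') by ring, mul_add]
    exact (abs_sub _ _).trans (add_le_add b1 b2)
  calc ((n i : ℝ) / (2 * η)) ^ 2 * |p - q - (p' - q')| ^ 2
      ≤ ((n i : ℝ) / (2 * η)) ^ 2 * (Ly i ^ 2 * (2 * (a ^ 2 + b ^ 2))) := by
        refine mul_le_mul_of_nonneg_left ?_ (sq_nonneg _)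
        refine (pow_le_pow_left₀ (abs_nonneg _) h1 2).trans ?_
        rw [mul_pow]
        exact mul_le_mul_of_nonneg_left (by nlinarith [sq_nonneg (a - b)]) (sq_nonneg _)
    _ = _ := by field_simp

variable [IsProbabilityMeasure ν]

theorem Game.Standing.lintegral_saIter_le (hG : G.Standing ν η L)
    (hD : G.Assumptions ν η P LHI Pmax Pmin σm μ Ly) (hSA : G.SASetting ν η μ α₀ Γ y₀ c v)
    {i : Fin N} {z : Eu (n i)} (hz : z ∈ G.Xη η i) (t : ℕ) :
    ∫⁻ ζ, ENNReal.ofReal (‖saIter (G.F i z) (G.Y i) α₀ Γ (y₀ i) ζ t - G.y i z‖ ^ 2)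
      ∂(Measure.infinitePi fun _ : ℕ => ν) ≤
        ENNReal.ofReal (4 * G.inexactness μ α₀ Γ y₀ c v t) := by
  have hU := hG.Xη_sub_U i hz
  have hC : max ((c i ^ 2 + v i ^ 2) * α₀ ^ 2 / (2 * μ i * α₀ - 1))
      (Γ * sSup ((fun y => ‖y₀ i - y‖ ^ 2) '' G.Y i)) ≤ G.saConst μ α₀ Γ y₀ c v :=
    le_ciSup (f := fun i => max ((c i ^ 2 + v i ^ 2) * α₀ ^ 2 / (2 * μ i * α₀ - 1))
      (Γ * sSup ((fun y => ‖y₀ i - y‖ ^ 2) '' G.Y i))) (Set.finite_range _).bddAbove i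
  have hmono := hD.strongly_monotone i z hU
  have hint := hG.integrable_F i z hU
  have hys := hG.solves i z hU
  -- The mean bound makes `Y_i` bounded; without boundedness the real `sSup` would take its default
  -- value and would not dominate the initial error.
  have hc := hSA.mean_bound i z hz
  have hb : ∀ y ∈ G.Y i, ‖y - G.y i z‖ ≤ c i / μ i := fun y hy =>
    norm_sub_le_of_mean_bound (hD.μ_pos i) hmono hint hys hc hy
  have hbdd : BddAbove ((fun y => ‖y₀ i - y‖ ^ 2) '' G.Y i) := by
    refine ⟨(c i / μ i + c i / μ i) ^ 2, ?_⟩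
    rintro _ ⟨y, hy, rfl⟩
    refine pow_le_pow_left₀ (norm_nonneg _) ?_ 2
    calc ‖y₀ i - y‖ = ‖(y₀ i - G.y i z) - (y - G.y i z)‖ := by congr 1; abel
      _ ≤ _ := (norm_sub_le _ _).trans (add_le_add (hb _ (hSA.y₀_mem i)) (hb _ hy))
  rw [Game.inexactness, ← mul_div_assoc]
  refine integral_saIter_le ?_ (hG.closed_Y i) (hG.convex_Y i) (hD.μ_pos i) hmono hint hys hc
    (hSA.variance i z hz) (hSA.y₀_mem i) (hSA.α₀_gt i) hSA.Γ_pos ((le_max_left _ _).trans hC) ?_ t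
  · have : Measurable fun p : Eu (κ i) × Ξ => (z, p.1, p.2) := by fun_prop
    exact (hG.measurable_F i).comp this
  · refine le_trans ?_ ((le_max_right _ _).trans hC)
    exact mul_le_mul_of_nonneg_left (le_csSup hbdd ⟨_, hys.1, rfl⟩) hSA.Γ_pos.le

/-- The mean square error caused by inexact lower-level solutions. -/
theorem Game.Standing.lintegral_estimator_sub_le (hG : G.Standing ν η L)
    (hD : G.Assumptions ν η P LHI Pmax Pmin σm μ Ly) (hSA : G.SASetting ν η μ α₀ Γ y₀ c v)
    (hη : 0 < η) {i : Fin N} (hn : 0 < n i) {x : Profile n} (hx : x ∈ G.XX) (t : ℕ) :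
    ∫⁻ w, ENNReal.ofReal
      (‖G.estimator η α₀ Γ y₀ t i x w - G.exactEstimator η i x (w.1, w.2.1)‖ ^ 2)
        ∂drawLaw ν (n i) η ≤
      ENNReal.ofReal (4 * biasHI n Ly η (G.inexactness μ α₀ Γ y₀ c v t) ^ 2) := by
  have := isProbabilityMeasure_sphereUniform hn η
  set π := Measure.infinitePi fun _ : ℕ => ν
  set ε := G.inexactness μ α₀ Γ y₀ c v t
  have hε : 0 ≤ ε := Game.inexactness_nonneg (fun i => by
    have h1 := hSA.α₀_gt i
    have h2 := hD.μ_pos i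
    rw [div_lt_iff₀ (by positivity)] at h1
    linarith) hSA.Γ_pos t
  set K : ℝ := (n i : ℝ) ^ 2 * Ly i ^ 2 / (2 * η ^ 2)
  have hK : 0 ≤ K := by positivity
  -- Two lower-level calls contribute `4ε` each.
  have hconst : K * (8 * ε) ≤ 4 * biasHI n Ly η ε ^ 2 := by
    have h1 : (n i : ℝ) ≤ ((⨆ i, n i : ℕ) : ℝ) :=
      Nat.cast_le.2 (le_ciSup (Set.finite_range n).bddAbove i)
    have h2 : (Ly i : ℝ) ≤ ((⨆ i, Ly i : ℝ≥0) : ℝ) :=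
      NNReal.coe_le_coe.2 (le_ciSup (Set.finite_range Ly).bddAbove i)
    calc K * (8 * ε) = 4 * ((η⁻¹) ^ 2 * (n i) ^ 2 * (Ly i) ^ 2 * ε) := by
          simp only [K]
          field_simp
          ring
      _ ≤ 4 * ((η⁻¹) ^ 2 * ((⨆ i, n i : ℕ) : ℝ) ^ 2 * ((⨆ i, Ly i : ℝ≥0) : ℝ) ^ 2 * ε) := by
          gcongr
      _ = _ := by
          rw [biasHI, mul_pow, mul_pow, mul_pow, Real.sq_sqrt hε]
  have hsa : ∀ z, Measurable fun ζ : ℕ → Ξ => saIter (G.F i z) (G.Y i) α₀ Γ (y₀ i) ζ t := by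
    intro z
    refine measurable_saIter (hG.closed_Y i) (hG.convex_Y i) (hSA.y₀_mem i) ?_
      fun s _ => measurable_pi_apply s
    intro y ξ hy hξ
    exact (hG.measurable_F i).comp (measurable_const.prodMk (hy.prodMk hξ))
  have hsa' : ∀ z, Measurable fun ζ : ℕ → Ξ => ENNReal.ofReal
      (‖saIter (G.F i z) (G.Y i) α₀ Γ (y₀ i) ζ t - G.y i z‖ ^ 2) := fun z =>
    (((hsa z).sub_const _).norm.pow_const 2).ennreal_ofReal
  have hinner : ∀ ξ : Ξ, ∀ u : Eu (n i), ‖u‖ = η → ∫⁻ ζ, ENNReal.ofReal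
      (‖G.estimator η α₀ Γ y₀ t i x (ξ, u, ζ) - G.exactEstimator η i x (ξ, u)‖ ^ 2)
      ∂(π.prod π) ≤ ENNReal.ofReal (4 * biasHI n Ly η ε ^ 2) := by
    intro ξ u hu
    have e1 : x i + u ∈ G.Xη η i := ⟨x i, hx i, by simp [hu]⟩
    have e2 : x i - u ∈ G.Xη η i := ⟨x i, hx i, by simp [hu]⟩
    have mp1 : MeasurePreserving Prod.fst (π.prod π) π := measurePreserving_fst
    have mp2 : MeasurePreserving Prod.snd (π.prod π) π := measurePreserving_snd
    have hle : ∀ ζ : (ℕ → Ξ) × (ℕ → Ξ), ENNReal.ofReal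
        (‖G.estimator η α₀ Γ y₀ t i x (ξ, u, ζ) - G.exactEstimator η i x (ξ, u)‖ ^ 2) ≤
        ENNReal.ofReal K *
          (ENNReal.ofReal (‖saIter (G.F i (x i + u)) (G.Y i) α₀ Γ (y₀ i) ζ.1 t -
            G.y i (x i + u)‖ ^ 2) +
          ENNReal.ofReal (‖saIter (G.F i (x i - u)) (G.Y i) α₀ Γ (y₀ i) ζ.2 t -
            G.y i (x i - u)‖ ^ 2)) := fun ζ => by
      rw [← ENNReal.ofReal_add (sq_nonneg _) (sq_nonneg _), ← ENNReal.ofReal_mul hK]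
      exact ENNReal.ofReal_le_ofReal (hG.norm_estimator_sub_sq_le hD hη hSA.y₀_mem hx t
        (w := (ξ, u, ζ)) hu)
    have hm1 : Measurable fun ζ : (ℕ → Ξ) × (ℕ → Ξ) => ENNReal.ofReal
        (‖saIter (G.F i (x i + u)) (G.Y i) α₀ Γ (y₀ i) ζ.1 t - G.y i (x i + u)‖ ^ 2) :=
      (hsa' _).comp measurable_fst
    refine le_trans (lintegral_mono hle) ?_
    rw [lintegral_const_mul' _ _ ENNReal.ofReal_ne_top,
      lintegral_add_left hm1,
      mp1.lintegral_comp (hsa' (x i + u)), mp2.lintegral_comp (hsa' (x i - u))]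
    calc _ ≤ ENNReal.ofReal K * (ENNReal.ofReal (4 * ε) + ENNReal.ofReal (4 * ε)) := by
          gcongr
          · exact hG.lintegral_saIter_le hD hSA e1 t
          · exact hG.lintegral_saIter_le hD hSA e2 t
      _ = ENNReal.ofReal (K * (8 * ε)) := by
          rw [← ENNReal.ofReal_add (by positivity) (by positivity), ← ENNReal.ofReal_mul hK]
          ring_nf
      _ ≤ _ := ENNReal.ofReal_le_ofReal hconst
  rw [drawLaw]
  -- This direction of Tonelli's theorem requires no joint measurability.
  refine (lintegral_prod_le _).trans ?_
  refine (lintegral_mono (g := fun _ => ENNReal.ofReal (4 * biasHI n Ly η ε ^ 2)) fun ξ => ?_).trans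
    (by simp)
  refine (lintegral_prod_le _).trans ?_
  refine (lintegral_mono_ae (g := fun _ => ENNReal.ofReal (4 * biasHI n Ly η ε ^ 2)) ?_).trans
    (by simp)
  filter_upwards [ae_norm_eq_sphereUniform hη] with u hu
  exact hinner ξ u hu

theorem measurePreserving_drawLaw {d : ℕ} (hd : 0 < d) :
    MeasurePreserving (fun w : Draw Ξ d => (w.1, w.2.1)) (drawLaw ν d η)
      (ν.prod (sphereUniform d η)) := by
  have := isProbabilityMeasure_sphereUniform hd η
  exact (MeasurePreserving.id ν).prod measurePreserving_fst

/-- Numerically `9π²/2 < 45`, while `√(2π) ≥ 1`. The `εup` term of `sigmaHI` is only dropped here;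
its role is in `biasHI_sq_le`. -/
theorem variance_bound_le_sigmaHI_sq {εup : ℝ} (hεup : 0 < εup) (i : Fin N) :
    9 * Real.pi ^ 2 / 2 * n i * L i ^ 2 + 2 * σm ^ 2 ≤ sigmaHI n L Ly η σm εup ^ 2 := by
  have h1 : (n i : ℝ) ≤ ((⨆ i, n i : ℕ) : ℝ) :=
    Nat.cast_le.2 (le_ciSup (Set.finite_range n).bddAbove i)
  have h2 : (L i : ℝ) ≤ ((⨆ i, L i : ℝ≥0) : ℝ) :=
    NNReal.coe_le_coe.2 (le_ciSup (Set.finite_range L).bddAbove i)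
  have hpi : 9 * Real.pi ^ 2 / 2 ≤ 64 * √(2 * Real.pi) := by
    have e1 : Real.pi < 3.15 := Real.pi_lt_d2
    have e2 : 3 < Real.pi := Real.pi_gt_three
    have e3 : (1 : ℝ) ≤ √(2 * Real.pi) := Real.one_le_sqrt.2 (by linarith)
    nlinarith
  have h3 : 9 * Real.pi ^ 2 / 2 * n i * L i ^ 2 ≤
      64 * √(2 * Real.pi) * ((⨆ i, L i : ℝ≥0) : ℝ) ^ 2 * ((⨆ i, n i : ℕ) : ℝ) := by
    calc _ ≤ 64 * √(2 * Real.pi) * ((⨆ i, n i : ℕ) : ℝ) * ((⨆ i, L i : ℝ≥0) : ℝ) ^ 2 := by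
          gcongr
      _ = _ := by ring
  rw [sigmaHI, Real.sq_sqrt (by positivity)]
  have h4 : 0 ≤ 4 * ((⨆ i, n i : ℕ) : ℝ) ^ 2 * ((⨆ i, Ly i : ℝ≥0) : ℝ) ^ 2 * εup / η ^ 2 := by
    positivity
  linarith

/-- The mean square error of a batch of inexact estimators at a fixed point. -/
theorem Game.Standing.lintegral_batch_sub_le (hG : G.Standing ν η L)
    (hD : G.Assumptions ν η P LHI Pmax Pmin σm μ Ly) (hSA : G.SASetting ν η μ α₀ Γ y₀ c v)
    (hη : 0 < η) {i : Fin N} (hn : 0 < n i) {x : Profile n} (hx : x ∈ G.XX) (t : ℕ)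
    {εup : ℝ} (hεup : 0 < εup) {Ω : Type*} [MeasurableSpace Ω] {Q : Measure Ω}
    [IsProbabilityMeasure Q] {W : ℕ → Ω → Draw Ξ (n i)} (hW : ∀ l, Measurable (W l))
    (hlaw : ∀ l, Q.map (W l) = drawLaw ν (n i) η)
    (hind : Pairwise fun l l' => IndepFun (W l) (W l') Q) {S : ℕ} (hS : 0 < S) :
    ∫⁻ ω, ENNReal.ofReal (‖(S : ℝ)⁻¹ • ∑ l ∈ Finset.range S, G.estimator η α₀ Γ y₀ t i x (W l ω) -
      G.Fη ν η x i‖ ^ 2) ∂Q ≤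
      ENNReal.ofReal (2 * sigmaHI n L Ly η σm εup ^ 2 / S +
        8 * biasHI n Ly η (G.inexactness μ α₀ Γ y₀ c v t) ^ 2) := by
  have := isProbabilityMeasure_sphereUniform hn η
  set V := sigmaHI n L Ly η σm εup ^ 2
  set m2 := biasHI n Ly η (G.inexactness μ α₀ Γ y₀ c v t) ^ 2
  have hS' : (0 : ℝ) < S := Nat.cast_pos.2 hS
  have hm1 : Measurable fun w : Draw Ξ (n i) => G.estimator η α₀ Γ y₀ t i x w :=
    hG.measurable_estimator_apply hSA.y₀_mem α₀ Γ t i hx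
  have hm2 : Measurable fun w : Draw Ξ (n i) => G.exactEstimator η i x (w.1, w.2.1) :=
    hG.measurable_exactEstimator_apply i hx
  obtain ⟨k1, k2, k3⟩ := hG.memLp_exactEstimator_sub hD hη hn hx
  set a : Draw Ξ (n i) → Eu (n i) := fun w => G.exactEstimator η i x (w.1, w.2.1) - G.Fη ν η x i
  set b : Draw Ξ (n i) → Eu (n i) := fun w =>
    G.estimator η α₀ Γ y₀ t i x w - G.exactEstimator η i x (w.1, w.2.1)
  have ham : Measurable a := hm2.sub_const _
  have hbm : Measurable b := hm1.sub hm2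
  have mpW : ∀ l, MeasurePreserving (W l) Q (drawLaw ν (n i) η) := fun l => ⟨hW l, hlaw l⟩
  have mp : ∀ l, MeasurePreserving (fun ω => ((W l ω).1, (W l ω).2.1)) Q
      (ν.prod (sphereUniform (n i) η)) := fun l => (measurePreserving_drawLaw hn).comp (mpW l)
  have hA : ∀ l, MemLp (fun ω => a (W l ω)) 2 Q := fun l => k1.comp_measurePreserving (mp l)
  have hA0 : ∀ l, ∫ ω, a (W l ω) ∂Q = 0 := fun l => by
    rw [← k2, ← (mp l).map_eq, integral_map (mp l).measurable.aemeasurable]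
    rw [(mp l).map_eq]; exact k1.1
  have hA2 : ∀ l, ∫ ω, ‖a (W l ω)‖ ^ 2 ∂Q ≤ V := fun l => by
    refine le_trans (le_of_eq ?_) (k3.trans (variance_bound_le_sigmaHI_sq hεup i))
    rw [← (mp l).map_eq, integral_map (mp l).measurable.aemeasurable]
    rw [(mp l).map_eq]; exact k1.1.norm.pow 2
  have hB : ∀ l, ∫⁻ ω, ENNReal.ofReal (‖b (W l ω)‖ ^ 2) ∂Q ≤ ENNReal.ofReal (4 * m2) := fun l => by
    rw [(mpW l).lintegral_comp ((hbm.norm.pow_const 2).ennreal_ofReal)]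
    exact hG.lintegral_estimator_sub_le hD hSA hη hn hx t
  have hsumA : ∫⁻ ω, ENNReal.ofReal (‖∑ l ∈ Finset.range S, a (W l ω)‖ ^ 2) ∂Q ≤
      ENNReal.ofReal (S * V) := by
    rw [← ofReal_integral_eq_lintegral_ofReal _ (.of_forall fun ω => sq_nonneg _)]
    · refine ENNReal.ofReal_le_ofReal ?_
      rw [integral_norm_sum_sq (fun l _ => hA l) (fun l _ => hA0 l)
        fun l _ l' _ h => (hind h).comp ham ham]
      exact (Finset.sum_le_sum fun l _ => hA2 l).trans (by simp)
    · exact (memLp_finsetSum _ fun l _ => hA l).integrable_norm_pow two_ne_zero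
  -- The centered sum is kept intact, so that independence can gain a factor `1/S`. The bias terms
  -- need not be centered and are separated by Cauchy–Schwarz, without gain.
  have hpt : ∀ ω, ‖(S : ℝ)⁻¹ • ∑ l ∈ Finset.range S, G.estimator η α₀ Γ y₀ t i x (W l ω) -
      G.Fη ν η x i‖ ^ 2 ≤ 2 / S ^ 2 * ‖∑ l ∈ Finset.range S, a (W l ω)‖ ^ 2 +
        2 / S * ∑ l ∈ Finset.range S, ‖b (W l ω)‖ ^ 2 := by
    intro ω
    have e1 : (S : ℝ)⁻¹ • ∑ l ∈ Finset.range S, G.estimator η α₀ Γ y₀ t i x (W l ω) -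
        G.Fη ν η x i = (S : ℝ)⁻¹ • ((∑ l ∈ Finset.range S, a (W l ω)) +
          ∑ l ∈ Finset.range S, b (W l ω)) := by
      rw [← Finset.sum_add_distrib, show G.Fη ν η x i = (S : ℝ)⁻¹ •
        ∑ l ∈ Finset.range S, G.Fη ν η x i by
          rw [Finset.sum_const, Finset.card_range, ← Nat.cast_smul_eq_nsmul ℝ, smul_smul,
            inv_mul_cancel₀ hS'.ne', one_smul], ← smul_sub, ← Finset.sum_sub_distrib]
      congr 1
      refine Finset.sum_congr rfl fun l _ => ?_
      simp only [a, b]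
      abel
    rw [e1, norm_smul, norm_inv, Real.norm_natCast, mul_pow]
    set p := ∑ l ∈ Finset.range S, a (W l ω)
    have h1 : ‖∑ l ∈ Finset.range S, b (W l ω)‖ ^ 2 ≤
        S * ∑ l ∈ Finset.range S, ‖b (W l ω)‖ ^ 2 := by
      refine (pow_le_pow_left₀ (norm_nonneg _) (norm_sum_le _ _) 2).trans ?_
      simpa using sq_sum_le_card_mul_sum_sq (s := Finset.range S) (f := fun l => ‖b (W l ω)‖)
    set q := ∑ l ∈ Finset.range S, b (W l ω)
    have h2 : ‖p + q‖ ^ 2 ≤ 2 * ‖p‖ ^ 2 + 2 * ‖q‖ ^ 2 := by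
      refine (pow_le_pow_left₀ (norm_nonneg _) (norm_add_le p q) 2).trans ?_
      nlinarith [sq_nonneg (‖p‖ - ‖q‖)]
    calc _ ≤ ((S : ℝ)⁻¹) ^ 2 * (2 * ‖p‖ ^ 2 +
          2 * (S * ∑ l ∈ Finset.range S, ‖b (W l ω)‖ ^ 2)) := by
          refine mul_le_mul_of_nonneg_left ?_ (sq_nonneg _)
          linarith
      _ = _ := by field_simp
  have hmA : Measurable fun ω => ENNReal.ofReal (2 / S ^ 2) *
      ENNReal.ofReal (‖∑ l ∈ Finset.range S, a (W l ω)‖ ^ 2) :=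
    (((Finset.measurable_sum _ fun l _ => ham.comp (hW l)).norm.pow_const 2).ennreal_ofReal).const_mul
      _
  have hmB : ∀ l, Measurable fun ω => ENNReal.ofReal (‖b (W l ω)‖ ^ 2) := fun l =>
    ((hbm.comp (hW l)).norm.pow_const 2).ennreal_ofReal
  have hle : ∀ ω, ENNReal.ofReal (‖(S : ℝ)⁻¹ • ∑ l ∈ Finset.range S,
      G.estimator η α₀ Γ y₀ t i x (W l ω) - G.Fη ν η x i‖ ^ 2) ≤ ENNReal.ofReal (2 / S ^ 2) *
        ENNReal.ofReal (‖∑ l ∈ Finset.range S, a (W l ω)‖ ^ 2) +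
        ENNReal.ofReal (2 / S) * ∑ l ∈ Finset.range S, ENNReal.ofReal (‖b (W l ω)‖ ^ 2) := by
    intro ω
    rw [← ENNReal.ofReal_sum_of_nonneg fun l _ => sq_nonneg _,
      ← ENNReal.ofReal_mul (by positivity), ← ENNReal.ofReal_mul (by positivity),
      ← ENNReal.ofReal_add (by positivity) (by positivity)]
    exact ENNReal.ofReal_le_ofReal (hpt ω)
  refine le_trans (lintegral_mono hle) ?_
  rw [lintegral_add_left hmA, lintegral_const_mul' _ _ ENNReal.ofReal_ne_top,
    lintegral_const_mul' _ _ ENNReal.ofReal_ne_top, lintegral_finsetSum _ fun l _ => hmB l]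
  calc _ ≤ ENNReal.ofReal (2 / S ^ 2) * ENNReal.ofReal (S * V) +
        ENNReal.ofReal (2 / S) * ∑ l ∈ Finset.range S, ENNReal.ofReal (4 * m2) := by
        gcongr with l _
        exact hB l
    _ = _ := by
        rw [← ENNReal.ofReal_sum_of_nonneg fun l _ => by positivity,
          ← ENNReal.ofReal_mul (by positivity), ← ENNReal.ofReal_mul (by positivity),
          ← ENNReal.ofReal_add (by positivity) (by positivity), Finset.sum_const,
          Finset.card_range, nsmul_eq_mul]
        congr 1
        field_simp
        ring

end Bias

/-! ### Game map, potential and residual. -/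

section Descent

variable {N : ℕ} {n κ : Fin N → ℕ} {Ξ : Type*} [MeasurableSpace Ξ] {G : Game n κ Ξ}
  {ν : Measure Ξ} {η : ℝ} {L Ly : Fin N → ℝ≥0} {P : Profile n → ℝ}
  {LHI Pmax Pmin σm α₀ Γ : ℝ} {μ c v : Fin N → ℝ} {y₀ : ∀ i, Eu (κ i)}

theorem inner_upd_sub (g x : Profile n) (i : Fin N) (z : Eu (n i)) :
    (inner ℝ g (upd x i z - x) : ℝ) = inner ℝ (g i) (z - x i) := by
  rw [PiLp.inner_apply, Finset.sum_eq_single_of_mem i (Finset.mem_univ i)]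
  · rw [PiLp.sub_apply, upd_apply_self]
  · intro j _ hj
    rw [PiLp.sub_apply, upd_apply_of_ne x hj, sub_self, inner_zero_right]

theorem upd_add_smul (x : Profile n) (i : Fin N) (z : Eu (n i)) (s : ℝ) :
    x + s • (upd x i z - x) = upd x i (x i + s • (z - x i)) := by
  ext1 j
  by_cases h : j = i
  · subst h
    simp [upd_apply_self]
  · simp [upd_apply_of_ne x h]

theorem Game.Standing.iterate_mem (hG : G.Standing ν η L) (α₀ Γ : ℝ) (y₀ : ∀ i, Eu (κ i))
    (t : ℕ → ℕ) (γ : ℕ → ℝ) (S : ℕ) {x₀ : Profile n} (hx₀ : x₀ ∈ G.XX)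
    (w : ∀ j : ℕ × Fin N × ℕ, Draw Ξ (n j.2.1)) (k : ℕ) :
    G.iterate η α₀ Γ y₀ t γ S x₀ w k ∈ G.XX := by
  cases k with
  | zero => exact hx₀
  | succ k => exact fun i => proj_mem ⟨x₀ i, hx₀ i⟩ (hG.closed_X i) _

variable [IsProbabilityMeasure ν]

/-- On `X` the game map and the gradient of the potential have the same inner products with
feasible directions. -/
theorem Game.Standing.inner_Fη_eq (hG : G.Standing ν η L)
    (hD : G.Assumptions ν η P LHI Pmax Pmin σm μ Ly) (hη : 0 < η) (hn : ∀ i, 0 < n i)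
    {g : Profile n → Profile n} (hg : ∀ x ∈ G.XX, HasGradientWithinAt P (g x) G.XX x)
    {x z : Profile n} (hx : x ∈ G.XX) (hz : z ∈ G.XX) :
    (inner ℝ (G.Fη ν η x) (z - x) : ℝ) = inner ℝ (g x) (z - x) := by
  rw [PiLp.inner_apply, PiLp.inner_apply]
  refine Finset.sum_congr rfl fun i _ => ?_
  rw [PiLp.sub_apply, ← inner_upd_sub (g x)]
  have h0 : (0 : ℝ) ∈ Set.Icc (0 : ℝ) 1 := by simp
  have h1 := hasDerivWithinAt_segment hG.convex_XX hg hx (Game.upd_mem_XX hx (hz i)) h0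
  rw [zero_smul, add_zero] at h1
  have h2 : HasDerivAt (fun s : ℝ => G.smoothedCost ν η i (upd x i (x i + s • (z i - x i))))
      (inner ℝ (G.Fη ν η x i) (z i - x i)) 0 := by
    have e1 : HasDerivAt (fun s : ℝ => x i + s • (z i - x i)) (z i - x i) 0 := by
      simpa using ((hasDerivAt_id (0 : ℝ)).smul_const (z i - x i)).const_add (x i)
    have e2 := (hG.hasGradientAt_smoothedCost hD hη (hn i) hx).hasFDerivAt
    rw [← hG.Fη_apply hD hη (hn i) hx] at e2
    have e3 : x i + (0 : ℝ) • (z i - x i) = x i := by simp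
    rw [← e3] at e2
    exact e2.comp_hasDerivAt 0 e1
  -- Along block `i` the potential and the cost differ by a constant. As `x` may lie on the boundary
  -- of `X`, only the segment is available, and derivatives are identified within `[0, 1]`.
  have h3 : HasDerivWithinAt (fun s : ℝ => P (x + s • (upd x i (z i) - x)))
      (inner ℝ (G.Fη ν η x i) (z i - x i)) (Set.Icc 0 1) 0 := by
    have e1 : ∀ s ∈ Set.Icc (0 : ℝ) 1, P (x + s • (upd x i (z i) - x)) =
        G.smoothedCost ν η i (upd x i (x i + s • (z i - x i))) +
          (P x - G.smoothedCost ν η i x) := by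
      intro s hs
      have h := hD.potential x hx i (x i + s • (z i - x i))
        ((hG.convex_X i).add_smul_sub_mem (hx i) (hz i) hs) (x i) (hx i)
      rw [upd_self] at h
      rw [upd_add_smul]
      linarith
    exact (h2.hasDerivWithinAt.add_const _).congr e1 (e1 0 h0)
  exact (uniqueDiffOn_Icc zero_lt_one 0 h0).eq_deriv _ h3 h1

/-- The condition that determines a projection sees the gradient only through differences of points
of `X`, where the two maps agree. As `g` is Lipschitz, this makes the residual continuous on `X`. -/
theorem Game.Standing.residual_eq (hG : G.Standing ν η L)
    (hD : G.Assumptions ν η P LHI Pmax Pmin σm μ Ly) (hη : 0 < η) (hn : ∀ i, 0 < n i)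
    {g : Profile n → Profile n} (hg : ∀ x ∈ G.XX, HasGradientWithinAt P (g x) G.XX x)
    (γ : ℝ) {x : Profile n} (hx : x ∈ G.XX) :
    G.residual ν η γ x = γ⁻¹ • (x - proj G.XX (x - γ • g x)) := by
  have hp : proj G.XX (x - γ • g x) ∈ G.XX := proj_mem ⟨x, hx⟩ hG.isClosed_XX _
  rw [Game.residual]
  congr 2
  refine proj_eq_of_variational hG.isClosed_XX hG.convex_XX hp fun z hz => ?_
  have h1 := inner_sub_proj_nonpos ⟨x, hx⟩ hG.isClosed_XX hG.convex_XX (x - γ • g x) z hz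
  set p := proj G.XX (x - γ • g x)
  have h2 := hG.inner_Fη_eq hD hη hn hg hx hz
  have h3 := hG.inner_Fη_eq hD hη hn hg hx hp
  have e1 : z - p = (z - x) - (p - x) := by abel
  have e2 : ∀ F : Profile n, x - γ • F - p = (x - p) - γ • F := fun F => by abel
  rw [e2, inner_sub_left, real_inner_smul_left] at h1 ⊢
  have e3 : (inner ℝ (G.Fη ν η x) (z - p) : ℝ) = inner ℝ (g x) (z - p) := by
    rw [e1, inner_sub_right _ (z - x), inner_sub_right _ (z - x), h2, h3]
  rw [e3]
  exact h1

theorem Game.Standing.continuous_residual (hG : G.Standing ν η L)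
    (hD : G.Assumptions ν η P LHI Pmax Pmin σm μ Ly) (hη : 0 < η) (hn : ∀ i, 0 < n i) (γ : ℝ) :
    Continuous fun x : G.XX => G.residual ν η γ x := by
  rcases G.XX.eq_empty_or_nonempty with h | hne
  · have : IsEmpty G.XX := Set.isEmpty_coe_sort.2 h
    exact continuous_of_const fun x => isEmptyElim x
  obtain ⟨g, hg, hgL⟩ := hD.smooth
  have hgc : Continuous fun x : G.XX => g x := by
    have h : LipschitzOnWith LHI.toNNReal g G.XX := LipschitzOnWith.of_dist_le_mul
      fun x hx y hy => by
        rw [dist_eq_norm, dist_eq_norm, Real.coe_toNNReal _ hD.LHI_pos.le]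
        exact hgL x hx y hy
    exact h.continuousOn.domRestrict
  have h : (fun x : G.XX => G.residual ν η γ x) = fun x : G.XX =>
      γ⁻¹ • ((x : Profile n) - proj G.XX ((x : Profile n) - γ • g x)) :=
    funext fun x => hG.residual_eq hD hη hn hg γ x.2
  rw [h]
  have hc := continuous_proj hne hG.isClosed_XX hG.convex_XX
  have h1 : Continuous fun x : G.XX => (x : Profile n) - γ • g x :=
    continuous_subtype_val.sub (hgc.const_smul γ)
  exact (continuous_subtype_val.sub (hc.comp h1)).const_smul γ⁻¹

/-- One step of projected descent from `x` along the inexact game map `F + e`. -/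
theorem Game.Standing.norm_residual_sq_le (hG : G.Standing ν η L)
    (hD : G.Assumptions ν η P LHI Pmax Pmin σm μ Ly) (hη : 0 < η) (hn : ∀ i, 0 < n i)
    {x d : Profile n} (hx : x ∈ G.XX) :
    ‖G.residual ν η (1 / (2 * LHI)) x‖ ^ 2 ≤
      4 * LHI * (P x - P (WithLp.toLp 2 fun i => proj (G.X i) (x i - (1 / (2 * LHI)) • d i))) +
        ‖d - G.Fη ν η x‖ ^ 2 := by
  obtain ⟨g, hg, hgL⟩ := hD.smooth
  refine residual_sq_le (F := G.Fη ν η x) hG.convex_XX hD.LHI_pos hg hgL hx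
    (proj_mem ⟨x, hx⟩ hG.isClosed_XX _)
    (fun i => proj_mem ⟨x i, hx i⟩ (hG.closed_X i) _) (fun z hz => hG.inner_Fη_eq hD hη hn hg hx hz)
    (inner_sub_proj_nonpos ⟨x, hx⟩ hG.isClosed_XX hG.convex_XX _) fun z hz => ?_
  rw [add_sub_cancel, PiLp.inner_apply]
  refine Finset.sum_nonpos fun i _ => ?_
  exact inner_sub_proj_nonpos ⟨x i, hx i⟩ (hG.closed_X i) (hG.convex_X i) _ (z i) (hz i)

/-- The descent step with zero error. The uniform bound yields all integrability needed for the
residual. -/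
theorem Game.Standing.norm_residual_sq_le_of_potential (hG : G.Standing ν η L)
    (hD : G.Assumptions ν η P LHI Pmax Pmin σm μ Ly) (hη : 0 < η) (hn : ∀ i, 0 < n i)
    {x : Profile n} (hx : x ∈ G.XX) :
    ‖G.residual ν η (1 / (2 * LHI)) x‖ ^ 2 ≤ 4 * LHI * (Pmax - Pmin) := by
  have h := hG.norm_residual_sq_le hD hη hn (d := G.Fη ν η x) hx
  rw [sub_self, norm_zero, zero_pow two_ne_zero, add_zero] at h
  refine h.trans (mul_le_mul_of_nonneg_left ?_ (by linarith [hD.LHI_pos]))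
  refine sub_le_sub (hD.isGreatest.2 ⟨x, hx, rfl⟩) (hD.isLeast.2 ⟨_, fun i => ?_, rfl⟩)
  exact proj_mem ⟨x i, hx i⟩ (hG.closed_X i) _

/-- The game map is the mean of the exact estimator, hence a parametric integral of a jointly
measurable function. -/
theorem Game.Standing.measurable_Fη (hG : G.Standing ν η L)
    (hD : G.Assumptions ν η P LHI Pmax Pmin σm μ Ly) (hη : 0 < η) {i : Fin N} (hn : 0 < n i) :
    Measurable fun x : G.XX => G.Fη ν η x i := by
  have := isProbabilityMeasure_sphereUniform hn η
  have h1 := (hG.measurable_exactEstimator i).stronglyMeasurable.integral_prod_right'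
    (ν := ν.prod (sphereUniform (n i) η))
  have h2 : (fun x : G.XX => G.Fη ν η x i) = fun x : G.XX =>
      ∫ w, G.exactEstimator η i x w ∂ν.prod (sphereUniform (n i) η) := by
    ext1 x
    obtain ⟨k1, k2, -⟩ := hG.memLp_exactEstimator_sub hD hη hn x.2
    have h3 := integral_add (k1.integrable one_le_two)
      (integrable_const (μ := ν.prod (sphereUniform (n i) η)) (G.Fη ν η x i))
    simp only [sub_add_cancel] at h3
    rw [h3, k2]
    simp
  rw [h2]
  exact h1.measurable

end Descent

/-- Evaluation of a random process at an independent index with the uniform distribution. -/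
theorem integral_uniform_index {Ω W : Type*} [MeasurableSpace Ω] [MeasurableSpace W]
    {Q : Measure Ω} [IsProbabilityMeasure Q] {R : Ω → ℕ} {Z : Ω → W} (hR : Measurable R)
    (hZ : Measurable Z) (hind : IndepFun R Z Q) {T : ℕ} (hT : 1 ≤ T)
    (hunif : ∀ k ∈ Finset.Icc 1 T, Q.real (R ⁻¹' {k}) = 1 / (T : ℝ)) {φ : ℕ → W → ℝ}
    (hφ : ∀ k ∈ Finset.Icc 1 T, Measurable (φ k)) {B : ℝ}
    (hB : ∀ k ∈ Finset.Icc 1 T, ∀ w, |φ k w| ≤ B) :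
    Integrable (fun ω => φ (R ω) (Z ω)) Q ∧
      ∫ ω, φ (R ω) (Z ω) ∂Q = (1 / (T : ℝ)) * ∑ k ∈ Finset.Icc 1 T, ∫ ω, φ k (Z ω) ∂Q := by
  have hT' : (0 : ℝ) < T := Nat.cast_pos.2 hT
  -- The prescribed probabilities add up to 1, so other values of `R` have probability zero.
  have hmem : ∀ᵐ ω ∂Q, R ω ∈ Finset.Icc 1 T := by
    have hm : MeasurableSet (R ⁻¹' (Finset.Icc 1 T : Finset ℕ)) :=
      hR (Finset.measurableSet _)
    have h1 : Q.real (R ⁻¹' (Finset.Icc 1 T : Finset ℕ)) = 1 := by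
      have h2 : R ⁻¹' (Finset.Icc 1 T : Finset ℕ) = ⋃ k ∈ Finset.Icc 1 T, R ⁻¹' {k} := by
        ext ω
        simp
      rw [h2, measureReal_biUnion_finset (fun k _ k' _ hne => ?_)
        fun k _ => hR (measurableSet_singleton k), Finset.sum_congr rfl hunif]
      · simp [hT'.ne']
      · exact Disjoint.preimage _ (by simpa using hne)
    have h3 : Q (R ⁻¹' (Finset.Icc 1 T : Finset ℕ)) = 1 := by
      rw [← ENNReal.ofReal_toReal (measure_ne_top Q _), ← measureReal_def, h1, ENNReal.ofReal_one]
    exact (prob_compl_eq_zero_iff hm).2 h3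
  set ψ : ℕ → ℕ → ℝ := fun k r => if r = k then 1 else 0
  have hψ : ∀ k, Measurable (ψ k) := fun k => measurable_of_countable _
  have hi1 : ∀ k, Integrable (fun ω => ψ k (R ω)) Q := fun k =>
    Integrable.of_bound ((hψ k).comp hR).aestronglyMeasurable 1 (.of_forall fun ω => by
      simp only [ψ]
      split_ifs <;> simp)
  have hψi : ∀ k ∈ Finset.Icc 1 T, ∫ ω, ψ k (R ω) ∂Q = 1 / (T : ℝ) := fun k hk => by
    rw [← hunif k hk, ← integral_indicator_one (hR (measurableSet_singleton k))]
    refine integral_congr_ae (.of_forall fun ω => ?_)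
    by_cases h : R ω = k
    · rw [Set.indicator_of_mem (show ω ∈ R ⁻¹' {k} from h)]
      simp [ψ, h]
    · rw [Set.indicator_of_notMem (show ω ∉ R ⁻¹' {k} from h)]
      simp [ψ, h]
  have hi2 : ∀ k ∈ Finset.Icc 1 T, Integrable (fun ω => ψ k (R ω) * φ k (Z ω)) Q := fun k hk => by
    refine Integrable.of_bound (((hψ k).comp hR).mul ((hφ k hk).comp hZ)).aestronglyMeasurable B
      (.of_forall fun ω => ?_)
    have h1 := hB k hk (Z ω)
    simp only [ψ]
    split_ifs
    · simpa using h1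
    · simpa using (abs_nonneg _).trans h1
  have hae : (fun ω => φ (R ω) (Z ω)) =ᵐ[Q]
      fun ω => ∑ k ∈ Finset.Icc 1 T, ψ k (R ω) * φ k (Z ω) := by
    filter_upwards [hmem] with ω hω
    rw [Finset.sum_eq_single_of_mem _ hω]
    · simp [ψ]
    · intro k _ hk
      simp [ψ, hk.symm]
  refine ⟨(integrable_finsetSum _ hi2).congr hae.symm, ?_⟩
  rw [integral_congr_ae hae, integral_finsetSum _ hi2, Finset.mul_sum]
  refine Finset.sum_congr rfl fun k hk => ?_
  have h := (hind.comp (hψ k) (hφ k hk)).integral_fun_mul_eq_mul_integral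
    ((hψ k).comp hR).aestronglyMeasurable ((hφ k hk).comp hZ).aestronglyMeasurable
  rw [← hψi k hk]
  exact h

/-! ### The estimates along the random iteration. -/

section Scheme

variable {N : ℕ} {n κ : Fin N → ℕ} {Ξ : Type*} [MeasurableSpace Ξ] {G : Game n κ Ξ}
  {ν : Measure Ξ} {η : ℝ} {L Ly : Fin N → ℝ≥0} {P : Profile n → ℝ}
  {LHI Pmax Pmin σm : ℝ} {μ c v : Fin N → ℝ} {x₀ : Profile n}

/-- The averaged gradient estimates of all players at iteration `k`. -/
noncomputable def Game.batch (G : Game n κ Ξ) (η α₀ Γ : ℝ) (y₀ : ∀ i, Eu (κ i)) (t : ℕ → ℕ)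
    (S : ℕ) (x : Profile n) (w : ∀ j : ℕ × Fin N × ℕ, Draw Ξ (n j.2.1)) (k : ℕ) : Profile n :=
  WithLp.toLp 2 fun i => (S : ℝ)⁻¹ • ∑ l ∈ Finset.range S,
    G.estimator η α₀ Γ y₀ (t k) i x (w (k, i, l))

theorem Game.Standing.measurable_batch (hG : G.Standing ν η L) {y₀ : ∀ i, Eu (κ i)}
    (hy₀ : ∀ i, y₀ i ∈ G.Y i) (α₀ Γ : ℝ) (t : ℕ) (S : ℕ) (i : Fin N) :
    Measurable fun p : G.XX × (ℕ → Draw Ξ (n i)) => (S : ℝ)⁻¹ • ∑ l ∈ Finset.range S,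
      G.estimator η α₀ Γ y₀ t i p.1 (p.2 l) := by
  refine Measurable.const_smul ?_ (S : ℝ)⁻¹
  refine Finset.measurable_fun_sum _ fun l _ => ?_
  have h1 : Measurable fun p : G.XX × (ℕ → Draw Ξ (n i)) => (p.1, p.2 l) :=
    measurable_fst.prodMk ((measurable_pi_apply l).comp measurable_snd)
  have h := (hG.measurable_estimator hy₀ α₀ Γ t i).comp h1
  exact h

theorem Game.Standing.measurable_iterate (hG : G.Standing ν η L) {y₀ : ∀ i, Eu (κ i)}
    (hy₀ : ∀ i, y₀ i ∈ G.Y i) (α₀ Γ : ℝ) (t : ℕ → ℕ) (γ : ℕ → ℝ) (S : ℕ) (hx₀ : x₀ ∈ G.XX)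
    {Ω : Type*} {mΩ : MeasurableSpace Ω} {Z : ∀ j : ℕ × Fin N × ℕ, Ω → Draw Ξ (n j.2.1)} {k : ℕ}
    (hZ : ∀ j, j.1 < k → Measurable (Z j)) :
    Measurable fun ω => (⟨G.iterate η α₀ Γ y₀ t γ S x₀ (fun j => Z j ω) k,
      hG.iterate_mem α₀ Γ y₀ t γ S hx₀ _ k⟩ : G.XX) := by
  induction k with
  | zero => exact measurable_const (a := (⟨x₀, hx₀⟩ : G.XX))
  | succ k ih =>
    have hx := ih fun j hj => hZ j (hj.trans (Nat.lt_succ_self k))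
    refine Measurable.subtype_mk ?_
    refine (WithLp.measurable_toLp 2 _).comp ?_
    refine measurable_pi_lambda _ fun i => ?_
    have h1 : Measurable fun ω (l : ℕ) => Z (k, i, l) ω :=
      measurable_pi_lambda _ fun l => hZ (k, i, l) (Nat.lt_succ_self k)
    have h2 := (hG.measurable_batch hy₀ α₀ Γ (t k) S i).comp (hx.prodMk h1)
    have h3 := (measurable_block i).comp (measurable_subtype_coe.comp hx)
    exact (continuous_proj ⟨x₀ i, hx₀ i⟩ (hG.closed_X i) (hG.convex_X i)).measurable.comp
      (h3.sub (h2.const_smul (γ k)))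

variable [IsProbabilityMeasure ν] {α₀ Γ : ℝ} {y₀ : ∀ i, Eu (κ i)} {Ω : Type*} [MeasurableSpace Ω]
  {Q : Measure Ω} [IsProbabilityMeasure Q] {Z : ∀ j : ℕ × Fin N × ℕ, Ω → Draw Ξ (n j.2.1)}

/-- The mean square error of the gradient estimates along the iteration. -/
theorem Game.Standing.integral_norm_batch_sub_sq_le (hG : G.Standing ν η L)
    (hD : G.Assumptions ν η P LHI Pmax Pmin σm μ Ly) (hSA : G.SASetting ν η μ α₀ Γ y₀ c v)
    (hη : 0 < η) (hn : ∀ i, 0 < n i) (hx₀ : x₀ ∈ G.XX) (t : ℕ → ℕ) (γ : ℕ → ℝ) {S : ℕ}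
    (hS : 0 < S) {εup : ℝ} (hεup : 0 < εup) (hZ : ∀ j, Measurable (Z j))
    (hlaw : ∀ j, Q.map (Z j) = drawLaw ν (n j.2.1) η) (hind : iIndepFun Z Q) (k : ℕ) :
    let e : Ω → Profile n := fun ω =>
      G.batch η α₀ Γ y₀ t S (G.iterate η α₀ Γ y₀ t γ S x₀ (fun j => Z j ω) k) (fun j => Z j ω) k -
        G.Fη ν η (G.iterate η α₀ Γ y₀ t γ S x₀ (fun j => Z j ω) k)
    Integrable (fun ω => ‖e ω‖ ^ 2) Q ∧
      ∫ ω, ‖e ω‖ ^ 2 ∂Q ≤ N * (2 * sigmaHI n L Ly η σm εup ^ 2 / S +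
        8 * biasHI n Ly η (G.inexactness μ α₀ Γ y₀ c v (t k)) ^ 2) := by
  intro e
  set V := 2 * sigmaHI n L Ly η σm εup ^ 2 / S +
        8 * biasHI n Ly η (G.inexactness μ α₀ Γ y₀ c v (t k)) ^ 2
  have hV : 0 ≤ V := by positivity
  set X : Ω → G.XX := fun ω => ⟨G.iterate η α₀ Γ y₀ t γ S x₀ (fun j => Z j ω) k,
      hG.iterate_mem α₀ Γ y₀ t γ S hx₀ _ k⟩ with hXdef
  have hX : Measurable X := hG.measurable_iterate hSA.y₀_mem α₀ Γ t γ S hx₀ fun j _ => hZ j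
  set W : ∀ i, Ω → ℕ → Draw Ξ (n i) := fun i ω l => Z (k, i, l) ω
  have hW : ∀ i, Measurable (W i) := fun i => measurable_pi_lambda _ fun l => hZ (k, i, l)
  set Φ : ∀ i, G.XX × (ℕ → Draw Ξ (n i)) → ℝ := fun i p =>
    ‖(S : ℝ)⁻¹ • ∑ l ∈ Finset.range S, G.estimator η α₀ Γ y₀ (t k) i p.1 (p.2 l) -
      G.Fη ν η p.1 i‖ ^ 2 with hΦdef
  have hΦ : ∀ i, Measurable (Φ i) := fun i => by
    have h1 := hG.measurable_batch hSA.y₀_mem α₀ Γ (t k) S i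
    have h2 : Measurable fun p : G.XX × (ℕ → Draw Ξ (n i)) => G.Fη ν η p.1 i :=
      (hG.measurable_Fη hD hη (hn i)).comp measurable_fst
    exact (h1.sub h2).norm.pow_const 2
  -- The iterate `x^k` is a function of the draws with first index below `k`, the batch of those
  -- with first index `k`.
  have hXW : ∀ i, IndepFun X (W i) Q := fun i => by
    refine indepFun_of_iIndepFun_of_disjoint hZ hind (S := {j | j.1 < k}) (T := {j | j.1 = k})
      ?_ ?_ ?_
    · rw [Set.disjoint_left]
      exact fun j (h1 : j.1 < k) (h2 : j.1 = k) => h1.ne h2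
    · refine hG.measurable_iterate (mΩ := _) hSA.y₀_mem α₀ Γ t γ S hx₀ fun j hj => ?_
      exact Measurable.mono (comap_measurable _)
        (le_iSup₂_of_le (f := fun j (_ : j ∈ {j : ℕ × Fin N × ℕ | j.1 < k}) =>
          MeasurableSpace.comap (Z j) inferInstance) j hj le_rfl) le_rfl
    · refine @measurable_pi_lambda _ _ _ (_) _ _ fun l => ?_
      exact Measurable.mono (comap_measurable _)
        (le_iSup₂_of_le (f := fun j (_ : j ∈ {j : ℕ × Fin N × ℕ | j.1 = k}) =>
          MeasurableSpace.comap (Z j) inferInstance) (k, i, l) rfl le_rfl) le_rfl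
  have hlint : ∀ i, ∫⁻ ω, ENNReal.ofReal (Φ i (X ω, W i ω)) ∂Q ≤ ENNReal.ofReal V := fun i => by
    have h := lintegral_indep_le (φ := fun p => ENNReal.ofReal (Φ i p))
      (ψ := fun _ => ENNReal.ofReal V) hX (hW i) (hXW i) (hΦ i).ennreal_ofReal fun ω => by
        refine hG.lintegral_batch_sub_le hD hSA hη (hn i) (X ω).2 (t k) hεup
          (W := fun l ω => Z (k, i, l) ω) (fun l => hZ _) (fun l => hlaw _) (fun l l' hne => ?_) hS
        exact hind.indepFun (by simpa using hne)
    simpa using h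
  have hΦn : ∀ i ω, 0 ≤ Φ i (X ω, W i ω) := fun i ω => sq_nonneg _
  have hm : ∀ i, AEStronglyMeasurable (fun ω => Φ i (X ω, W i ω)) Q := fun i =>
    ((hΦ i).comp (hX.prodMk (hW i))).aestronglyMeasurable
  have hint : ∀ i, Integrable (fun ω => Φ i (X ω, W i ω)) Q := fun i => by
    refine (lintegral_ofReal_ne_top_iff_integrable (hm i) (.of_forall (hΦn i))).1 ?_
    exact ((hlint i).trans_lt ENNReal.ofReal_lt_top).ne
  have hle : ∀ i, ∫ ω, Φ i (X ω, W i ω) ∂Q ≤ V := fun i => by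
    rw [integral_eq_lintegral_of_nonneg_ae (.of_forall (hΦn i)) (hm i)]
    exact ENNReal.toReal_le_of_le_ofReal hV (hlint i)
  have he : (fun ω => ‖e ω‖ ^ 2) = fun ω => ∑ i, Φ i (X ω, W i ω) := by
    ext1 ω
    rw [PiLp.norm_sq_eq_of_L2]
    rfl
  rw [he]
  refine ⟨integrable_finsetSum _ fun i _ => hint i, ?_⟩
  rw [integral_finsetSum _ fun i _ => hint i]
  refine (Finset.sum_le_sum fun i _ => hle i).trans ?_
  simp

/-- The expected squared residual at an independent uniformly distributed iterate. -/
theorem Game.Standing.integral_residual_le (hG : G.Standing ν η L)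
    (hD : G.Assumptions ν η P LHI Pmax Pmin σm μ Ly) (hSA : G.SASetting ν η μ α₀ Γ y₀ c v)
    (hη : 0 < η) (hn : ∀ i, 0 < n i) (hx₀ : x₀ ∈ G.XX) (t : ℕ → ℕ) {γ : ℕ → ℝ} {S : ℕ}
    (hS : 0 < S) {εup : ℝ} (hεup : 0 < εup) (hZ : ∀ j, Measurable (Z j))
    (hlaw : ∀ j, Q.map (Z j) = drawLaw ν (n j.2.1) η) (hind : iIndepFun Z Q) {T : ℕ} (hT : 1 ≤ T)
    (hγ : ∀ k ∈ Finset.Icc 1 T, γ k = 1 / (2 * LHI)) {R : Ω → ℕ} (hR : Measurable R)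
    (hunif : ∀ k ∈ Finset.Icc 1 T, Q.real (R ⁻¹' {k}) = 1 / (T : ℝ))
    (hRZ : IndepFun R (fun ω j => Z j ω) Q) :
    Integrable (fun ω => ‖G.residual ν η (γ (R ω))
      (G.iterate η α₀ Γ y₀ t γ S x₀ (fun j => Z j ω) (R ω))‖ ^ 2) Q ∧
    ∫ ω, ‖G.residual ν η (γ (R ω))
      (G.iterate η α₀ Γ y₀ t γ S x₀ (fun j => Z j ω) (R ω))‖ ^ 2 ∂Q ≤
      (1 / (T : ℝ)) * (4 * LHI * (Pmax - Pmin) + ∑ k ∈ Finset.Icc 1 T,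
        N * (2 * sigmaHI n L Ly η σm εup ^ 2 / S +
          8 * biasHI n Ly η (G.inexactness μ α₀ Γ y₀ c v (t k)) ^ 2)) := by
  set φ : ℕ → (∀ j : ℕ × Fin N × ℕ, Draw Ξ (n j.2.1)) → ℝ := fun k w =>
    ‖G.residual ν η (γ k) (G.iterate η α₀ Γ y₀ t γ S x₀ w k)‖ ^ 2 with hφdef
  have hZm : Measurable fun ω j => Z j ω := measurable_pi_lambda _ hZ
  have hφ : ∀ k, Measurable (φ k) := fun k => by
    have h1 := hG.measurable_iterate hSA.y₀_mem α₀ Γ t γ S hx₀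
      (Z := fun j (w : ∀ j : ℕ × Fin N × ℕ, Draw Ξ (n j.2.1)) => w j) (k := k)
      fun j _ => measurable_pi_apply j
    have h2 := ((hG.continuous_residual hD hη hn (γ k)).measurable.comp h1).norm.pow_const 2
    exact h2
  have hmem : ∀ w k, G.iterate η α₀ Γ y₀ t γ S x₀ w k ∈ G.XX :=
    hG.iterate_mem α₀ Γ y₀ t γ S hx₀
  have hB : ∀ k ∈ Finset.Icc 1 T, ∀ w, |φ k w| ≤ 4 * LHI * (Pmax - Pmin) := fun k hk w => by
    rw [abs_of_nonneg (sq_nonneg _), hφdef]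
    simp only
    rw [hγ k hk]
    exact hG.norm_residual_sq_le_of_potential hD hη hn (hmem w k)
  obtain ⟨h1, h2⟩ := integral_uniform_index hR hZm hRZ hT hunif (fun k _ => hφ k) hB
  refine ⟨h1, ?_⟩
  have hi : ∀ k ∈ Finset.Icc 1 T, Integrable (fun ω => φ k fun j => Z j ω) Q := fun k hk =>
    Integrable.of_bound ((hφ k).comp hZm).aestronglyMeasurable _ (.of_forall fun ω => hB k hk _)
  have herr := fun k => hG.integral_norm_batch_sub_sq_le hD hSA hη hn hx₀ t γ hS hεup hZ hlaw hind k
  set e : ℕ → Ω → Profile n := fun k ω =>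
    G.batch η α₀ Γ y₀ t S (G.iterate η α₀ Γ y₀ t γ S x₀ (fun j => Z j ω) k) (fun j => Z j ω) k -
      G.Fη ν η (G.iterate η α₀ Γ y₀ t γ S x₀ (fun j => Z j ω) k)
  rw [h2]
  refine mul_le_mul_of_nonneg_left ?_ (by positivity)
  rw [← integral_finsetSum _ hi]
  have hpt : ∀ ω, ∑ k ∈ Finset.Icc 1 T, φ k (fun j => Z j ω) ≤
      4 * LHI * (Pmax - Pmin) + ∑ k ∈ Finset.Icc 1 T, ‖e k ω‖ ^ 2 := by
    intro ω
    set x : ℕ → Profile n := G.iterate η α₀ Γ y₀ t γ S x₀ (fun j => Z j ω)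
    have hstep : ∀ k ∈ Finset.Icc 1 T, φ k (fun j => Z j ω) ≤
        4 * LHI * (P (x k) - P (x (k + 1))) + ‖e k ω‖ ^ 2 := fun k hk => by
      have h := hG.norm_residual_sq_le hD hη hn (hmem (fun j => Z j ω) k)
        (d := G.batch η α₀ Γ y₀ t S (x k) (fun j => Z j ω) k)
      rw [← hγ k hk] at h
      exact h
    refine (Finset.sum_le_sum hstep).trans ?_
    rw [Finset.sum_add_distrib, ← Finset.mul_sum]
    refine add_le_add_left (mul_le_mul_of_nonneg_left ?_ (by linarith [hD.LHI_pos])) _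
    -- The sum begins at `x^1`, so the step from `x^0`, whose stepsize is unrestricted, does not
    -- enter.
    have htel : ∑ k ∈ Finset.Icc 1 T, (P (x k) - P (x (k + 1))) = P (x 1) - P (x (T + 1)) := by
      rw [← Finset.Ico_add_one_right_eq_Icc, Finset.sum_Ico_eq_sum_range]
      have h := Finset.sum_range_sub' (fun j => P (x (1 + j))) T
      rwa [add_zero, add_comm 1 T] at h
    rw [htel]
    exact sub_le_sub (hD.isGreatest.2 ⟨_, hmem _ 1, rfl⟩) (hD.isLeast.2 ⟨_, hmem _ (T + 1), rfl⟩)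
  have hie : Integrable (fun ω => ∑ k ∈ Finset.Icc 1 T, ‖e k ω‖ ^ 2) Q :=
    integrable_finsetSum _ fun k _ => (herr k).1
  calc ∫ ω, ∑ k ∈ Finset.Icc 1 T, φ k (fun j => Z j ω) ∂Q ≤
        ∫ ω, (4 * LHI * (Pmax - Pmin) + ∑ k ∈ Finset.Icc 1 T, ‖e k ω‖ ^ 2) ∂Q :=
        integral_mono (integrable_finsetSum _ hi) ((integrable_const _).add hie) hpt
    _ = 4 * LHI * (Pmax - Pmin) + ∑ k ∈ Finset.Icc 1 T, ∫ ω, ‖e k ω‖ ^ 2 ∂Q := by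
        rw [integral_add (integrable_const _) hie, integral_finsetSum _ fun k _ => (herr k).1,
          integral_const, probReal_univ, one_smul]
    _ ≤ _ := by
        gcongr with k _
        exact (herr k).2

end Scheme

/-! ### Constants, batch size and iteration count. -/

section Numerics

variable {N : ℕ}

theorem sigmaHI_pos {n : Fin N → ℕ} {L Ly : Fin N → ℝ≥0} {η σm εup : ℝ} (hσm : 0 < σm)
    (hεup : 0 < εup) : 0 < sigmaHI n L Ly η σm εup :=
  Real.sqrt_pos.2 (by positivity)

/-- The first term of `sigmaHI` squared is four times the squared bias at `εup`. -/
theorem biasHI_sq_le {n : Fin N → ℕ} {L Ly : Fin N → ℝ≥0} {η σm εup ε : ℝ}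
    (hε0 : 0 ≤ ε) (hε : ε ≤ εup) :
    biasHI n Ly η ε ^ 2 ≤ sigmaHI n L Ly η σm εup ^ 2 / 4 := by
  have hεup : 0 ≤ εup := hε0.trans hε
  have h1 : biasHI n Ly η ε ^ 2 ≤
      ((⨆ i, n i : ℕ) : ℝ) ^ 2 * ((⨆ i, Ly i : ℝ≥0) : ℝ) ^ 2 * εup / η ^ 2 := by
    rw [biasHI, mul_pow, mul_pow, mul_pow, Real.sq_sqrt hε0, inv_pow]
    calc _ = ((⨆ i, n i : ℕ) : ℝ) ^ 2 * ((⨆ i, Ly i : ℝ≥0) : ℝ) ^ 2 * ε / η ^ 2 := by ring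
      _ ≤ _ := by gcongr
  have h2 : 0 ≤ 64 * √(2 * Real.pi) * ((⨆ i, L i : ℝ≥0) : ℝ) ^ 2 * ((⨆ i, n i : ℕ) : ℝ) := by
    positivity
  rw [sigmaHI, Real.sq_sqrt (by positivity)]
  linarith [sq_nonneg σm, mul_div_assoc (4 * ((⨆ i, n i : ℕ) : ℝ) ^ 2 *
    ((⨆ i, Ly i : ℝ≥0) : ℝ) ^ 2) εup (η ^ 2), mul_div_assoc (((⨆ i, n i : ℕ) : ℝ) ^ 2 *
    ((⨆ i, Ly i : ℝ≥0) : ℝ) ^ 2) εup (η ^ 2)]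

theorem iterLimit_eq (S M₀ M₁ : ℕ) :
    iterLimit N S M₀ M₁ = ⌊budget M₀ M₁ / ((S : ℝ) * N)⌋₊ := by
  rw [iterLimit, budget, ← Nat.floor_mono.map_min, min_div_div_right (by positivity)]

theorem batchSize_pos_of_iterLimit {S M₀ M₁ : ℕ} (hT : 1 ≤ iterLimit N S M₀ M₁) : 0 < S := by
  rcases Nat.eq_zero_or_pos S with rfl | h
  · simp [iterLimit] at hT
  · exact h

/-- If the integer part of `y` is at least 1, then `y < ⌊y⌋ + 1 ≤ 2⌊y⌋`. -/
theorem le_budget_of_iterLimit (hN : 0 < N) {S M₀ M₁ : ℕ} (hT : 1 ≤ iterLimit N S M₀ M₁) :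
    (S : ℝ) * N ≤ budget M₀ M₁ ∧
      budget M₀ M₁ ≤ 2 * (S * N) * (iterLimit N S M₀ M₁ : ℝ) := by
  have hS : (0 : ℝ) < S := Nat.cast_pos.2 (batchSize_pos_of_iterLimit hT)
  have hSN : (0 : ℝ) < S * N := mul_pos hS (Nat.cast_pos.2 hN)
  have hT' : (1 : ℝ) ≤ iterLimit N S M₀ M₁ := Nat.one_le_cast.2 hT
  have h2 := Nat.lt_floor_add_one (budget M₀ M₁ / ((S : ℝ) * N))
  rw [← iterLimit_eq, div_lt_iff₀ hSN] at h2
  rw [iterLimit_eq, Nat.one_le_floor_iff, one_le_div hSN] at hT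
  exact ⟨hT, by nlinarith⟩

/-- The batch size grows only like `√M`, so `S N ≤ M` once `√M` exceeds a constant `K`. The
threshold `2K²` allows for the halving of `M₀`. -/
theorem exists_one_le_iterLimit (hN : 0 < N) {σ L D : ℝ} (hσ : 0 < σ) (hL : 0 < L)
    (hD : 0 < D) : ∃ Mbar : ℕ, ∀ M₀ M₁ : ℕ, Mbar ≤ M₀ → Mbar ≤ M₁ →
      1 ≤ iterLimit N (batchSize σ L D (budget M₀ M₁)) M₀ M₁ := by
  set C : ℝ := σ * √6 / (4 * L * D)
  have hC : 0 < C := by positivity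
  set K : ℝ := N * (C + 1) + 1
  have hK : 1 ≤ K := by simp only [K]; linarith [show 0 ≤ (N : ℝ) * (C + 1) by positivity]
  refine ⟨⌈2 * K ^ 2⌉₊, fun M₀ M₁ h0 h1 => ?_⟩
  have h0' : 2 * K ^ 2 ≤ M₀ := Nat.ceil_le.1 h0
  have h1' : 2 * K ^ 2 ≤ M₁ := Nat.ceil_le.1 h1
  set M := budget M₀ M₁
  have hM : K ^ 2 ≤ M := le_min (by linarith) (by nlinarith)
  have hr : K ≤ √M := Real.le_sqrt_of_sq_le hM
  have hM0 : 0 < M := by nlinarith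
  have hq : σ * √(6 * M) / (4 * L * D) = C * √M := by
    rw [Real.sqrt_mul (by norm_num)]
    simp only [C]
    ring
  have hr0 : 0 < √M := Real.sqrt_pos.2 hM0
  have hS : 0 < batchSize σ L D M := Nat.ceil_pos.2 (by rw [hq]; positivity)
  have hS' : (batchSize σ L D M : ℝ) < C * √M + 1 := by
    rw [← hq]
    exact Nat.ceil_lt_add_one (by rw [hq]; positivity)
  have hN' : (0 : ℝ) < N := Nat.cast_pos.2 hN
  rw [iterLimit_eq, Nat.one_le_floor_iff, one_le_div (mul_pos (Nat.cast_pos.2 hS) hN')]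
  calc (batchSize σ L D M : ℝ) * N ≤ (C * √M + √M) * N :=
        mul_le_mul_of_nonneg_right (by linarith) hN'.le
    _ = (N * (C + 1)) * √M := by ring
    _ ≤ √M * √M := mul_le_mul_of_nonneg_right (by linarith) hr0.le
    _ = M := Real.mul_self_sqrt hM0.le

/-- The complexity bound implied by the choice of the batch size. -/
theorem rate_le {σ L D M : ℝ} (hσ : 0 < σ) (hL : 0 < L) (hD : 0 < D) (hM : 0 < M) {S T : ℕ}
    (hS : S = batchSize σ L D M) (hT : 1 ≤ T)
    (hMT : M ≤ 2 * (S * N) * T) {b : ℕ → ℝ}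
    (hb0 : ∀ k, 0 ≤ b k) (hb : ∀ k, b k ≤ σ ^ 2 / 4) :
    (1 / (T : ℝ)) * (4 * L * (L * D ^ 2) + ∑ k ∈ Finset.Icc 1 T,
        N * (2 * σ ^ 2 / S + 8 * b k)) ≤
      48 * L ^ 2 * D ^ 2 * N / M + (60 * √6 * L ^ 2 * D ^ 2 * N * σ +
        18 * √6 * (N : ℝ) ^ 2 * σ * ∑ k ∈ Finset.Icc 1 T, b k) / (L * D * √M) := by
  have hT' : (0 : ℝ) < T := Nat.cast_pos.2 hT
  set r := √M
  set s := √6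
  have hr : 0 < r := Real.sqrt_pos.2 hM
  have hs : 0 < s := Real.sqrt_pos.2 (by norm_num)
  have hs2 : s ^ 2 = 6 := Real.sq_sqrt (by norm_num)
  have hrM : M = r ^ 2 := (Real.sq_sqrt hM.le).symm
  set q : ℝ := σ * (s * r) / (4 * L * D) with hqdef
  have hq : 0 < q := by positivity
  have hSq : S = ⌈q⌉₊ := by
    rw [hS, batchSize, Real.sqrt_mul (by norm_num)]
  have hS1 : q ≤ S := by rw [hSq]; exact Nat.le_ceil q
  have hS2 : (S : ℝ) ≤ q + 1 := by rw [hSq]; exact (Nat.ceil_lt_add_one hq.le).le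
  have hinv : 1 / (T : ℝ) ≤ 2 * (S * N) / M := by
    rw [div_le_div_iff₀ hT' hM]
    linarith
  set B := ∑ k ∈ Finset.Icc 1 T, b k
  have hB0 : 0 ≤ B := Finset.sum_nonneg fun k _ => hb0 k
  have hBT : B ≤ T * (σ ^ 2 / 4) := by
    refine (Finset.sum_le_sum fun k _ => hb k).trans ?_
    simp
  have hLHS : (1 / (T : ℝ)) * (4 * L * (L * D ^ 2) + ∑ k ∈ Finset.Icc 1 T,
      N * (2 * σ ^ 2 / S + 8 * b k)) =
      4 * L ^ 2 * D ^ 2 * (1 / (T : ℝ)) + 2 * N * σ ^ 2 / S + 8 * N * ((1 / (T : ℝ)) * B) := by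
    rw [← Finset.mul_sum, Finset.sum_add_distrib, ← Finset.mul_sum, Finset.sum_const,
      Nat.card_Icc, add_tsub_cancel_right, nsmul_eq_mul]
    change _ * (_ + _ * (_ + 8 * B)) = _
    field_simp
    ring
  -- In `S ≤ q + 1`, the rounding term 1 produces the `1/M` part and `q` the `1/√M` part.
  have t1 : 4 * L ^ 2 * D ^ 2 * (1 / (T : ℝ)) ≤
      8 * L ^ 2 * D ^ 2 * N / M + 2 * s * L * D * N * σ / r := by
    calc _ ≤ 4 * L ^ 2 * D ^ 2 * (2 * ((q + 1) * N) / M) := by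
          refine mul_le_mul_of_nonneg_left (hinv.trans ?_) (by positivity)
          gcongr
      _ = _ := by
          rw [hrM, hqdef]
          field_simp
          ring
  have t2 : 2 * N * σ ^ 2 / S ≤ 2 * s * L * D * N * σ / r := by
    calc _ ≤ 2 * N * σ ^ 2 / q := by gcongr
      _ = 8 / s ^ 2 * (s * L * D * N * σ / r) := by
          rw [hqdef]
          field_simp
          ring
      _ ≤ 2 * (s * L * D * N * σ / r) := by
          refine mul_le_mul_of_nonneg_right ?_ (by positivity)
          rw [hs2]
          norm_num
      _ = _ := by ring
  -- If `q ≥ 1`, then `S ≤ 2q` and the bias sum keeps its coefficient of order `1/√M`. If `q < 1`,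
  -- each `b k` is replaced by `σ²/4`, and `q < 1` itself says that `σ²` is at most of order
  -- `L²D²/M`.
  have t3 : 8 * N * ((1 / (T : ℝ)) * B) ≤
      6 * L ^ 2 * D ^ 2 * N / M + 8 * s * (N : ℝ) ^ 2 * σ * B / (L * D * r) := by
    rcases le_or_gt 1 q with h | h
    · have e1 : 8 * N * ((1 / (T : ℝ)) * B) ≤ 8 * s * (N : ℝ) ^ 2 * σ * B / (L * D * r) := by
        calc _ ≤ 8 * N * (2 * ((2 * q) * N) / M * B) := by
              refine mul_le_mul_of_nonneg_left ?_ (by positivity)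
              refine mul_le_mul_of_nonneg_right (hinv.trans ?_) hB0
              gcongr
              linarith
          _ = _ := by
              rw [hrM, hqdef]
              field_simp
              ring
      exact e1.trans (le_add_of_nonneg_left (by positivity))
    · have e1 : σ * (s * r) < 4 * L * D := by
        rwa [hqdef, div_lt_one (by positivity)] at h
      have e2 : σ ^ 2 * (6 * M) ≤ 16 * L ^ 2 * D ^ 2 := by
        calc σ ^ 2 * (6 * M) = (σ * (s * r)) ^ 2 := by rw [mul_pow, mul_pow, hs2, hrM]
          _ ≤ (4 * L * D) ^ 2 := pow_le_pow_left₀ (by positivity) e1.le 2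
          _ = _ := by ring
      have e3 : 8 * N * ((1 / (T : ℝ)) * B) ≤ 6 * L ^ 2 * D ^ 2 * N / M := by
        calc _ ≤ 8 * N * ((1 / (T : ℝ)) * (T * (σ ^ 2 / 4))) := by gcongr
          _ = 2 * N * σ ^ 2 := by field_simp; ring
          _ ≤ _ := by
              rw [le_div_iff₀ hM]
              nlinarith [mul_le_mul_of_nonneg_left e2 (Nat.cast_nonneg (α := ℝ) N),
                show 0 ≤ (N : ℝ) * (L ^ 2 * D ^ 2) by positivity]
      exact e3.trans (le_add_of_nonneg_right (by positivity))
  rw [hLHS]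
  have hR1 : (60 * s * L ^ 2 * D ^ 2 * N * σ + 18 * s * (N : ℝ) ^ 2 * σ * B) / (L * D * r) =
      60 * (s * L * D * N * σ / r) + 18 * (s * (N : ℝ) ^ 2 * σ * B / (L * D * r)) := by
    field_simp
  have hR2 : 48 * L ^ 2 * D ^ 2 * N / M = 48 * (L ^ 2 * D ^ 2 * N / M) := by ring
  have p1 : 0 ≤ s * L * D * N * σ / r := by positivity
  have p2 : 0 ≤ s * (N : ℝ) ^ 2 * σ * B / (L * D * r) := by positivity
  have p3 : 0 ≤ L ^ 2 * D ^ 2 * N / M := by positivity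
  rw [hR1, hR2]
  have r1 : 8 * L ^ 2 * D ^ 2 * N / M = 8 * (L ^ 2 * D ^ 2 * N / M) := by ring
  have r2 : 6 * L ^ 2 * D ^ 2 * N / M = 6 * (L ^ 2 * D ^ 2 * N / M) := by ring
  have r3 : 2 * s * L * D * N * σ / r = 2 * (s * L * D * N * σ / r) := by ring
  have r4 : 8 * s * (N : ℝ) ^ 2 * σ * B / (L * D * r) =
    8 * (s * (N : ℝ) ^ 2 * σ * B / (L * D * r)) := by ring
  rw [r1, r3] at t1
  rw [r3] at t2
  rw [r2, r4] at t3
  linarith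

end Numerics

end HierGame

/-! ### Convergence of the biased scheme. -/

theorem mainTheorem6
    {N : ℕ} (hN : 0 < N) {n κ : Fin N → ℕ} (hn : ∀ i, 0 < n i)
    {Ξ : Type*} [MeasurableSpace Ξ] (ν : Measure Ξ) [IsProbabilityMeasure ν]
    (G : HierGame.Game n κ Ξ) (η : ℝ) (hη : 0 < η)
    (L Ly : Fin N → ℝ≥0) (P : HierGame.Profile n → ℝ) (LHI Pmax Pmin σm : ℝ) (μ : Fin N → ℝ)
    (hstanding : G.Standing ν η L)
    (hD : G.Assumptions ν η P LHI Pmax Pmin σm μ Ly)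
    (hP : Pmin < Pmax)
    (α₀ Γ : ℝ) (y₀ : ∀ i, HierGame.Eu (κ i)) (c v : Fin N → ℝ)
    (hSA : G.SASetting ν η μ α₀ Γ y₀ c v)
    (t : ℕ → ℕ) (εup : ℝ) (hεup : 0 < εup)
    (hε : ∀ k, G.inexactness μ α₀ Γ y₀ c v (t k) ≤ εup)
    (x₀ : HierGame.Profile n) (hx₀ : x₀ ∈ G.XX)
    {Ω : Type*} [MeasurableSpace Ω] (Q : Measure Ω) [IsProbabilityMeasure Q]
    (Z : ∀ j : ℕ × Fin N × ℕ, Ω → HierGame.Draw Ξ (n j.2.1))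
    (hZmeas : ∀ j, Measurable (Z j))
    (hZlaw : ∀ j, Q.map (Z j) = HierGame.drawLaw ν (n j.2.1) η)
    (hZindep : iIndepFun Z Q) :
    let D : ℝ := HierGame.DHI LHI Pmax Pmin
    let σ : ℝ := HierGame.sigmaHI n L Ly η σm εup
    let S : ℕ → ℕ → ℕ := fun M₀ M₁ =>
      HierGame.batchSize σ LHI D (HierGame.budget M₀ M₁)
    let T : ℕ → ℕ → ℕ := fun M₀ M₁ => HierGame.iterLimit N (S M₀ M₁) M₀ M₁
    -- at least one iteration is affordable once both numbers of oracle calls are large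
    (∃ Mbar : ℕ, ∀ M₀ M₁ : ℕ, Mbar ≤ M₀ → Mbar ≤ M₁ → 1 ≤ T M₀ M₁) ∧
    ∀ M₀ M₁ : ℕ, 1 ≤ T M₀ M₁ →
      ∀ γ : ℕ → ℝ, (∀ k ∈ Finset.Icc 1 (T M₀ M₁), γ k = 1 / (2 * LHI)) →
      ∀ R : Ω → ℕ, Measurable R →
        (∀ k ∈ Finset.Icc 1 (T M₀ M₁), Q.real (R ⁻¹' {k}) = 1 / (T M₀ M₁ : ℝ)) →
        IndepFun R (fun ω j => Z j ω) Q →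
        let M : ℝ := HierGame.budget M₀ M₁
        let xR : Ω → HierGame.Profile n := fun ω =>
          G.iterate η α₀ Γ y₀ t γ (S M₀ M₁) x₀ (fun j => Z j ω) (R ω)
        Integrable (fun ω => ‖G.residual ν η (γ (R ω)) (xR ω)‖ ^ 2) Q ∧
        ∫ ω, ‖G.residual ν η (γ (R ω)) (xR ω)‖ ^ 2 ∂Q ≤
          48 * LHI ^ 2 * D ^ 2 * N / M +
            (60 * √6 * LHI ^ 2 * D ^ 2 * N * σ +
              18 * √6 * (N : ℝ) ^ 2 * σ * ∑ k ∈ Finset.Icc 1 (T M₀ M₁),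
                HierGame.biasHI n Ly η (G.inexactness μ α₀ Γ y₀ c v (t k)) ^ 2) /
              (LHI * D * √M) := by
  intro D σ S T
  have hL := hD.LHI_pos
  have hσ : 0 < σ := HierGame.sigmaHI_pos hD.σm_pos hεup
  have hDpos : 0 < D := Real.sqrt_pos.2 (div_pos (sub_pos.2 hP) hL)
  have hD2 : LHI * D ^ 2 = Pmax - Pmin := by
    rw [show D ^ 2 = (Pmax - Pmin) / LHI from
      Real.sq_sqrt (div_pos (sub_pos.2 hP) hL).le, mul_div_cancel₀ _ hL.ne']
  refine ⟨HierGame.exists_one_le_iterLimit hN hσ hL hDpos, fun M₀ M₁ hT γ hγ R hR hunif hRZ => ?_⟩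
  intro M xR
  have hS : 0 < S M₀ M₁ := HierGame.batchSize_pos_of_iterLimit hT
  obtain ⟨hM1, hM2⟩ := HierGame.le_budget_of_iterLimit hN hT
  have hM : 0 < M := lt_of_lt_of_le (mul_pos (Nat.cast_pos.2 hS) (Nat.cast_pos.2 hN)) hM1
  have hε0 : ∀ k, 0 ≤ G.inexactness μ α₀ Γ y₀ c v (t k) := fun k =>
    HierGame.Game.inexactness_nonneg (fun i => by
      have h1 := hSA.α₀_gt i
      have h2 := hD.μ_pos i
      rw [div_lt_iff₀ (by positivity)] at h1
      linarith) hSA.Γ_pos _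
  obtain ⟨h1, h2⟩ := hstanding.integral_residual_le hD hSA hη hn hx₀ t hS hεup hZmeas hZlaw hZindep
    hT hγ hR hunif hRZ
  refine ⟨h1, h2.trans ?_⟩
  rw [← hD2]
  exact HierGame.rate_le hσ hL hDpos hM rfl hT hM2 (fun k => sq_nonneg _)
    fun k => HierGame.biasHI_sq_le (hε0 k) (hε k)
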